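/- Let $G=(V,E)$ be a finite simple undirected graph with $V=\{0,\dots,n-1\}$ and $m=|E|$, let $d(v)\in\mathbb{Z}_{\ge 0}$ ($v\in V$) be demands, let $d^*=\max_{v\in V} d(v)$, and let $n_0$ be the number of isolated vertices of $G$. A set $S\subseteq V$ is a total vector dominating set if every vertex $v\in V$, whether or not it lies in $S$, has at least $d(v)$ neighbours in $S$. A branch decomposition of $G$ is a pair $(T,\tau)$ in which $T$ is a tree all of whose non-leaf nodes have degree $3$ and $\tau$ is a bijection from $E$ to the set of leaves of $T$ (the node of a one-node tree counts as a leaf). For an edge $f$ of $T$, let $w(f)\subseteq V$ be the set of vertices that are incident to two edges of $G$ whose leaves lie in different components of $T-f$. The width of $(T,\tau)$ is $\max_f |w(f)|$, and it is $0$ if $T$ has no edge. Theorem. There are a fixed random access program (natural-number variables and arrays; assignments, additions, truncated subtractions, array reads and writes, and comparisons, each at unit cost; no multiplication) and an absolute constant $C$ such that the following holds. Given $G$ and $T$ by their edge lists, the demands $d$, and $\tau$, where $(T,\tau)$ is a branch decomposition of $G$ of width $b$, the program halts after at most $$C\left(2^{3b/2}\,(d^*+1)^{2b}\,m+n_0\right)$$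 steps and outputs a total vector dominating set of minimum cardinality, or reports that there is none if $G$ has no total vector dominating set. In particular, if $G$ has no isolated vertices, the running time is $O\!\left(2^{3b/2}(d^*+1)^{2b}m\right)$. -/

import Mathlib

/-! Total vector domination, branch decompositions, and random access programs with a step count. -/

namespace TVD

/-! ## Total vector dominating sets -/

/-- `S` is a total vector dominating set of `G` for the demand vector `d`: every vertex, whether or
not it lies in `S`, has at least `d v` neighbours in `S`. -/
def IsTotalVectorDominating {V : Type*} (G : SimpleGraph V) (d : V → ℕ) (S : Set V) : Prop :=
  ∀ v : V, d v ≤ (G.neighborSet v ∩ S).ncard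

/-- `S` is a total vector dominating set of minimum cardinality. -/
def IsMinTotalVectorDominating {V : Type*} (G : SimpleGraph V) (d : V → ℕ) (S : Set V) : Prop :=
  IsTotalVectorDominating G d S ∧
    ∀ S' : Set V, IsTotalVectorDominating G d S' → S.ncard ≤ S'.ncard

/-- The maximum demand (`0` if there are no vertices). -/
def maxDemand {V : Type*} [Fintype V] (d : V → ℕ) : ℕ :=
  Finset.univ.sup d

/-- The number of edges. -/
noncomputable def numEdges {V : Type*} (G : SimpleGraph V) : ℕ :=
  G.edgeSet.ncard

/-- The number of isolated vertices. -/
noncomputable def numIsolated {V : Type*} (G : SimpleGraph V) : ℕ :=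
  {v : V | ∀ u : V, ¬ G.Adj v u}.ncard

/-! ## Branch decompositions -/

/-- A leaf of a tree. In a tree with at least two nodes this means degree exactly `1`; the node of
a one-node tree counts as a leaf, so that a graph with one edge has a branch decomposition. -/
def IsLeaf {W : Type*} (T : SimpleGraph W) (x : W) : Prop :=
  (T.neighborSet x).ncard ≤ 1

/-- A branch decomposition of `G` whose tree has the node set `W`. -/
structure BranchDecomposition {V : Type*} (G : SimpleGraph V) (W : Type*) where
  /-- the tree -/
  tree : SimpleGraph W
  isTree : tree.IsTree
  /-- every non-leaf node has degree three -/
  degree_eq_three : ∀ x : W, ¬ IsLeaf tree x → (tree.neighborSet x).ncard = 3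
  /-- the bijection from the edges of `G` to the leaves of the tree -/
  leafOf : G.edgeSet ≃ {x : W // IsLeaf tree x}

/-- The order function at a tree edge `f`: the vertices that are incident both to an edge of `G`
whose leaf is in one of the two components of the tree without `f`, and to an edge of `G` whose leaf
is in the other component. -/
def BranchDecomposition.order {V : Type*} {G : SimpleGraph V} {W : Type*}
    (B : BranchDecomposition G W) (f : B.tree.edgeSet) : Set V :=
  {v : V | ∃ e e' : G.edgeSet, v ∈ (e : Sym2 V) ∧ v ∈ (e' : Sym2 V) ∧
    ¬ (B.tree.deleteEdges {(f : Sym2 W)}).Reachable (B.leafOf e : W) (B.leafOf e' : W)}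

/-- The width, `max |order f|` over the tree edges `f` (`0` if the tree has no edge). It is used
with a finite node set only. -/
noncomputable def BranchDecomposition.width {V : Type*} {G : SimpleGraph V} {W : Type*}
    (B : BranchDecomposition G W) : ℕ :=
  ⨆ f : B.tree.edgeSet, (B.order f).ncard

/-! ## Random access programs

A program uses natural-number variables and one-way infinite arrays of natural numbers, both named
by numbers. It is a finite piece of syntax, so it mentions only finitely many variables and arrays,
which are fixed independently of the data. Every assignment and every evaluation of a test costs one
step (uniform cost). The arithmetic operations are addition and truncated subtraction; there is no
multiplication. -/

/-- The contents of all variables and arrays. -/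
structure State where
  var : ℕ → ℕ
  arr : ℕ → ℕ → ℕ

/-- Assign the value `a` to the variable `x`. -/
def State.setVar (s : State) (x a : ℕ) : State :=
  { s with var := Function.update s.var x a }

/-- Assign the value `a` to the cell with index `i` of the array `A`. -/
def State.setArr (s : State) (A i a : ℕ) : State :=
  { s with arr := Function.update s.arr A (Function.update (s.arr A) i a) }

/-- Programs. Here `x`, `y`, `z` name variables, `A` names an array, and `c` is a constant. -/
inductive Program : Type
  /-- do nothing -/
  | skip : Program
  /-- `x := c` -/
  | const (x c : ℕ) : Program
  /-- `x := y` -/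
  | copy (x y : ℕ) : Program
  /-- `x := y + z` -/
  | add (x y z : ℕ) : Program
  /-- `x := max (y - z) 0` -/
  | sub (x y z : ℕ) : Program
  /-- `x := A[y]` -/
  | load (x A y : ℕ) : Program
  /-- `A[x] := y` -/
  | store (A x y : ℕ) : Program
  /-- first `p`, then `q` -/
  | seq (p q : Program) : Program
  /-- if `x < y` then `p` else `q` -/
  | ite (x y : ℕ) (p q : Program) : Program
  /-- while `x < y` do `p` -/
  | loop (x y : ℕ) (p : Program) : Program

/-- `Exec p s t s'`: started in the state `s`, the program `p` halts after exactly `t` steps in the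
state `s'`. -/
inductive Exec : Program → State → ℕ → State → Prop
  | skip (s : State) : Exec .skip s 1 s
  | const (s : State) (x c : ℕ) : Exec (.const x c) s 1 (s.setVar x c)
  | copy (s : State) (x y : ℕ) : Exec (.copy x y) s 1 (s.setVar x (s.var y))
  | add (s : State) (x y z : ℕ) : Exec (.add x y z) s 1 (s.setVar x (s.var y + s.var z))
  | sub (s : State) (x y z : ℕ) : Exec (.sub x y z) s 1 (s.setVar x (s.var y - s.var z))
  | load (s : State) (x A y : ℕ) : Exec (.load x A y) s 1 (s.setVar x (s.arr A (s.var y)))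
  | store (s : State) (A x y : ℕ) : Exec (.store A x y) s 1 (s.setArr A (s.var x) (s.var y))
  | seq {p q : Program} {s s' s'' : State} {t t' : ℕ} :
      Exec p s t s' → Exec q s' t' s'' → Exec (.seq p q) s (t + t') s''
  | ite_true {x y : ℕ} {p q : Program} {s s' : State} {t : ℕ} :
      s.var x < s.var y → Exec p s t s' → Exec (.ite x y p q) s (1 + t) s'
  | ite_false {x y : ℕ} {p q : Program} {s s' : State} {t : ℕ} :
      ¬ s.var x < s.var y → Exec q s t s' → Exec (.ite x y p q) s (1 + t) s'
  | loop_true {x y : ℕ} {p : Program} {s s' s'' : State} {t t' : ℕ} :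
      s.var x < s.var y → Exec p s t s' → Exec (.loop x y p) s' t' s'' →
      Exec (.loop x y p) s (1 + t + t') s''
  | loop_false {x y : ℕ} {p : Program} {s : State} :
      ¬ s.var x < s.var y → Exec (.loop x y p) s 1 s

/-! ## Input and output -/

/-- A listing of the edges of a graph `H`, in any order and with the two ends of every edge in any
order. -/
structure EdgeListing {V : Type*} (H : SimpleGraph V) where
  num : ℕ
  edge : Fin num ≃ H.edgeSet
  fst : Fin num → V
  snd : Fin num → V
  mk_eq : ∀ i, s(fst i, snd i) = (edge i : Sym2 V)

/-- The array that starts with the given values and is `0` afterwards. -/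
def toArray {k : ℕ} (f : Fin k → ℕ) : ℕ → ℕ :=
  fun i => if h : i < k then f ⟨i, h⟩ else 0

/-- The state in which a program receives the graph `G` on the vertices `0, …, n - 1`, the demands
`d`, and the branch decomposition `B` with the tree nodes `0, …, N - 1`.

The variables `0, 1, 2, 3` hold the number of vertices, of edges, of tree nodes, and of tree edges.
The array `0` holds the demands, the arrays `1` and `2` hold the ends of the edges of `G`, the array
`3` holds the leaf of each edge of `G`, and the arrays `4` and `5` hold the ends of the tree edges.
Everything else is `0`. -/
def inputState {n N : ℕ} {G : SimpleGraph (Fin n)} (d : Fin n → ℕ)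
    (B : BranchDecomposition G (Fin N)) (L : EdgeListing G) (K : EdgeListing B.tree) : State where
  var x :=
    match x with
    | 0 => n
    | 1 => L.num
    | 2 => N
    | 3 => K.num
    | _ => 0
  arr A :=
    match A with
    | 0 => toArray d
    | 1 => toArray fun i => (L.fst i : ℕ)
    | 2 => toArray fun i => (L.snd i : ℕ)
    | 3 => toArray fun i => ((B.leafOf (L.edge i) : Fin N) : ℕ)
    | 4 => toArray fun j => (K.fst j : ℕ)
    | 5 => toArray fun j => (K.snd j : ℕ)
    | _ => fun _ => 0

/-- The set of vertices that a final state describes: the array `6` is its indicator. -/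
def outputSet (n : ℕ) (s : State) : Set (Fin n) :=
  {v : Fin n | s.arr 6 v ≠ 0}

/-- The answer in a final state is correct: either the variable `0` is `1` and the output set is a
minimum total vector dominating set, or the variable `0` is `0` and there is no total vector
dominating set at all. -/
def CorrectOutput {n : ℕ} (G : SimpleGraph (Fin n)) (d : Fin n → ℕ) (s : State) : Prop :=
  (s.var 0 = 1 ∧ IsMinTotalVectorDominating G d (outputSet n s)) ∨
    (s.var 0 = 0 ∧ ∀ S : Set (Fin n), ¬ IsTotalVectorDominating G d S)

end TVD

namespace TVD

/-! ## Reasoning about programs -/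

/-! The program is a dynamic programme over sets of edges. Let `A` be a set of edges and `X` a set
of vertices of `A` that contains every vertex with edges both in `A` and outside. A vertex set `S`
acts on the rest of the graph only through its behaviour at `X`: for each `v` in `X`, whether `v` is
selected, and the number of its selected neighbours along `A`, truncated at the demand. For every
behaviour, `best A X` holds the least weight outside `X` of a set that meets the demands of the
vertices of `A` outside `X`. Behaviours of disjoint `A` and `B` that select the same common vertices
can be glued, and their counts add up; a vertex whose edges have all been used leaves the list, and
only then is its demand tested and its weight charged. This is `best_joined`.

Uniting `A`, `X` with `B`, `Y` means running through triples (σ, p, q) for the vertices of `X ∪ Y`: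
selected or not, count in `A`, count in `B`. A vertex outside `X` has no edge in `A`, so that p = 0
there, and likewise for `Y`; this leaves at most 2^|X ∪ Y| (d*+1)^(|X|+|Y|) choices. If `X` and `Y`
are the exact boundaries, every vertex of `X ∪ Y` lies in at least two of `X`, `Y` and the new
boundary, whence |X ∪ Y| ≤ 3b/2 (`two_mul_card_union_le`, `joinSize_le_sizeBound`). The list of
partial choices is built vertex by vertex and the bound for its length at least doubles each time,
so a geometric sum bounds the work by a constant times the final bound (`run_vertices`,
`run_merge`).

The tree is not rooted. A node with exactly one remaining neighbour is contracted into it, until one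
node is left. By `exists_cut` the leaves contracted into a node are separated from the others by at
most one tree edge, so every edge set that occurs has a boundary of size at most b
(`card_boundary_owned_le`). There are fewer than 3m nodes, hence O(m) unions.

Behaviours are coded as numbers in a mixed radix system and used as addresses. The address range of
a table is huge, but cells that are never touched cost nothing and are 0. The radices are powers of
two, so that place values arise by doubling; a preliminary test that no demand exceeds the degree
bounds the number of doublings by O(m + n). Vertex `v` weighs 2^n + 2^v: a lightest set has minimum
cardinality, and it can be read off from the binary digits of its weight, so no backtracking is
needed. -/

@[simp] theorem State.setVar_var (s : State) (x a y : ℕ) :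
    (s.setVar x a).var y = if y = x then a else s.var y := by
  simp [State.setVar, Function.update_apply]

@[simp] theorem State.setVar_arr (s : State) (x a : ℕ) : (s.setVar x a).arr = s.arr := rfl

@[simp] theorem State.setArr_var (s : State) (A i a : ℕ) : (s.setArr A i a).var = s.var := rfl

@[simp] theorem State.setArr_arr (s : State) (A i a A' : ℕ) :
    (s.setArr A i a).arr A' = if A' = A then Function.update (s.arr A) i a else s.arr A' := by
  simp only [State.setArr, Function.update_apply]

@[simp] theorem State.ite_var (c : Prop) [Decidable c] (s s' : State) (x : ℕ) :
    (if c then s else s').var x = if c then s.var x else s'.var x := by split_ifs <;> rfl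

@[simp] theorem State.ite_arr (c : Prop) [Decidable c] (s s' : State) (A : ℕ) :
    (if c then s else s').arr A = if c then s.arr A else s'.arr A := by split_ifs <;> rfl

namespace Program

/-- `p.writesVar x`: the program `p` contains an assignment to the variable `x`. -/
def writesVar : Program → ℕ → Bool
  | skip, _ => false
  | const y _, x => x == y
  | copy y _, x => x == y
  | add y _ _, x => x == y
  | sub y _ _, x => x == y
  | load y _ _, x => x == y
  | store _ _ _, _ => false
  | seq p q, x => p.writesVar x || q.writesVar x
  | ite _ _ p q, x => p.writesVar x || q.writesVar x
  | loop _ _ p, x => p.writesVar x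

/-- `p.writesArr A`: the program `p` contains an assignment to a cell of the array `A`. -/
def writesArr : Program → ℕ → Bool
  | store B _ _, A => A == B
  | seq p q, A => p.writesArr A || q.writesArr A
  | ite _ _ p q, A => p.writesArr A || q.writesArr A
  | loop _ _ p, A => p.writesArr A
  | _, _ => false

/-- The states `s` and `s'` agree on everything that `p` does not assign to. -/
structure Frame (p : Program) (s s' : State) : Prop where
  var : ∀ x, p.writesVar x = false → s'.var x = s.var x
  arr : ∀ A, p.writesArr A = false → s'.arr A = s.arr A

theorem Frame.rfl {p : Program} {s : State} : p.Frame s s := ⟨fun _ _ => by rfl, fun _ _ => by rfl⟩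

theorem Frame.trans {p : Program} {s s' s'' : State} (h : p.Frame s s') (h' : p.Frame s' s'') :
    p.Frame s s'' :=
  ⟨fun x hx => (h'.var x hx).trans (h.var x hx), fun A hA => (h'.arr A hA).trans (h.arr A hA)⟩

/-- The syntactic tests `writesVar` and `writesArr` evaluate, so for a concrete program the side
condition of a frame is closed by `rfl`. -/
theorem frame_of_exec {p : Program} {s s' : State} {t : ℕ} (h : Exec p s t s') :
    p.Frame s s' := by
  induction h with
  | skip | loop_false => exact Frame.rfl
  | const | copy | add | sub | load =>
    refine ⟨fun y hy => ?_, fun A _ => by simp⟩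
    simp only [writesVar, beq_eq_false_iff_ne] at hy
    simp [hy]
  | store =>
    refine ⟨fun y _ => by simp, fun A hA => ?_⟩
    simp only [writesArr, beq_eq_false_iff_ne] at hA
    simp [hA]
  | seq _ _ ih ih' =>
    refine Frame.trans (s' := _) ⟨fun x hx => ih.var x ?_, fun A hA => ih.arr A ?_⟩
      ⟨fun x hx => ih'.var x ?_, fun A hA => ih'.arr A ?_⟩ <;>
    simp_all [writesVar, writesArr]
  | ite_true _ _ ih | ite_false _ _ ih =>
    refine ⟨fun x hx => ih.var x ?_, fun A hA => ih.arr A ?_⟩ <;> simp_all [writesVar, writesArr]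
  | loop_true _ _ _ ih ih' =>
    exact Frame.trans ⟨fun x hx => ih.var x hx, fun A hA => ih.arr A hA⟩ ih'

/-- Sequential composition of a list of programs. -/
def block : List Program → Program
  | [] => skip
  | [p] => p
  | p :: q :: l => seq p (block (q :: l))

/-- The program contains no loop. -/
def loopFree : Program → Bool
  | seq p q => p.loopFree && q.loopFree
  | ite _ _ p q => p.loopFree && q.loopFree
  | loop _ _ _ => false
  | _ => true

/-- The effect of a loop-free program. -/
def ev : Program → State → State
  | skip, s => s
  | const x c, s => s.setVar x c
  | copy x y, s => s.setVar x (s.var y)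
  | add x y z, s => s.setVar x (s.var y + s.var z)
  | sub x y z, s => s.setVar x (s.var y - s.var z)
  | load x A y, s => s.setVar x (s.arr A (s.var y))
  | store A x y, s => s.setArr A (s.var x) (s.var y)
  | seq p q, s => q.ev (p.ev s)
  | ite x y p q, s => if s.var x < s.var y then p.ev s else q.ev s
  | loop _ _ _, s => s

/-- An upper bound for the number of steps of a loop-free program. -/
def cost : Program → ℕ
  | seq p q => p.cost + q.cost
  | ite _ _ p q => 1 + max p.cost q.cost
  | _ => 1

end Program

open Program

/-- Started in `s`, the program `p` halts after at most `T` steps in a state that satisfies `Q`. -/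
def Run (p : Program) (s : State) (T : ℕ) (Q : State → Prop) : Prop :=
  ∃ t s', Exec p s t s' ∧ t ≤ T ∧ Q s'

namespace Run

variable {p q : Program} {s : State} {T T' : ℕ} {Q R : State → Prop}

theorem mono (h : Run p s T Q) (hT : T ≤ T') (hQ : ∀ s', Q s' → R s') : Run p s T' R := by
  obtain ⟨t, s', he, ht, hq⟩ := h
  exact ⟨t, s', he, ht.trans hT, hQ _ hq⟩

theorem frame (h : Run p s T Q) : Run p s T (fun s' => Q s' ∧ p.Frame s s') := by
  obtain ⟨t, s', he, ht, hq⟩ := h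
  exact ⟨t, s', he, ht, hq, frame_of_exec he⟩

theorem mono_frame (h : Run p s T Q) (hT : T ≤ T')
    (hQ : ∀ s', Q s' → p.Frame s s' → R s') : Run p s T' R :=
  h.frame.mono hT fun s' hs => hQ s' hs.1 hs.2

theorem seq {T₁ T₂ : ℕ} (h : Run p s T₁ R)
    (h' : ∀ s', R s' → p.Frame s s' → Run q s' T₂ Q) (hT : T₁ + T₂ ≤ T) :
    Run (.seq p q) s T Q := by
  obtain ⟨t, s', he, ht, hr⟩ := h
  obtain ⟨t', s'', he', ht', hq⟩ := h' s' hr (frame_of_exec he)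
  exact ⟨t + t', s'', .seq he he', by omega, hq⟩

theorem of_loopFree (hp : p.loopFree = true) : Run p s p.cost (fun s' => s' = p.ev s) := by
  induction p generalizing s with
  | skip => exact ⟨1, s, .skip s, le_rfl, rfl⟩
  | const x c => exact ⟨1, _, .const s x c, le_rfl, rfl⟩
  | copy x y => exact ⟨1, _, .copy s x y, le_rfl, rfl⟩
  | add x y z => exact ⟨1, _, .add s x y z, le_rfl, rfl⟩
  | sub x y z => exact ⟨1, _, .sub s x y z, le_rfl, rfl⟩
  | load x A y => exact ⟨1, _, .load s x A y, le_rfl, rfl⟩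
  | store A x y => exact ⟨1, _, .store s A x y, le_rfl, rfl⟩
  | seq p q ih ih' =>
    simp only [loopFree, Bool.and_eq_true] at hp
    exact (ih hp.1).seq (fun s' hs' _ => hs' ▸ ih' hp.2) le_rfl
  | ite x y p q ih ih' =>
    simp only [loopFree, Bool.and_eq_true] at hp
    by_cases h : s.var x < s.var y
    · obtain ⟨t, s', he, ht, hq⟩ := ih hp.1 (s := s)
      exact ⟨1 + t, s', .ite_true h he, by simp only [cost]; omega, by simp [ev, h, hq]⟩
    · obtain ⟨t, s', he, ht, hq⟩ := ih' hp.2 (s := s)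
      exact ⟨1 + t, s', .ite_false h he, by simp only [cost]; omega, by simp [ev, h, hq]⟩
  | loop => simp [loopFree] at hp

/-- A loop-free program runs to the state given by `ev`. -/
theorem straight (hp : p.loopFree = true) (hT : p.cost ≤ T) (hQ : Q (p.ev s)) : Run p s T Q :=
  (of_loopFree hp).mono hT fun _ h => h ▸ hQ

theorem ite {x y : ℕ} (h : s.var x < s.var y → Run p s T Q)
    (h' : ¬ s.var x < s.var y → Run q s T Q) (hT : T + 1 ≤ T') :
    Run (.ite x y p q) s T' Q := by
  by_cases hxy : s.var x < s.var y
  · obtain ⟨t, s', he, ht, hq⟩ := h hxy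
    exact ⟨1 + t, s', .ite_true hxy he, by omega, hq⟩
  · obtain ⟨t, s', he, ht, hq⟩ := h' hxy
    exact ⟨1 + t, s', .ite_false hxy he, by omega, hq⟩

/-- A loop with an invariant that depends on a ghost value and with a potential function. -/
theorem whileLoop {α : Type*} {x y : ℕ} (I : α → State → Prop) (Φ : α → ℕ) {a : α} (h0 : I a s)
    (hb : ∀ a' s', I a' s' → p.Frame s s' → s'.var x < s'.var y →
      ∃ T a'', Run p s' T (I a'') ∧ Φ a'' + T + 1 ≤ Φ a') :
    Run (.loop x y p) s (Φ a + 1) (fun s' => ¬ s'.var x < s'.var y ∧ ∃ a', I a' s') := by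
  -- Induction on a bound for the potential. Every iteration lowers it by at least 1, so at bound 0
  -- the test of the loop must fail.
  have key : ∀ k a' s', Φ a' ≤ k → I a' s' → p.Frame s s' →
      Run (.loop x y p) s' (Φ a' + 1) (fun s' => ¬ s'.var x < s'.var y ∧ ∃ a', I a' s') := by
    intro k
    induction k with
    | zero =>
      intro a' s' hk hI hF
      by_cases hxy : s'.var x < s'.var y
      · obtain ⟨T, a'', -, h⟩ := hb a' s' hI hF hxy
        omega
      · exact ⟨1, s', .loop_false hxy, by omega, hxy, a', hI⟩
    | succ k ih =>
      intro a' s' hk hI hF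
      by_cases hxy : s'.var x < s'.var y
      · obtain ⟨T, a'', ⟨t, s'', he, ht, hI'⟩, h⟩ := hb a' s' hI hF hxy
        obtain ⟨t', s₃, he', ht', hq⟩ := ih a'' s'' (by omega) hI' (hF.trans (frame_of_exec he))
        exact ⟨1 + t + t', s₃, .loop_true hxy he he', by omega, hq⟩
      · exact ⟨1, s', .loop_false hxy, by omega, hxy, a', hI⟩
  exact key _ a s le_rfl h0 Frame.rfl

/-- A loop with `k` iterations, the `i`-th of which takes at most `f i` steps. -/
theorem forLoop {x y k : ℕ} (I : ℕ → State → Prop) (f : ℕ → ℕ) (h0 : I 0 s)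
    (hg : ∀ i s', i ≤ k → I i s' → p.Frame s s' → (s'.var x < s'.var y ↔ i < k))
    (hb : ∀ i s', i < k → I i s' → p.Frame s s' → Run p s' (f i) (I (i + 1)))
    (hT : 1 + ∑ i ∈ Finset.range k, (f i + 1) ≤ T) :
    Run (.loop x y p) s T (I k) := by
  have key : ∀ j i s', i + j = k → I i s' → p.Frame s s' →
      Run (.loop x y p) s' (1 + ∑ i ∈ Finset.Ico i k, (f i + 1)) (I k) := by
    intro j
    induction j with
    | zero =>
      intro i s' hk hI hF
      obtain rfl : i = k := by omega
      have := (hg i s' le_rfl hI hF).not.2 (lt_irrefl _)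
      exact ⟨1, s', .loop_false this, by omega, hI⟩
    | succ j ih =>
      intro i s' hk hI hF
      have hxy := (hg i s' (by omega) hI hF).2 (by omega)
      obtain ⟨t, s'', he, ht, hI'⟩ := hb i s' (by omega) hI hF
      obtain ⟨t', s₃, he', ht', hq⟩ := ih (i + 1) s'' (by omega) hI' (hF.trans (frame_of_exec he))
      refine ⟨1 + t + t', s₃, .loop_true hxy he he', ?_, hq⟩
      rw [Finset.sum_eq_sum_Ico_succ_bot (by omega)]
      omega
  refine (key k 0 s (by omega) h0 Frame.rfl).mono ?_ fun _ h => h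
  rwa [Nat.Ico_zero_eq_range]

/-- A loop with `k` iterations, each of which takes at most `c` steps. -/
theorem forLoop_const {x y k : ℕ} (I : ℕ → State → Prop) (c : ℕ) (h0 : I 0 s)
    (hg : ∀ i s', i ≤ k → I i s' → p.Frame s s' → (s'.var x < s'.var y ↔ i < k))
    (hb : ∀ i s', i < k → I i s' → p.Frame s s' → Run p s' c (I (i + 1)))
    (hT : 1 + k * (c + 1) ≤ T) :
    Run (.loop x y p) s T (I k) :=
  Run.forLoop I (fun _ => c) h0 hg hb (by simpa using hT)

end Run
end TVD

namespace TVD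
open Program

/-! ## Names of the variables and arrays -/

-- `big` holds the length of a table; `lp` and `op` are the first free addresses for lists and for
-- tables. A union works on the slots `y` and `x`, whose list start, list length and table offset
-- are `sa`, `la`, `oa` and `sb`, `lb`, `ob`. The current entries occupy the indices from `a` to `e
-- - 1`, and `t` is the next free one. The variables from `pK` to `rst` are the parameters of an
-- expansion, those from `ef` to `ec` the entry in progress.
namespace Reg
@[simp] abbrev one : ℕ := 4
@[simp] abbrev zero : ℕ := 5
@[simp] abbrev pn : ℕ := 6
@[simp] abbrev big : ℕ := 7
@[simp] abbrev lp : ℕ := 8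
@[simp] abbrev op : ℕ := 9
@[simp] abbrev y : ℕ := 10
@[simp] abbrev x : ℕ := 11
@[simp] abbrev sa : ℕ := 12
@[simp] abbrev la : ℕ := 13
@[simp] abbrev oa : ℕ := 14
@[simp] abbrev sb : ℕ := 15
@[simp] abbrev lb : ℕ := 16
@[simp] abbrev ob : ℕ := 17
@[simp] abbrev nu : ℕ := 18
@[simp] abbrev i : ℕ := 19
@[simp] abbrev v : ℕ := 20
@[simp] abbrev a : ℕ := 21
@[simp] abbrev e : ℕ := 22
@[simp] abbrev nl : ℕ := 23
@[simp] abbrev k : ℕ := 24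
@[simp] abbrev ca : ℕ := 25
@[simp] abbrev cb : ℕ := 26
@[simp] abbrev dv : ℕ := 27
@[simp] abbrev s : ℕ := 28
@[simp] abbrev s2 : ℕ := 29
@[simp] abbrev pK : ℕ := 30
@[simp] abbrev df : ℕ := 31
@[simp] abbrev dg : ℕ := 32
@[simp] abbrev de : ℕ := 33
@[simp] abbrev dw : ℕ := 34
@[simp] abbrev dc : ℕ := 35
@[simp] abbrev lim : ℕ := 36
@[simp] abbrev need : ℕ := 37
@[simp] abbrev rst : ℕ := 38
@[simp] abbrev h : ℕ := 39
@[simp] abbrev t : ℕ := 40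
@[simp] abbrev ef : ℕ := 41
@[simp] abbrev eg : ℕ := 42
@[simp] abbrev ee : ℕ := 43
@[simp] abbrev ew : ℕ := 44
@[simp] abbrev ec : ℕ := 45
@[simp] abbrev j : ℕ := 46
@[simp] abbrev t1 : ℕ := 47
@[simp] abbrev t2 : ℕ := 48
@[simp] abbrev t3 : ℕ := 49
@[simp] abbrev t4 : ℕ := 50
@[simp] abbrev k1 : ℕ := 51
@[simp] abbrev k2 : ℕ := 52
@[simp] abbrev es : ℕ := 53
@[simp] abbrev es2 : ℕ := 54
@[simp] abbrev wt : ℕ := 55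
@[simp] abbrev nd : ℕ := 56
@[simp] abbrev si : ℕ := 57
@[simp] abbrev go : ℕ := 58
@[simp] abbrev root : ℕ := 59
@[simp] abbrev bad : ℕ := 60
@[simp] abbrev two : ℕ := 61
end Reg

-- `S` and `P` hold place values and powers of two; `r` and `sm` the number and the sum of the
-- remaining tree neighbours. A slot consists of `st`, `len` (its segment of the vertices `LV` and
-- their edge counts `LC`) and `off` (the start of its table in `TB`). `CA`, `CB` and `UV` are
-- scratch space for a union, and the arrays from `EF` to `EC` store the entries.
namespace Arr
@[simp] abbrev dem : ℕ := 0
@[simp] abbrev fst : ℕ := 1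
@[simp] abbrev snd : ℕ := 2
@[simp] abbrev leaf : ℕ := 3
@[simp] abbrev tfst : ℕ := 4
@[simp] abbrev tsnd : ℕ := 5
@[simp] abbrev out : ℕ := 6
@[simp] abbrev deg : ℕ := 7
@[simp] abbrev S : ℕ := 8
@[simp] abbrev P : ℕ := 9
@[simp] abbrev r : ℕ := 10
@[simp] abbrev sm : ℕ := 11
@[simp] abbrev st : ℕ := 12
@[simp] abbrev len : ℕ := 13
@[simp] abbrev off : ℕ := 14
@[simp] abbrev LV : ℕ := 15
@[simp] abbrev LC : ℕ := 16
@[simp] abbrev TB : ℕ := 17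
@[simp] abbrev CA : ℕ := 18
@[simp] abbrev CB : ℕ := 19
@[simp] abbrev UV : ℕ := 20
@[simp] abbrev EF : ℕ := 21
@[simp] abbrev EG : ℕ := 22
@[simp] abbrev EE : ℕ := 23
@[simp] abbrev EW : ℕ := 24
@[simp] abbrev EC : ℕ := 25
end Arr

/-! ## Expanding a list of partial choices -/

/-- A partial choice: addresses `f`, `g` in two tables, an address `e` in a new table, an additional
weight `w` and a counter `c`. -/
@[ext] structure Entry where
  f : ℕ
  g : ℕ
  e : ℕ
  w : ℕ
  c : ℕ

/-- The parameters of an expansion: every entry is replaced by `K` entries, each of which results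
from the previous one by adding the increments, where `e` and `c` only grow as long as `c < lim`.
Entries with `c < need` are dropped, and `rst` is subtracted from `c` in the end. -/
structure Expansion where
  K : ℕ
  df : ℕ
  dg : ℕ
  de : ℕ
  dw : ℕ
  dc : ℕ
  lim : ℕ
  need : ℕ
  rst : ℕ

namespace Expansion

/-- The limit implements the truncation of counts at the demand: once the counter has reached it,
neither the counter nor the digit in the new code grows. -/
def step (P : Expansion) (x : Entry) : Entry :=
  ⟨x.f + P.df, x.g + P.dg, if x.c < P.lim then x.e + P.de else x.e, x.w + P.dw,
    if x.c < P.lim then x.c + P.dc else x.c⟩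

def emit (P : Expansion) (x : Entry) : List Entry :=
  if x.c < P.need then [] else [⟨x.f, x.g, x.e, x.w, x.c - P.rst⟩]

def apply (P : Expansion) (l : List Entry) : List Entry :=
  l.flatMap fun x => (List.range P.K).flatMap fun i => P.emit (P.step^[i] x)

def ofState (s : State) : Expansion :=
  ⟨s.var Reg.pK, s.var Reg.df, s.var Reg.dg, s.var Reg.de, s.var Reg.dw, s.var Reg.dc,
    s.var Reg.lim, s.var Reg.need, s.var Reg.rst⟩

end Expansion

/-- The entry that is stored with the index `i`. -/
def entryAt (s : State) (i : ℕ) : Entry :=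
  ⟨s.arr Arr.EF i, s.arr Arr.EG i, s.arr Arr.EE i, s.arr Arr.EW i, s.arr Arr.EC i⟩

/-- The entry in the variables. -/
def currentEntry (s : State) : Entry :=
  ⟨s.var Reg.ef, s.var Reg.eg, s.var Reg.ee, s.var Reg.ew, s.var Reg.ec⟩

/-- The entries with the indices from `lo` to `hi - 1`. -/
def entries (s : State) (lo hi : ℕ) : List Entry :=
  (List.range' lo (hi - lo)).map (entryAt s)

theorem entries_congr {s s' : State} {lo hi : ℕ} (h : ∀ i < hi, entryAt s' i = entryAt s i) :
    entries s' lo hi = entries s lo hi := by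
  refine List.map_congr_left fun i hi => h i ?_
  have := List.mem_range'_1.1 hi
  omega

theorem entries_succ (s : State) {lo hi : ℕ} (h : lo ≤ hi) :
    entries s lo (hi + 1) = entries s lo hi ++ [entryAt s hi] := by
  rw [entries, entries, Nat.succ_sub h, List.range'_concat, List.map_append]
  simp [Nat.add_sub_cancel' h]

@[simp] theorem entries_self (s : State) (lo : ℕ) : entries s lo lo = [] := by simp [entries]

@[simp] theorem length_entries (s : State) (lo hi : ℕ) : (entries s lo hi).length = hi - lo := by
  simp [entries]

/-- Append the current entry to the list. -/
def pushEntry : Program :=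
  .ite Reg.ec Reg.need .skip
    (block [.store Arr.EF Reg.t Reg.ef, .store Arr.EG Reg.t Reg.eg, .store Arr.EE Reg.t Reg.ee,
      .store Arr.EW Reg.t Reg.ew, .sub Reg.t1 Reg.ec Reg.rst, .store Arr.EC Reg.t Reg.t1,
      .add Reg.t Reg.t Reg.one])

def expandStep : Program :=
  block [pushEntry, .add Reg.ef Reg.ef Reg.df, .add Reg.eg Reg.eg Reg.dg,
    .add Reg.ew Reg.ew Reg.dw,
    .ite Reg.ec Reg.lim (block [.add Reg.ec Reg.ec Reg.dc, .add Reg.ee Reg.ee Reg.de]) .skip,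
    .add Reg.j Reg.j Reg.one]

def expandEntryInit : Program :=
  block [.load Reg.ef Arr.EF Reg.h, .load Reg.eg Arr.EG Reg.h, .load Reg.ee Arr.EE Reg.h,
    .load Reg.ew Arr.EW Reg.h, .load Reg.ec Arr.EC Reg.h, .const Reg.j 0]

def expandEntry : Program :=
  block [expandEntryInit, .loop Reg.j Reg.pK expandStep, .add Reg.h Reg.h Reg.one]

/-- Replace the list of entries by its expansion. -/
def expand : Program :=
  block [block [.copy Reg.t Reg.e, .copy Reg.h Reg.a], .loop Reg.h Reg.e expandEntry,
    block [.copy Reg.a Reg.e, .copy Reg.e Reg.t]]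

theorem run_expandStep {s : State} {P : Expansion} (hP : Expansion.ofState s = P)
    (h1 : s.var Reg.one = 1) {lo : ℕ} (hlo : lo ≤ s.var Reg.t) :
    Run expandStep s 15 fun s' => s'.var Reg.j = s.var Reg.j + 1 ∧
      currentEntry s' = P.step (currentEntry s) ∧
      entries s' lo (s'.var Reg.t) = entries s lo (s.var Reg.t) ++ P.emit (currentEntry s) ∧
      s.var Reg.t ≤ s'.var Reg.t ∧ ∀ i < s.var Reg.t, entryAt s' i = entryAt s i := by
  refine Run.straight rfl (by decide) ?_
  subst hP
  have key : ∀ i < s.var Reg.t, entryAt (expandStep.ev s) i = entryAt s i := by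
    intro i hi
    by_cases hc : s.var Reg.ec < s.var Reg.need <;> by_cases hl : s.var Reg.ec < s.var Reg.lim <;>
    simp [expandStep, block, pushEntry, Program.ev, entryAt, hi.ne, hc, hl]
  refine ⟨?_, ?_, ?_, ?_, key⟩
  · by_cases hc : s.var Reg.ec < s.var Reg.need <;> by_cases hl : s.var Reg.ec < s.var Reg.lim <;>
    simp [hc, hl, h1, expandStep, block, pushEntry, Program.ev]
  · by_cases hc : s.var Reg.ec < s.var Reg.need <;> by_cases hl : s.var Reg.ec < s.var Reg.lim <;>
    simp [hc, hl, h1, expandStep, block, pushEntry, Program.ev, currentEntry, Expansion.step,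
      Expansion.ofState]
  · by_cases hc : s.var Reg.ec < s.var Reg.need
    · have : (expandStep.ev s).var Reg.t = s.var Reg.t := by
        by_cases hl : s.var Reg.ec < s.var Reg.lim <;>
        simp [hc, hl, h1, expandStep, block, pushEntry, Program.ev]
      have he : (Expansion.ofState s).emit (currentEntry s) = [] := if_pos hc
      rw [this, entries_congr key, he, List.append_nil]
    · have : (expandStep.ev s).var Reg.t = s.var Reg.t + 1 := by
        by_cases hl : s.var Reg.ec < s.var Reg.lim <;>
        simp [hc, hl, h1, expandStep, block, pushEntry, Program.ev]
      have he : (Expansion.ofState s).emit (currentEntry s) =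
        [⟨s.var Reg.ef, s.var Reg.eg, s.var Reg.ee, s.var Reg.ew, s.var Reg.ec - s.var Reg.rst⟩] :=
        if_neg hc
      rw [this, entries_succ _ hlo, entries_congr key, he]
      congr 2
      by_cases hl : s.var Reg.ec < s.var Reg.lim <;>
      simp [hc, hl, h1, expandStep, block, pushEntry, Program.ev, entryAt]
  · by_cases hc : s.var Reg.ec < s.var Reg.need <;> by_cases hl : s.var Reg.ec < s.var Reg.lim <;>
    simp [hc, hl, h1, expandStep, block, pushEntry, Program.ev]

theorem Expansion.ofState_congr {p : Program} {s s' : State} (hF : p.Frame s s')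
    (h : ∀ x, Reg.pK ≤ x → x ≤ Reg.rst → p.writesVar x = false) :
    Expansion.ofState s' = Expansion.ofState s := by
  simp only [Expansion.ofState]
  rw [hF.var _ (h _ _ _), hF.var _ (h _ _ _), hF.var _ (h _ _ _), hF.var _ (h _ _ _),
    hF.var _ (h _ _ _), hF.var _ (h _ _ _), hF.var _ (h _ _ _), hF.var _ (h _ _ _),
    hF.var _ (h _ _ _)] <;> decide

theorem run_expandLoop {s : State} {P : Expansion} (hP : Expansion.ofState s = P)
    (h1 : s.var Reg.one = 1) {lo : ℕ} (hlo : lo ≤ s.var Reg.t) (hj : s.var Reg.j = 0) :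
    Run (.loop Reg.j Reg.pK expandStep) s (1 + P.K * 16) fun s' =>
      entries s' lo (s'.var Reg.t) = entries s lo (s.var Reg.t) ++
        (List.range P.K).flatMap (fun i => P.emit (P.step^[i] (currentEntry s))) ∧
      s.var Reg.t ≤ s'.var Reg.t ∧ ∀ i < s.var Reg.t, entryAt s' i = entryAt s i := by
  refine (Run.forLoop_const (k := P.K) (c := 15) (fun i s' => s'.var Reg.j = i ∧
    currentEntry s' = P.step^[i] (currentEntry s) ∧
      entries s' lo (s'.var Reg.t) = entries s lo (s.var Reg.t) ++
        (List.range i).flatMap (fun i => P.emit (P.step^[i] (currentEntry s))) ∧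
      s.var Reg.t ≤ s'.var Reg.t ∧ ∀ i < s.var Reg.t, entryAt s' i = entryAt s i)
      ?_ ?_ ?_ le_rfl).mono le_rfl ?_
  · simp [hj]
  · rintro i s' - ⟨hi, -⟩ hF
    rw [hi, hF.var _ rfl, ← hP]
    rfl
  · rintro i s' hi ⟨hj', hc, he, ht, hk⟩ hF
    have hP' : Expansion.ofState s' = P := by
      rw [← hP]
      refine Expansion.ofState_congr hF (by decide)
    refine (run_expandStep hP' (by rw [hF.var _ rfl, h1]) (hlo.trans ht)).mono le_rfl ?_
    rintro s'' ⟨h1', h2, h3, h4, h5⟩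
    refine ⟨by omega, ?_, ?_, by omega, fun i hi => (h5 i (by omega)).trans (hk i hi)⟩
    · rw [h2, hc, Function.iterate_succ_apply']
    · rw [h3, he, hc, List.range_succ, List.flatMap_append, List.append_assoc]
      simp
  · rintro s' ⟨-, -, h⟩
    exact h

theorem run_expandEntry {s : State} {P : Expansion} (hP : Expansion.ofState s = P)
    (h1 : s.var Reg.one = 1) {lo : ℕ} (hlo : lo ≤ s.var Reg.t) :
    Run expandEntry s (8 + P.K * 16) fun s' => s'.var Reg.h = s.var Reg.h + 1 ∧
      entries s' lo (s'.var Reg.t) = entries s lo (s.var Reg.t) ++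
        P.apply [entryAt s (s.var Reg.h)] ∧
      s.var Reg.t ≤ s'.var Reg.t ∧ ∀ i < s.var Reg.t, entryAt s' i = entryAt s i := by
  refine Run.seq (T₁ := 6) (T₂ := P.K * 16 + 2) (Run.straight rfl (by decide) rfl) ?_ (by omega)
  rintro s1 rfl hF
  have hx : currentEntry (expandEntryInit.ev s) = entryAt s (s.var Reg.h) := by
    simp [expandEntryInit, block, Program.ev, currentEntry, entryAt]
  have hea : ∀ i, entryAt (expandEntryInit.ev s) i = entryAt s i := by
    simp [expandEntryInit, block, Program.ev, entryAt]
  have hP' : Expansion.ofState (expandEntryInit.ev s) = P :=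
    (Expansion.ofState_congr hF (by decide)).trans hP
  have ht : (expandEntryInit.ev s).var Reg.t = s.var Reg.t := hF.var _ rfl
  refine (run_expandLoop hP' ?_ (lo := lo) (by rwa [ht]) ?_).seq (T₂ := 1) ?_ (by omega)
  · rw [hF.var _ rfl, h1]
  · simp [expandEntryInit, block, Program.ev]
  rintro s2 ⟨he, hle, hk⟩ hF2
  refine Run.straight (p := .add Reg.h Reg.h Reg.one) rfl le_rfl ⟨?_, ?_, ?_, ?_⟩
  · simp only [Program.ev, State.setVar_var]
    rw [if_pos trivial, hF2.var _ rfl, hF2.var _ rfl, hF.var _ rfl, hF.var _ rfl, h1]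
  · have : entries (s2.setVar Reg.h (s2.var Reg.h + s2.var Reg.one)) lo (s2.var Reg.t) =
      entries s2 lo (s2.var Reg.t) := rfl
    simp only [Program.ev]
    rw [show (s2.setVar Reg.h (s2.var Reg.h + s2.var Reg.one)).var Reg.t = s2.var Reg.t from rfl,
      this, he, ht, hx, entries_congr fun i _ => hea i]
    simp [Expansion.apply]
  · rw [ht] at hle
    exact hle
  · intro i hi
    refine Eq.trans ?_ ((hk i (by rwa [ht])).trans (hea i))
    rfl

theorem Expansion.apply_append (P : Expansion) (l l' : List Entry) :
    P.apply (l ++ l') = P.apply l ++ P.apply l' := List.flatMap_append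

theorem run_expand {s : State} {P : Expansion} (hP : Expansion.ofState s = P)
    (h1 : s.var Reg.one = 1) (hae : s.var Reg.a ≤ s.var Reg.e) {l : List Entry}
    (hl : entries s (s.var Reg.a) (s.var Reg.e) = l) :
    Run expand s (5 + l.length * (9 + P.K * 16)) fun s' => s'.var Reg.a ≤ s'.var Reg.e ∧
      entries s' (s'.var Reg.a) (s'.var Reg.e) = P.apply l := by
  refine Run.seq (T₁ := 2) (T₂ := 3 + l.length * (9 + P.K * 16))
    (Run.straight rfl (by decide) rfl) ?_ (by omega)
  rintro s1 rfl hF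
  set s1 := (block [.copy Reg.t Reg.e, .copy Reg.h Reg.a]).ev s with hs1
  have ht : s1.var Reg.t = s.var Reg.e := rfl
  have hh : s1.var Reg.h = s.var Reg.a := rfl
  have ha : s1.var Reg.a = s.var Reg.a := rfl
  have he : s1.var Reg.e = s.var Reg.e := rfl
  have hP' : Expansion.ofState s1 = P := hP
  have hl' : entries s1 (s.var Reg.a) (s.var Reg.e) = l := hl
  have hlen : l.length = s.var Reg.e - s.var Reg.a := by rw [← hl, length_entries]
  have hone : s1.var Reg.one = 1 := h1
  clear_value s1
  -- The expansion is written behind the old list, which stays intact while it is being read.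
  refine (Run.forLoop_const (k := l.length) (c := 8 + P.K * 16) (fun i s' =>
    s'.var Reg.h = s.var Reg.a + i ∧ s.var Reg.e ≤ s'.var Reg.t ∧
    (∀ i < s.var Reg.e, entryAt s' i = entryAt s1 i) ∧
    entries s' (s.var Reg.e) (s'.var Reg.t) =
      P.apply (entries s1 (s.var Reg.a) (s.var Reg.a + i))) ?_ ?_ ?_ le_rfl).seq (T₂ := 2)
      ?_ (by ring_nf; omega)
  · simp [hh, ht, Expansion.apply]
  · rintro i s' - ⟨hi, -⟩ hF
    rw [hi, hF.var _ rfl, he]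
    omega
  · rintro i s' hi ⟨hi', htle, hk, hent⟩ hF
    have hP2 : Expansion.ofState s' = P :=
      (Expansion.ofState_congr hF (by decide)).trans hP'
    refine (run_expandEntry hP2 (by rw [hF.var _ rfl, hone]) htle).mono le_rfl ?_
    rintro s2 ⟨h1', h2, h3, h4⟩
    refine ⟨by omega, by omega, fun i hi => (h4 i (by omega)).trans (hk i hi), ?_⟩
    rw [h2, hent, hi', ← add_assoc, entries_succ _ (by omega), Expansion.apply_append,
      hk _ (by omega)]
  · rintro s2 ⟨h1', h2, h3, h4⟩ hF2
    refine Run.straight (p := block [.copy Reg.a Reg.e, .copy Reg.e Reg.t]) rfl (by decide) ?_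
    have e1 : ((block [.copy Reg.a Reg.e, .copy Reg.e Reg.t]).ev s2).var Reg.a = s.var Reg.e := by
      simp [block, Program.ev]
      rw [hF2.var _ rfl]; exact he
    have e2 : ((block [.copy Reg.a Reg.e, .copy Reg.e Reg.t]).ev s2).var Reg.e = s2.var Reg.t := by
      simp [block, Program.ev]
    have e3 : ∀ a b, entries ((block [.copy Reg.a Reg.e, .copy Reg.e Reg.t]).ev s2) a b =
      entries s2 a b := fun a b => rfl
    rw [e1, e2, e3]
    refine ⟨h2, ?_⟩
    rw [h4, show s.var Reg.a + l.length = s.var Reg.e by omega, hl']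

end TVD

namespace TVD
open Finset

/-! ## Choices for the vertices of a union of two boundaries -/

/-- What the expansion for a vertex depends on: the stride, the demand, the numbers of edges in the
two parts, the weight, and whether the vertex stays in the boundary. -/
structure VertexInfo where
  s : ℕ
  d : ℕ
  ca : ℕ
  cb : ℕ
  w : ℕ
  keep : Prop

namespace VertexInfo
variable (i : VertexInfo)
open Classical in
/-- Choose whether the vertex is selected. -/
noncomputable def selExpansion : Expansion :=
  -- A vertex has a digit in the code of a part only if it has an edge there. The counter is 0 and
  -- has increment 0, so it stays below the limit 1 and the new code always grows.
  ⟨2, if 0 < i.ca then i.s else 0, if 0 < i.cb then i.s else 0, if i.keep then i.s else 0,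
    if i.keep then 0 else i.w, 0, 1, 0, 0⟩

open Classical in
/-- Choose the number of selected neighbours in the first part. -/
noncomputable def fstExpansion : Expansion :=
  ⟨min i.d i.ca + 1, 2 * i.s, 0, if i.keep then 2 * i.s else 0, 0, 1, i.d, 0, 0⟩

open Classical in
/-- Choose the number of selected neighbours in the second part. -/
noncomputable def sndExpansion : Expansion :=
  -- The demand is required only of a vertex that leaves the boundary. Since the counter never
  -- exceeds the demand, subtracting the demand resets it to 0 for the next vertex.
  ⟨min i.d i.cb + 1, 0, 2 * i.s, if i.keep then 2 * i.s else 0, 0, 1, i.d,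
    if i.keep then 0 else i.d, i.d⟩

noncomputable def expansion (l : List Entry) : List Entry :=
  i.sndExpansion.apply (i.fstExpansion.apply (i.selExpansion.apply l))

/-- The choices `σ`, `p`, `q` are admissible. -/
def Valid (σ p q : ℕ) : Prop :=
  σ < 2 ∧ p ≤ min i.d i.ca ∧ q ≤ min i.d i.cb ∧ (i.keep ∨ i.d ≤ min i.d (p + q))

open Classical in
/-- The contribution of a choice. -/
noncomputable def contribution (σ p q : ℕ) : Entry :=
  ⟨σ * (if 0 < i.ca then i.s else 0) + p * (2 * i.s),
    σ * (if 0 < i.cb then i.s else 0) + q * (2 * i.s),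
    if i.keep then σ * i.s + min i.d (p + q) * (2 * i.s) else 0,
    if i.keep then 0 else σ * i.w, 0⟩

/-- The number of choices. -/
def size : ℕ := 2 * ((min i.d i.ca + 1) * (min i.d i.cb + 1))

end VertexInfo

theorem Expansion.length_apply (P : Expansion) (l : List Entry) :
    (P.apply l).length ≤ l.length * P.K := by
  induction l with
  | nil => simp [Expansion.apply]
  | cons x l ih =>
    have h : ((List.range P.K).flatMap fun i => P.emit (P.step^[i] x)).length ≤ P.K := by
      rw [List.length_flatMap]
      refine (List.sum_le_card_nsmul _ 1 ?_).trans (by simp)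
      simp only [List.mem_map]
      rintro _ ⟨i, -, rfl⟩
      unfold Expansion.emit
      split_ifs <;> simp
    have : P.apply (x :: l) = ((List.range P.K).flatMap fun i => P.emit (P.step^[i] x)) ++
      P.apply l := List.flatMap_cons
    rw [this, List.length_append, List.length_cons, add_mul, one_mul]
    omega

theorem Expansion.mem_apply (P : Expansion) (l : List Entry) (y : Entry) :
    y ∈ P.apply l ↔ ∃ x ∈ l, ∃ i < P.K, P.need ≤ (P.step^[i] x).c ∧
      y = { P.step^[i] x with c := (P.step^[i] x).c - P.rst } := by
  simp only [Expansion.apply, List.mem_flatMap, List.mem_range, Expansion.emit]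
  refine exists_congr fun x => and_congr_right fun _ => exists_congr fun i =>
    and_congr_right fun _ => ?_
  split_ifs with h
  · simp [h]
  · simp [not_lt.1 h]

namespace VertexInfo
variable (i : VertexInfo)

/-- Up to the demand the limit is not reached, so the iteration is linear. -/
theorem fst_iterate (x : Entry) (hx : x.c = 0) {p : ℕ} (hp : p ≤ i.d) :
    i.fstExpansion.step^[p] x =
      ⟨x.f + p * (2 * i.s), x.g, x.e + p * i.fstExpansion.de, x.w, p⟩ := by
  induction p with
  | zero => ext <;> simp [hx]
  | succ p ih =>
    rw [Function.iterate_succ_apply', ih (by omega)]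
    have h : p < i.d := by omega
    ext <;> simp [Expansion.step, fstExpansion, h] <;> (try split_ifs) <;> ring

/-- The counter continues from the count of the first part and saturates at the demand, while the
address in the second table keeps growing. -/
theorem snd_iterate (x : Entry) (hx : x.c ≤ i.d) (q : ℕ) :
    i.sndExpansion.step^[q] x =
      ⟨x.f, x.g + q * (2 * i.s), x.e + (min i.d (x.c + q) - x.c) * i.sndExpansion.de, x.w,
        min i.d (x.c + q)⟩ := by
  induction q with
  | zero => ext <;> simp [hx]
  | succ q ih =>
    rw [Function.iterate_succ_apply', ih]
    have h1 : i.sndExpansion.lim = i.d := rfl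
    have h2 : i.sndExpansion.dc = 1 := rfl
    have h3 : i.sndExpansion.dg = 2 * i.s := rfl
    have h4 : i.sndExpansion.df = 0 := rfl
    have h5 : i.sndExpansion.dw = 0 := rfl
    by_cases h : x.c + q < i.d
    · have e1 : min i.d (x.c + q) = x.c + q := by omega
      have e2 : min i.d (x.c + (q + 1)) = x.c + q + 1 := by omega
      ext <;> simp only [Expansion.step, h1, h2, h3, h4, h5, e1, e2, h, if_true, add_zero]
      · ring
      · rw [show x.c + q + 1 - x.c = q + 1 by omega, show x.c + q - x.c = q by omega]; ring
    · have e1 : min i.d (x.c + q) = i.d := by omega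
      have e2 : min i.d (x.c + (q + 1)) = i.d := by omega
      ext <;> simp only [Expansion.step, h1, h2, h3, h4, h5, e1, e2, lt_irrefl, if_false, add_zero]
      ring

instance : Add Entry := ⟨fun x y => ⟨x.f + y.f, x.g + y.g, x.e + y.e, x.w + y.w, x.c + y.c⟩⟩

theorem mem_selExpansion (l : List Entry) (hl : ∀ x ∈ l, x.c = 0) (y : Entry) :
    y ∈ i.selExpansion.apply l ↔ ∃ x ∈ l, ∃ σ < 2,
      y = ⟨x.f + σ * i.selExpansion.df, x.g + σ * i.selExpansion.dg,
        x.e + σ * i.selExpansion.de, x.w + σ * i.selExpansion.dw, 0⟩ := by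
  rw [Expansion.mem_apply]
  refine exists_congr fun x => and_congr_right fun hx => exists_congr fun σ =>
    and_congr_right fun hσ => ?_
  have hσ' : σ < 2 := hσ
  have := hl x hx
  interval_cases σ
  · simp [selExpansion, this]
  · simp [selExpansion, this, Expansion.step]

/-- Chaining the three expansions adds p steps and then min d (p + q) − p steps to the new digit,
which amounts to the truncated sum of the two counts. -/
theorem mem_expansion (l : List Entry) (hl : ∀ x ∈ l, x.c = 0) (y : Entry) :
    y ∈ i.expansion l ↔
      ∃ x ∈ l, ∃ σ p q, i.Valid σ p q ∧ y = x + i.contribution σ p q := by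
  have h1 : ∀ x ∈ i.selExpansion.apply l, x.c = 0 := by
    intro x hx
    obtain ⟨_, _, _, _, rfl⟩ := (i.mem_selExpansion l hl x).1 hx
    rfl
  have h2 : ∀ y, y ∈ i.fstExpansion.apply (i.selExpansion.apply l) ↔ ∃ x ∈ i.selExpansion.apply l,
      ∃ p ≤ min i.d i.ca, y =
        ⟨x.f + p * (2 * i.s), x.g, x.e + p * i.fstExpansion.de, x.w, p⟩ := by
    intro y
    rw [Expansion.mem_apply]
    refine exists_congr fun x => and_congr_right fun hx => exists_congr fun p => ?_
    rw [show i.fstExpansion.K = min i.d i.ca + 1 from rfl, Nat.lt_succ_iff]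
    refine and_congr_right fun hp => ?_
    rw [i.fst_iterate x (h1 x hx) (hp.trans (min_le_left _ _))]
    simp [fstExpansion]
  have key : y ∈ i.expansion l ↔ ∃ x ∈ l, ∃ σ < 2, ∃ p ≤ min i.d i.ca, ∃ q ≤ min i.d i.cb,
      i.sndExpansion.need ≤ min i.d (p + q) ∧
      y = ⟨x.f + σ * i.selExpansion.df + p * (2 * i.s),
        x.g + σ * i.selExpansion.dg + q * (2 * i.s),
        x.e + σ * i.selExpansion.de + p * i.fstExpansion.de +
          (min i.d (p + q) - p) * i.sndExpansion.de, x.w + σ * i.selExpansion.dw, 0⟩ := by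
    rw [expansion, Expansion.mem_apply]
    constructor
    · rintro ⟨z, hz, q, hq, hn, rfl⟩
      obtain ⟨x', hx', p, hp, rfl⟩ := (h2 z).1 hz
      obtain ⟨x, hx, σ, hσ, rfl⟩ := (i.mem_selExpansion l hl x').1 hx'
      rw [i.snd_iterate _ (hp.trans (min_le_left _ _))] at hn ⊢
      refine ⟨x, hx, σ, hσ, p, hp, q, Nat.lt_succ_iff.1 hq, hn, ?_⟩
      simp [sndExpansion]
    · rintro ⟨x, hx, σ, hσ, p, hp, q, hq, hn, rfl⟩
      refine ⟨_, (h2 _).2 ⟨_, (i.mem_selExpansion l hl _).2 ⟨x, hx, σ, hσ, rfl⟩, p, hp, rfl⟩, q,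
        Nat.lt_succ_iff.2 hq, ?_⟩
      rw [i.snd_iterate _ (hp.trans (min_le_left _ _))]
      refine ⟨hn, ?_⟩
      simp [sndExpansion]
  rw [key]
  refine exists_congr fun x => and_congr_right fun hx => ?_
  have hval : ∀ σ p q, (σ < 2 ∧ p ≤ min i.d i.ca ∧ q ≤ min i.d i.cb ∧
      i.sndExpansion.need ≤ min i.d (p + q)) ↔ i.Valid σ p q := by
    intro σ p q
    unfold Valid sndExpansion
    by_cases hk : i.keep <;> simp [hk]
  have hent : ∀ σ p q, p ≤ min i.d i.ca →
      (⟨x.f + σ * i.selExpansion.df + p * (2 * i.s),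
        x.g + σ * i.selExpansion.dg + q * (2 * i.s),
        x.e + σ * i.selExpansion.de + p * i.fstExpansion.de +
          (min i.d (p + q) - p) * i.sndExpansion.de, x.w + σ * i.selExpansion.dw, 0⟩ : Entry) =
        x + i.contribution σ p q := by
    intro σ p q hp
    have hxc := hl x hx
    change _ = (⟨x.f + _, x.g + _, x.e + _, x.w + _, x.c + 0⟩ : Entry)
    have : p + (min i.d (p + q) - p) = min i.d (p + q) := by omega
    ext
    · simp [contribution, selExpansion, add_assoc]
    · simp [contribution, selExpansion, add_assoc]
    · by_cases hk : i.keep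
      · simp [contribution, selExpansion, fstExpansion, sndExpansion, hk]
        rw [← this]; simp; ring
      · simp [contribution, selExpansion, fstExpansion, sndExpansion, hk]
    · by_cases hk : i.keep <;> simp [contribution, selExpansion, hk]
    · simp [hxc]
  constructor
  · rintro ⟨σ, hσ, p, hp, q, hq, hn, rfl⟩
    exact ⟨σ, p, q, (hval _ _ _).1 ⟨hσ, hp, hq, hn⟩, hent _ _ _ hp⟩
  · rintro ⟨σ, p, q, hv, rfl⟩
    obtain ⟨hσ, hp, hq, hn⟩ := (hval _ _ _).2 hv
    exact ⟨σ, hσ, p, hp, q, hq, hn, (hent _ _ _ hp).symm⟩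

theorem length_expansion (l : List Entry) : (i.expansion l).length ≤ l.length * i.size := by
  have h1 := i.selExpansion.length_apply l
  have h2 := i.fstExpansion.length_apply (i.selExpansion.apply l)
  have h3 := i.sndExpansion.length_apply (i.fstExpansion.apply (i.selExpansion.apply l))
  calc (i.expansion l).length
      ≤ ((l.length * 2) * (min i.d i.ca + 1)) * (min i.d i.cb + 1) :=
        h3.trans (Nat.mul_le_mul_right _ (h2.trans (Nat.mul_le_mul_right _ h1)))
    _ = l.length * i.size := by unfold size; ring

end VertexInfo

/-- All partial choices for a list of vertices. -/
noncomputable def choiceList (info : ℕ → VertexInfo) (U : List ℕ) : List Entry :=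
  U.foldl (fun l v => (info v).expansion l) [⟨0, 0, 0, 0, 0⟩]

theorem choiceList_concat (info : ℕ → VertexInfo) (U : List ℕ) (v : ℕ) :
    choiceList info (U ++ [v]) = (info v).expansion (choiceList info U) := by
  simp [choiceList]

theorem mem_choiceList (info : ℕ → VertexInfo) {U : List ℕ} (hU : U.Nodup) (y : Entry) :
    y ∈ choiceList info U ↔ ∃ σ p q : ℕ → ℕ, (∀ v ∈ U, (info v).Valid (σ v) (p v) (q v)) ∧
      y = ⟨∑ v ∈ U.toFinset, ((info v).contribution (σ v) (p v) (q v)).f,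
        ∑ v ∈ U.toFinset, ((info v).contribution (σ v) (p v) (q v)).g,
        ∑ v ∈ U.toFinset, ((info v).contribution (σ v) (p v) (q v)).e,
        ∑ v ∈ U.toFinset, ((info v).contribution (σ v) (p v) (q v)).w, 0⟩ := by
  induction U using List.reverseRecOn generalizing y with
  | nil => simp [choiceList]
  | append_singleton U v ih =>
    have hU' : U.Nodup := hU.of_append_left
    have hv : v ∉ U.toFinset := by
      rw [List.mem_toFinset]
      intro h
      exact (List.nodup_append.1 hU).2.2 v h v (by simp) rfl
    have hvU : v ∉ U := by simpa using hv
    have h0 : ∀ x ∈ choiceList info U, x.c = 0 := by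
      intro x hx
      obtain ⟨_, _, _, _, rfl⟩ := (ih hU' x).1 hx
      rfl
    have hUv : (U ++ [v]).toFinset = insert v U.toFinset := by ext; simp
    rw [choiceList_concat, VertexInfo.mem_expansion _ _ h0, hUv]
    simp only [sum_insert hv]
    constructor
    · rintro ⟨x, hx, σ', p', q', hval, rfl⟩
      obtain ⟨σ, p, q, hv', rfl⟩ := (ih hU' x).1 hx
      -- The new vertex does not occur in the old list, so redefining the choice functions there
      -- leaves the old sums unchanged.
      refine ⟨Function.update σ v σ', Function.update p v p', Function.update q v q', ?_, ?_⟩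
      · intro u hu
        by_cases huv : u = v
        · subst huv; simpa using hval
        · simp only [Function.update_of_ne huv]
          refine hv' u ?_
          simpa [huv] using hu
      · have hne : ∀ u ∈ U.toFinset, u ≠ v := fun u hu h => hv (h ▸ hu)
        have hupd : ∀ u ∈ U.toFinset, (info u).contribution (Function.update σ v σ' u)
            (Function.update p v p' u) (Function.update q v q' u) =
            (info u).contribution (σ u) (p u) (q u) := by
          intro u hu
          simp [Function.update_of_ne (hne u hu)]
        rw [sum_congr rfl fun u hu => congrArg Entry.f (hupd u hu),
          sum_congr rfl fun u hu => congrArg Entry.g (hupd u hu),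
          sum_congr rfl fun u hu => congrArg Entry.e (hupd u hu),
          sum_congr rfl fun u hu => congrArg Entry.w (hupd u hu)]
        simp only [Function.update_self]
        change (⟨_ + _, _ + _, _ + _, _ + _, _ + _⟩ : Entry) = _
        ext <;> simp [add_comm, VertexInfo.contribution]
    · rintro ⟨σ, p, q, hval, rfl⟩
      refine ⟨_, (ih hU' _).2 ⟨σ, p, q, fun u hu => hval u (by simp [hu]), rfl⟩, σ v, p v, q v,
        hval v (by simp), ?_⟩
      change _ = (⟨_ + _, _ + _, _ + _, _ + _, _ + _⟩ : Entry)
      ext <;> simp [add_comm, VertexInfo.contribution]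

theorem length_choiceList (info : ℕ → VertexInfo) (U : List ℕ) :
    (choiceList info U).length ≤ (U.map fun v => (info v).size).prod := by
  induction U using List.reverseRecOn with
  | nil => simp [choiceList]
  | append_singleton U v ih =>
    rw [choiceList_concat, List.map_append, List.prod_append]
    refine ((info v).length_expansion _).trans ?_
    simpa using Nat.mul_le_mul_right _ ih

end TVD

namespace TVD
open Finset

/-! ## Partial solutions -/

/-- A graph with vertices `0, …, n - 1` and edges `0, …, m - 1`, where the edge `j` has the ends `a j`
and `b j`, and demands `d`. -/
structure Network where
  n : ℕ
  m : ℕ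
  a : ℕ → ℕ
  b : ℕ → ℕ
  d : ℕ → ℕ

namespace Network
variable (I : Network)

/-- The number of edges of `A` at `v`. -/
def cnt (A : Finset ℕ) (v : ℕ) : ℕ := #{j ∈ A | I.a j = v ∨ I.b j = v}

/-- The number of edges of `A` from `v` to `S`. -/
def nbr (A S : Finset ℕ) (v : ℕ) : ℕ :=
  #{j ∈ A | (I.a j = v ∧ I.b j ∈ S) ∨ (I.b j = v ∧ I.a j ∈ S)}

def deg (v : ℕ) : ℕ := I.cnt (range I.m) v

/-- The positional value of the digit of `v` in a code. -/
def stride : ℕ → ℕ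
  | 0 => 1
  -- A digit is σ + 2c with σ ≤ 1 and c at most the demand, hence less than this radix. A power of
  -- two is reached by doubling, without multiplication.
  | v + 1 => stride v * 2 ^ (I.d v + 2)

/-- Weights for which a set of minimum weight has minimum cardinality and is determined by its
weight. -/
def weight (v : ℕ) : ℕ := 2 ^ I.n + 2 ^ v

/-- The vertices of the edges in `A`. -/
def verts (A : Finset ℕ) : Finset ℕ := {v ∈ range I.n | 0 < I.cnt A v}

/-- The vertices that are incident both to an edge in `A` and to an edge not in `A`. -/
def boundary (A : Finset ℕ) : Finset ℕ := {v ∈ I.verts A | I.cnt A v < I.deg v}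

/-- The code of the behaviour of `S` at the vertices in `X`. -/
def code (A X S : Finset ℕ) : ℕ :=
  ∑ v ∈ X, I.stride v * ((if v ∈ S then 1 else 0) + 2 * min (I.d v) (I.nbr A S v))

/-- The weight of `S` outside of `X`. -/
def cost (A X S : Finset ℕ) : ℕ := ∑ v ∈ I.verts A \ X, if v ∈ S then I.weight v else 0

/-- `S` satisfies the demands of the vertices outside of `X`. -/
def Sat (A X S : Finset ℕ) : Prop := ∀ v ∈ I.verts A \ X, I.d v ≤ I.nbr A S v

/-- One more than the minimum weight of a partial solution with the code `k`, or `0` if there is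
none. -/
noncomputable def best (A X : Finset ℕ) (k : ℕ) : ℕ :=
  -- The infimum of the empty set is 0, and the shift by one keeps genuine values positive.
  sInf {c | ∃ S, I.Sat A X S ∧ I.code A X S = k ∧ c = I.cost A X S + 1}

/-- The ends of all edges are vertices, and they are distinct. -/
def WellFormed : Prop := ∀ j < I.m, I.a j < I.n ∧ I.b j < I.n ∧ I.a j ≠ I.b j

/-- `X` contains the boundary of `A`. -/
structure Closed (A X : Finset ℕ) : Prop where
  edges : A ⊆ range I.m
  subset : X ⊆ I.verts A
  full : ∀ v ∈ I.verts A \ X, I.cnt A v = I.deg v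

variable {I} {A B X Y S S' : Finset ℕ} {v : ℕ}

theorem cnt_union (h : Disjoint A B) (v : ℕ) : I.cnt (A ∪ B) v = I.cnt A v + I.cnt B v := by
  rw [cnt, filter_union, card_union_of_disjoint (disjoint_filter_filter h)]; rfl

theorem nbr_union (h : Disjoint A B) (S : Finset ℕ) (v : ℕ) :
    I.nbr (A ∪ B) S v = I.nbr A S v + I.nbr B S v := by
  rw [nbr, filter_union, card_union_of_disjoint (disjoint_filter_filter h)]; rfl

theorem nbr_le_cnt (A S : Finset ℕ) (v : ℕ) : I.nbr A S v ≤ I.cnt A v :=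
  card_le_card (monotone_filter_right _ fun _ _ h => by tauto)

theorem cnt_mono (h : A ⊆ B) (v : ℕ) : I.cnt A v ≤ I.cnt B v :=
  card_le_card (filter_subset_filter _ h)

theorem mem_verts_iff (hI : I.WellFormed) (hA : A ⊆ range I.m) : v ∈ I.verts A ↔ 0 < I.cnt A v := by
  simp only [verts, mem_filter, mem_range, and_iff_right_iff_imp]
  intro h
  obtain ⟨j, hj⟩ := card_pos.1 h
  rw [mem_filter] at hj
  obtain ⟨h1, h2, -⟩ := hI j (mem_range.1 (hA hj.1))
  rcases hj.2 with rfl | rfl <;> assumption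

theorem cnt_eq_zero (hI : I.WellFormed) (hA : A ⊆ range I.m) : v ∉ I.verts A ↔ I.cnt A v = 0 := by
  rw [mem_verts_iff hI hA]; omega

theorem ends_mem_verts (hI : I.WellFormed) (hA : A ⊆ range I.m) {j : ℕ} (hj : j ∈ A) :
    I.a j ∈ I.verts A ∧ I.b j ∈ I.verts A := by
  rw [mem_verts_iff hI hA, mem_verts_iff hI hA]
  exact ⟨card_pos.2 ⟨j, by simp [hj]⟩, card_pos.2 ⟨j, by simp [hj]⟩⟩

theorem nbr_congr (hI : I.WellFormed) (hA : A ⊆ range I.m) (h : ∀ u ∈ I.verts A, u ∈ S ↔ u ∈ S')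
    (v : ℕ) : I.nbr A S v = I.nbr A S' v := by
  unfold nbr
  congr 1
  refine filter_congr fun j hj => ?_
  rw [h _ (ends_mem_verts hI hA hj).1, h _ (ends_mem_verts hI hA hj).2]

theorem closed_boundary (hA : A ⊆ range I.m) : I.Closed A (I.boundary A) := by
  refine ⟨hA, filter_subset _ _, fun v hv => ?_⟩
  simp only [boundary, mem_sdiff, mem_filter, not_and, not_lt] at hv
  exact (cnt_mono hA v).antisymm (hv.2 hv.1)

/-! ### Place-value codes and the uniqueness of their digits. -/

theorem stride_pos (v : ℕ) : 0 < I.stride v := by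
  induction v with
  | zero => exact one_pos
  | succ v ih => exact Nat.mul_pos ih (by positivity)

theorem digit_lt {σ c : ℕ} (hσ : σ ≤ 1) (hc : c ≤ I.d v) : σ + 2 * c < 2 ^ (I.d v + 2) := by
  have : I.d v < 2 ^ I.d v := Nat.lt_two_pow_self
  rw [pow_add]
  omega

theorem sum_stride_lt {f : ℕ → ℕ} (hf : ∀ v, f v < 2 ^ (I.d v + 2)) (n : ℕ) :
    ∑ v ∈ range n, I.stride v * f v < I.stride n := by
  induction n with
  | zero => simp [stride]
  | succ n ih =>
    rw [sum_range_succ, stride]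
    calc _ < I.stride n + I.stride n * f n := by omega
      _ = I.stride n * (f n + 1) := by ring
      _ ≤ _ := Nat.mul_le_mul_left _ (hf n)

/-- The remainder and the quotient by `stride n` separate the lower digits from the top one. -/
theorem sum_stride_inj {f g : ℕ → ℕ} (hf : ∀ v, f v < 2 ^ (I.d v + 2))
    (hg : ∀ v, g v < 2 ^ (I.d v + 2)) {n : ℕ}
    (h : ∑ v ∈ range n, I.stride v * f v = ∑ v ∈ range n, I.stride v * g v) :
    ∀ v < n, f v = g v := by
  induction n with
  | zero => simp
  | succ n ih =>
    rw [sum_range_succ, sum_range_succ] at h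
    have h1 := sum_stride_lt (I := I) hf n
    have h2 := sum_stride_lt (I := I) hg n
    have e1 := congrArg (· % I.stride n) h
    have e2 := congrArg (· / I.stride n) h
    simp only [Nat.add_mul_mod_self_left, Nat.mod_eq_of_lt h1, Nat.mod_eq_of_lt h2] at e1
    simp only [Nat.add_mul_div_left _ _ (stride_pos n), Nat.div_eq_of_lt h1, Nat.div_eq_of_lt h2,
      zero_add] at e2
    intro v hv
    rcases Nat.lt_succ_iff_lt_or_eq.1 hv with hv | rfl
    · exact ih e1 v hv
    · exact e2

theorem sum_stride_subset {X : Finset ℕ} {n : ℕ} (hX : X ⊆ range n) (f : ℕ → ℕ) :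
    ∑ v ∈ X, I.stride v * f v = ∑ v ∈ range n, I.stride v * (if v ∈ X then f v else 0) := by
  simp only [mul_ite, mul_zero, ← sum_filter]
  congr 1
  ext v
  simp only [mem_filter]
  exact ⟨fun h => ⟨hX h, h⟩, fun h => h.2⟩

theorem sum_stride_subset_lt {X : Finset ℕ} (hX : X ⊆ range I.n) {f : ℕ → ℕ}
    (hf : ∀ v ∈ X, f v < 2 ^ (I.d v + 2)) : ∑ v ∈ X, I.stride v * f v < I.stride I.n := by
  rw [sum_stride_subset hX]
  refine sum_stride_lt (fun v => ?_) _
  split_ifs with h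
  · exact hf v h
  · positivity

theorem sum_stride_subset_inj {X : Finset ℕ} (hX : X ⊆ range I.n) {f g : ℕ → ℕ}
    (hf : ∀ v ∈ X, f v < 2 ^ (I.d v + 2)) (hg : ∀ v ∈ X, g v < 2 ^ (I.d v + 2))
    (h : ∑ v ∈ X, I.stride v * f v = ∑ v ∈ X, I.stride v * g v) : ∀ v ∈ X, f v = g v := by
  rw [sum_stride_subset hX, sum_stride_subset hX] at h
  intro v hv
  have := sum_stride_inj (I := I) (fun v => ?_) (fun v => ?_) h v (mem_range.1 (hX hv))
  · simpa [hv] using this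
  · split_ifs with h
    · exact hf v h
    · positivity
  · split_ifs with h
    · exact hg v h
    · positivity

theorem Closed.subset_range (h : I.Closed A X) : X ⊆ range I.n :=
  h.subset.trans (filter_subset _ _)

theorem code_lt (h : I.Closed A X) (S : Finset ℕ) : I.code A X S < I.stride I.n :=
  sum_stride_subset_lt h.subset_range fun v _ =>
    digit_lt (by split_ifs <;> simp) (min_le_left _ _)

section Congr

variable (hI : I.WellFormed) (h : I.Closed A X) (hS : ∀ u ∈ I.verts A, u ∈ S ↔ u ∈ S')
include hS

theorem cost_congr : I.cost A X S = I.cost A X S' :=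
  sum_congr rfl fun v hv => if_congr (hS v (sdiff_subset hv)) rfl rfl

include hI h

theorem sat_congr : I.Sat A X S ↔ I.Sat A X S' :=
  forall₂_congr fun v _ => by rw [nbr_congr hI h.edges hS]

end Congr

theorem best_pos_iff {k : ℕ} : 0 < I.best A X k ↔
    ∃ S, I.Sat A X S ∧ I.code A X S = k ∧ I.best A X k = I.cost A X S + 1 := by
  constructor
  · intro h
    have hne := Nat.nonempty_of_pos_sInf h
    exact Nat.sInf_mem hne
  · rintro ⟨S, -, -, h⟩
    omega

theorem best_le (h : I.Sat A X S) : I.best A X (I.code A X S) ≤ I.cost A X S + 1 :=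
  Nat.sInf_le ⟨S, h, rfl, rfl⟩

theorem best_pos (h : I.Sat A X S) : 0 < I.best A X (I.code A X S) := by
  have : {c | ∃ S', I.Sat A X S' ∧ I.code A X S' = I.code A X S ∧
    c = I.cost A X S' + 1}.Nonempty := ⟨_, S, h, rfl, rfl⟩
  obtain ⟨S', -, -, h'⟩ := Nat.sInf_mem this
  unfold best
  omega

/-- The vertices in two boundaries that remain in the boundary of the union. -/
def joined (I : Network) (A X B Y : Finset ℕ) : Finset ℕ :=
  {v ∈ X ∪ Y | I.cnt A v + I.cnt B v < I.deg v}

/-- The data of a vertex when the edge sets `A` and `B` are united. -/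
def info (I : Network) (A B : Finset ℕ) (v : ℕ) : VertexInfo :=
  ⟨I.stride v, I.d v, I.cnt A v, I.cnt B v, I.weight v, I.cnt A v + I.cnt B v < I.deg v⟩

theorem contribution_info (A B : Finset ℕ) (v σ p q : ℕ) :
    (I.info A B v).contribution σ p q =
      ⟨σ * (if 0 < I.cnt A v then I.stride v else 0) + p * (2 * I.stride v),
        σ * (if 0 < I.cnt B v then I.stride v else 0) + q * (2 * I.stride v),
        if I.cnt A v + I.cnt B v < I.deg v then
          σ * I.stride v + min (I.d v) (p + q) * (2 * I.stride v) else 0,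
        if I.cnt A v + I.cnt B v < I.deg v then 0 else σ * I.weight v, 0⟩ := by
  unfold info VertexInfo.contribution
  ext
  · rfl
  · rfl
  · dsimp only; split_ifs <;> rfl
  · dsimp only; split_ifs <;> rfl
  · rfl

/-- Two edge sets to be united. -/
structure Joinable (I : Network) (A X B Y : Finset ℕ) : Prop where
  wf : I.WellFormed
  left : I.Closed A X
  right : I.Closed B Y
  disj : Disjoint A B

/-! ### Gluing partial solutions of two disjoint edge sets. -/

namespace Joinable
variable (h : I.Joinable A X B Y)
include h

theorem symm : I.Joinable B Y A X := ⟨h.wf, h.right, h.left, h.disj.symm⟩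

theorem cnt_add_le (v : ℕ) : I.cnt A v + I.cnt B v ≤ I.deg v := by
  rw [← cnt_union h.disj]
  exact cnt_mono (union_subset h.left.edges h.right.edges) v

/-- All edges at such a vertex lie in `A`, which leaves none for the disjoint set `B`. -/
theorem cnt_right_eq_zero (hv : v ∈ I.verts A \ X) : I.cnt B v = 0 := by
  have := h.cnt_add_le v
  have := h.left.full v hv
  omega

/-- Otherwise all edges at the vertex would lie in `A`, although a vertex of `Y` has an edge in `B`.
-/
theorem cnt_left_eq_zero (hv : v ∈ Y \ X) : I.cnt A v = 0 := by
  rw [mem_sdiff] at hv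
  by_contra hc
  have h1 : v ∈ I.verts A := (mem_verts_iff h.wf h.left.edges).2 (by omega)
  have h2 := h.cnt_right_eq_zero (mem_sdiff.2 ⟨h1, hv.2⟩)
  have h3 := (mem_verts_iff h.wf h.right.edges).1 (h.right.subset hv.1)
  omega

theorem verts_union : I.verts (A ∪ B) = I.verts A ∪ I.verts B := by
  ext v
  have hAB := union_subset h.left.edges h.right.edges
  rw [mem_union, mem_verts_iff h.wf hAB, mem_verts_iff h.wf h.left.edges,
    mem_verts_iff h.wf h.right.edges, cnt_union h.disj]
  omega

/-- A vertex of `A` outside `X`, or of `B` outside `Y`, has all its edges in the union, so the new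
boundary is found inside `X ∪ Y`. -/
theorem joined_eq_boundary : I.joined A X B Y = I.boundary (A ∪ B) := by
  ext v
  simp only [joined, boundary, mem_filter, cnt_union h.disj, h.verts_union, mem_union]
  constructor
  · rintro ⟨hv, hlt⟩
    exact ⟨hv.imp (fun a => h.left.subset a) (fun a => h.right.subset a), hlt⟩
  · rintro ⟨hv, hlt⟩
    refine ⟨?_, hlt⟩
    by_contra hc
    rw [not_or] at hc
    rcases hv with hv | hv
    · have := h.left.full v (mem_sdiff.2 ⟨hv, hc.1⟩)
      omega
    · have := h.right.full v (mem_sdiff.2 ⟨hv, hc.2⟩)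
      omega

theorem disjoint_sdiff : Disjoint (I.verts A \ X) (I.verts B \ Y) := by
  rw [disjoint_left]
  intro v h1 h2
  have := h.cnt_right_eq_zero h1
  have := (mem_verts_iff h.wf h.right.edges).1 (sdiff_subset h2)
  omega

theorem disjoint_sdiff_union : Disjoint (I.verts A \ X) (X ∪ Y) := by
  rw [disjoint_left]
  intro v h1 h2
  have h3 := h.cnt_right_eq_zero h1
  rcases mem_union.1 h2 with h2 | h2
  · exact (mem_sdiff.1 h1).2 h2
  · have := (mem_verts_iff h.wf h.right.edges).1 (h.right.subset h2)
    omega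

/-- The finished vertices are those of `A`, those of `B`, and those whose last edges meet in this
union. The three pieces are disjoint, so costs add up and the demands can be treated piecewise. -/
theorem verts_sdiff_joined : I.verts (A ∪ B) \ I.joined A X B Y =
    (I.verts A \ X ∪ I.verts B \ Y) ∪ {v ∈ X ∪ Y | ¬ I.cnt A v + I.cnt B v < I.deg v} := by
  ext v
  have h1 : v ∈ I.verts A \ X → ¬ I.cnt A v + I.cnt B v < I.deg v := fun hv => by
    have := h.left.full v hv; omega
  have h2 : v ∈ I.verts B \ Y → ¬ I.cnt A v + I.cnt B v < I.deg v := fun hv => by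
    have := h.right.full v hv; omega
  have h3 : v ∈ X → v ∈ I.verts A := fun hv => h.left.subset hv
  have h4 : v ∈ Y → v ∈ I.verts B := fun hv => h.right.subset hv
  rw [h.verts_union]
  simp only [joined, mem_sdiff, mem_union, mem_filter] at *
  tauto

theorem cost_joined (S : Finset ℕ) : I.cost (A ∪ B) (I.joined A X B Y) S =
    I.cost A X S + I.cost B Y S +
      ∑ v ∈ X ∪ Y, if I.cnt A v + I.cnt B v < I.deg v then 0 else if v ∈ S then I.weight v else 0 := by
  rw [cost, h.verts_sdiff_joined, sum_union, sum_union h.disjoint_sdiff, sum_filter]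
  · congr 1
    refine sum_congr rfl fun v _ => ?_
    split_ifs <;> simp_all
  · refine Disjoint.mono_right (filter_subset _ _) (disjoint_union_left.2
      ⟨h.disjoint_sdiff_union, ?_⟩)
    rw [union_comm]
    exact h.symm.disjoint_sdiff_union

theorem nbr_joined_left (hv : v ∈ I.verts A \ X) (S : Finset ℕ) :
    I.nbr (A ∪ B) S v = I.nbr A S v := by
  have := h.cnt_right_eq_zero hv
  have := nbr_le_cnt (I := I) B S v
  rw [nbr_union h.disj]
  omega

theorem sat_joined (S : Finset ℕ) : I.Sat (A ∪ B) (I.joined A X B Y) S ↔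
    I.Sat A X S ∧ I.Sat B Y S ∧ ∀ v ∈ X ∪ Y, I.cnt A v + I.cnt B v < I.deg v ∨
      I.d v ≤ min (I.d v) (min (I.d v) (I.nbr A S v) + min (I.d v) (I.nbr B S v)) := by
  unfold Sat
  rw [h.verts_sdiff_joined]
  simp only [forall_mem_union, and_assoc]
  refine and_congr ?_ (and_congr ?_ ?_)
  · exact forall₂_congr fun v hv => by rw [h.nbr_joined_left hv]
  · refine forall₂_congr fun v hv => ?_
    rw [union_comm A, h.symm.nbr_joined_left hv]
  · rw [← forall_mem_union]
    simp only [mem_filter, and_imp]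
    refine forall₂_congr fun v hv => ?_
    rw [nbr_union h.disj]
    -- Truncating both counts at the demand does not affect whether their sum reaches it.
    have e : ∀ d p q : ℕ, (d ≤ min d (min d p + min d q) ↔ d ≤ p + q) := by
      intro d p q; omega
    rw [e]
    tauto

theorem code_joined (S : Finset ℕ) : I.code (A ∪ B) (I.joined A X B Y) S =
    ∑ v ∈ X ∪ Y, if I.cnt A v + I.cnt B v < I.deg v then
      (if v ∈ S then 1 else 0) * I.stride v +
        min (I.d v) (min (I.d v) (I.nbr A S v) + min (I.d v) (I.nbr B S v)) * (2 * I.stride v)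
      else 0 := by
  rw [code, joined, sum_filter]
  refine sum_congr rfl fun v _ => ?_
  rw [nbr_union h.disj, show min (I.d v) (I.nbr A S v + I.nbr B S v) =
    min (I.d v) (min (I.d v) (I.nbr A S v) + min (I.d v) (I.nbr B S v)) by omega]
  split_ifs <;> ring

/-- A vertex of `Y \ X` has no edge in `A`: its count is forced to be 0 and the guard suppresses its
selection digit. Hence an entry carries exactly a code for `X`. -/
theorem sum_left {σ p : ℕ → ℕ} (hp : ∀ v ∈ X ∪ Y, p v ≤ I.cnt A v) :
    ∑ v ∈ X ∪ Y, (σ v * (if 0 < I.cnt A v then I.stride v else 0) + p v * (2 * I.stride v)) =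
      ∑ v ∈ X, I.stride v * (σ v + 2 * p v) := by
  symm
  rw [← sum_subset (subset_union_left (s₂ := Y))]
  · refine sum_congr rfl fun v hv => ?_
    rw [if_pos ((mem_verts_iff h.wf h.left.edges).1 (h.left.subset hv))]
    ring
  · intro v hv hvX
    have hv' := (mem_union.1 hv).resolve_left hvX
    have h0 := h.cnt_left_eq_zero (mem_sdiff.2 ⟨hv', hvX⟩)
    have := hp v hv
    simp [h0, show p v = 0 by omega]

theorem sum_right {σ p : ℕ → ℕ} (hp : ∀ v ∈ X ∪ Y, p v ≤ I.cnt B v) :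
    ∑ v ∈ X ∪ Y, (σ v * (if 0 < I.cnt B v then I.stride v else 0) + p v * (2 * I.stride v)) =
      ∑ v ∈ Y, I.stride v * (σ v + 2 * p v) := by
  rw [union_comm X]
  exact h.symm.sum_left fun v hv => hp v (by rwa [union_comm])

/-- The choices at the vertex `v` that a set makes, and the entry that belongs to the set. -/
theorem mem_choiceList_of_sat {U : List ℕ} (hU : U.Nodup) (hUX : U.toFinset = X ∪ Y)
    (hS : I.Sat (A ∪ B) (I.joined A X B Y) S) :
    ∃ y ∈ choiceList (I.info A B) U, y.f = I.code A X S ∧ y.g = I.code B Y S ∧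
      y.e = I.code (A ∪ B) (I.joined A X B Y) S ∧
      I.cost (A ∪ B) (I.joined A X B Y) S = I.cost A X S + I.cost B Y S + y.w := by
  have hmem : ∀ v, v ∈ U ↔ v ∈ X ∪ Y := by intro v; rw [← hUX, List.mem_toFinset]
  have hA : ∀ v, min (I.d v) (I.nbr A S v) ≤ I.cnt A v := fun v =>
    (min_le_right _ _).trans (nbr_le_cnt A S v)
  have hB : ∀ v, min (I.d v) (I.nbr B S v) ≤ I.cnt B v := fun v =>
    (min_le_right _ _).trans (nbr_le_cnt B S v)
  refine ⟨_, (mem_choiceList _ hU _).2 ⟨fun v => if v ∈ S then 1 else 0,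
    fun v => min (I.d v) (I.nbr A S v), fun v => min (I.d v) (I.nbr B S v), ?_, rfl⟩, ?_⟩
  · intro v hv
    refine ⟨by dsimp only; split_ifs <;> omega, le_min (min_le_left _ _) (hA v),
      le_min (min_le_left _ _) (hB v),
      ((h.sat_joined S).1 hS).2.2 v ((hmem v).1 hv)⟩
  · simp only [hUX, contribution_info]
    rw [h.sum_left fun v _ => hA v, h.sum_right fun v _ => hB v, h.cost_joined, h.code_joined]
    refine ⟨rfl, rfl, rfl, ?_⟩
    · congr 1
      refine sum_congr rfl fun v _ => ?_
      split_ifs <;> simp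

/-- Two partial solutions that agree with an entry can be glued. -/
theorem sat_of_mem_choiceList {U : List ℕ} (hU : U.Nodup) (hUX : U.toFinset = X ∪ Y) {y : Entry}
    (hy : y ∈ choiceList (I.info A B) U) {S₁ S₂ : Finset ℕ} (h₁ : I.Sat A X S₁)
    (h₂ : I.Sat B Y S₂) (hf : I.code A X S₁ = y.f) (hg : I.code B Y S₂ = y.g) :
    ∃ S, I.Sat (A ∪ B) (I.joined A X B Y) S ∧ I.code (A ∪ B) (I.joined A X B Y) S = y.e ∧
      I.cost (A ∪ B) (I.joined A X B Y) S = I.cost A X S₁ + I.cost B Y S₂ + y.w := by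
  have hmem : ∀ v, v ∈ U ↔ v ∈ X ∪ Y := by intro v; rw [← hUX, List.mem_toFinset]
  obtain ⟨σ, p, q, hval, rfl⟩ := (mem_choiceList _ hU _).1 hy
  simp only [hUX, contribution_info] at hf hg ⊢
  have hσ : ∀ v ∈ X ∪ Y, σ v < 2 := fun v hv => (hval v ((hmem v).2 hv)).1
  have hp : ∀ v ∈ X ∪ Y, p v ≤ min (I.d v) (I.cnt A v) := fun v hv => (hval v ((hmem v).2 hv)).2.1
  have hq : ∀ v ∈ X ∪ Y, q v ≤ min (I.d v) (I.cnt B v) :=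
    fun v hv => (hval v ((hmem v).2 hv)).2.2.1
  rw [h.sum_left fun v hv => (hp v hv).trans (min_le_right _ _)] at hf
  rw [h.sum_right fun v hv => (hq v hv).trans (min_le_right _ _)] at hg
  -- The parity of a digit gives the selection, and the rest gives the count.
  have digits : ∀ {σ p s k d : ℕ}, s ≤ 1 → σ < 2 → s + 2 * min d k = σ + 2 * p →
      s = σ ∧ min d k = p := by
    intros; omega
  have hA : ∀ v ∈ X, (if v ∈ S₁ then 1 else 0) = σ v ∧ min (I.d v) (I.nbr A S₁ v) = p v := by
    intro v hv
    refine digits (by split_ifs <;> simp) (hσ v (mem_union_left _ hv))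
      (sum_stride_subset_inj h.left.subset_range (fun v _ =>
        digit_lt (by split_ifs <;> simp) (min_le_left _ _)) (fun v hv => ?_) hf v hv)
    have := hσ v (mem_union_left _ hv)
    exact digit_lt (by omega) ((hp v (mem_union_left _ hv)).trans (min_le_left _ _))
  have hB : ∀ v ∈ Y, (if v ∈ S₂ then 1 else 0) = σ v ∧ min (I.d v) (I.nbr B S₂ v) = q v := by
    intro v hv
    refine digits (by split_ifs <;> simp) (hσ v (mem_union_right _ hv))
      (sum_stride_subset_inj h.right.subset_range (fun v _ =>
        digit_lt (by split_ifs <;> simp) (min_le_left _ _)) (fun v hv => ?_) hg v hv)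
    have := hσ v (mem_union_right _ hv)
    exact digit_lt (by omega) ((hq v (mem_union_right _ hv)).trans (min_le_left _ _))
  -- A vertex common to `A` and `B` lies in both `X` and `Y`, and there both sets make the selection
  -- σ, so the asymmetric definition agrees with `S₂` on all vertices of `B`.
  set S : Finset ℕ := {v ∈ S₁ | v ∈ I.verts A} ∪ {v ∈ S₂ | v ∉ I.verts A} with hS
  have hS₁ : ∀ u ∈ I.verts A, u ∈ S ↔ u ∈ S₁ := by
    intro u hu
    simp [hS, hu]
  have hS₂ : ∀ u ∈ I.verts B, u ∈ S ↔ u ∈ S₂ := by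
    intro u hu
    by_cases huA : u ∈ I.verts A
    · rw [hS₁ u huA]
      have hX : u ∈ X := by
        by_contra hc
        have := h.cnt_right_eq_zero (mem_sdiff.2 ⟨huA, hc⟩)
        have := (mem_verts_iff h.wf h.right.edges).1 hu
        omega
      have hY : u ∈ Y := by
        by_contra hc
        have := h.symm.cnt_right_eq_zero (mem_sdiff.2 ⟨hu, hc⟩)
        have := (mem_verts_iff h.wf h.left.edges).1 huA
        omega
      have e := (hA u hX).1.trans (hB u hY).1.symm
      constructor <;> intro h1 <;> by_contra h2 <;> simp [h1, h2] at e
    · simp [hS, huA]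
  have hσS : ∀ v ∈ X ∪ Y, (if v ∈ S then 1 else 0) = σ v := by
    intro v hv
    by_cases hvX : v ∈ X
    · rw [if_congr (hS₁ v (h.left.subset hvX)) rfl rfl]
      exact (hA v hvX).1
    · have hvY := (mem_union.1 hv).resolve_left hvX
      rw [if_congr (hS₂ v (h.right.subset hvY)) rfl rfl]
      exact (hB v hvY).1
  have hpS : ∀ v ∈ X ∪ Y, min (I.d v) (I.nbr A S v) = p v := by
    intro v hv
    rw [nbr_congr h.wf h.left.edges hS₁]
    by_cases hvX : v ∈ X
    · exact (hA v hvX).2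
    · have hvY := (mem_union.1 hv).resolve_left hvX
      have h0 := h.cnt_left_eq_zero (mem_sdiff.2 ⟨hvY, hvX⟩)
      have h1 := nbr_le_cnt (I := I) A S₁ v
      have h2 := hp v hv
      omega
  have hqS : ∀ v ∈ X ∪ Y, min (I.d v) (I.nbr B S v) = q v := by
    intro v hv
    rw [nbr_congr h.wf h.right.edges hS₂]
    by_cases hvY : v ∈ Y
    · exact (hB v hvY).2
    · have hvX := (mem_union.1 hv).resolve_right hvY
      have h0 := h.symm.cnt_left_eq_zero (mem_sdiff.2 ⟨hvX, hvY⟩)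
      have h1 := nbr_le_cnt (I := I) B S₂ v
      have h2 := hq v hv
      omega
  refine ⟨S, (h.sat_joined S).2 ⟨(sat_congr h.wf h.left hS₁).2 h₁, (sat_congr h.wf h.right hS₂).2 h₂,
    fun v hv => ?_⟩, ?_, ?_⟩
  · rw [hpS v hv, hqS v hv]
    exact (hval v ((hmem v).2 hv)).2.2.2
  · rw [h.code_joined]
    refine sum_congr rfl fun v hv => ?_
    rw [hσS v hv, hpS v hv, hqS v hv]
  · rw [h.cost_joined, cost_congr hS₁, cost_congr hS₂]
    congr 1
    refine sum_congr rfl fun v hv => ?_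
    rw [← hσS v hv]
    split_ifs <;> simp

/-- The table of the union results from the choices and from the tables of the two parts. -/
theorem best_joined {U : List ℕ} (hU : U.Nodup) (hUX : U.toFinset = X ∪ Y) (k : ℕ) :
    I.best (A ∪ B) (I.joined A X B Y) k =
      sInf {c | ∃ y ∈ choiceList (I.info A B) U, y.e = k ∧ 0 < I.best A X y.f ∧
        0 < I.best B Y y.g ∧ c = I.best A X y.f + I.best B Y y.g - 1 + y.w} := by
  -- Two sets of natural numbers each of which lies above elements of the other have the same
  -- infimum; they are also empty simultaneously, which covers the default value.
  have key : ∀ s t : Set ℕ, (∀ x ∈ s, ∃ y ∈ t, y ≤ x) → (∀ x ∈ t, ∃ y ∈ s, y ≤ x) →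
      sInf s = sInf t := by
    intro s t hst hts
    rcases s.eq_empty_or_nonempty with rfl | hs
    · rcases t.eq_empty_or_nonempty with rfl | ht
      · rfl
      · obtain ⟨x, hx⟩ := ht
        obtain ⟨y, hy, -⟩ := hts x hx
        exact absurd hy (Set.notMem_empty _)
    · obtain ⟨x, hx⟩ := hs
      have ht : t.Nonempty := (hst x hx).imp fun _ h => h.1
      refine le_antisymm ?_ ?_
      · obtain ⟨y, hy, hle⟩ := hts _ (Nat.sInf_mem ht)
        exact (Nat.sInf_le hy).trans hle
      · obtain ⟨y, hy, hle⟩ := hst _ (Nat.sInf_mem ⟨x, hx⟩)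
        exact (Nat.sInf_le hy).trans hle
  refine key _ _ ?_ ?_
  · rintro _ ⟨S, hS, rfl, rfl⟩
    obtain ⟨y, hy, hf, hg, he, hw⟩ := h.mem_choiceList_of_sat hU hUX hS
    obtain ⟨h₁, h₂, -⟩ := (h.sat_joined S).1 hS
    have p1 := best_pos h₁
    have p2 := best_pos h₂
    have l1 := best_le h₁
    have l2 := best_le h₂
    rw [← hf] at p1 l1
    rw [← hg] at p2 l2
    -- Both table values carry a shift by one, so one of the two shifts is subtracted.
    exact ⟨_, ⟨y, hy, he, p1, p2, rfl⟩, by omega⟩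
  · rintro _ ⟨y, hy, rfl, h₁, h₂, rfl⟩
    obtain ⟨S₁, hS₁, hc₁, hb₁⟩ := best_pos_iff.1 h₁
    obtain ⟨S₂, hS₂, hc₂, hb₂⟩ := best_pos_iff.1 h₂
    obtain ⟨S, hS, he, hw⟩ := h.sat_of_mem_choiceList hU hUX hy hS₁ hS₂ hc₁ hc₂
    exact ⟨_, ⟨S, hS, he, rfl⟩, by omega⟩

end Joinable
end Network
end TVD

namespace TVD
open Program

/-! ## The list of the vertices in two boundaries -/

/-- The values `f a, …, f (a + k - 1)`. -/
def segment (f : ℕ → ℕ) (a k : ℕ) : List ℕ := (List.range k).map fun i => f (a + i)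

@[simp] theorem segment_zero (f : ℕ → ℕ) (a : ℕ) : segment f a 0 = [] := rfl

theorem segment_succ (f : ℕ → ℕ) (a k : ℕ) :
    segment f a (k + 1) = segment f a k ++ [f (a + k)] := by
  simp [segment, List.range_succ]

@[simp] theorem length_segment (f : ℕ → ℕ) (a k : ℕ) : (segment f a k).length = k := by
  simp [segment]

theorem segment_congr {f g : ℕ → ℕ} {a k : ℕ} (h : ∀ i < k, f (a + i) = g (a + i)) :
    segment f a k = segment g a k :=
  List.map_congr_left fun i hi => h i (List.mem_range.1 hi)

theorem segment_take (f : ℕ → ℕ) (a : ℕ) {i k : ℕ} (h : i ≤ k) :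
    (segment f a k).take i = segment f a i := by
  rw [segment, ← List.map_take, List.take_range, min_eq_left h, segment]

def loadFirstStep : Program :=
  block [.add Reg.t1 Reg.sa Reg.i, .load Reg.v Arr.LV Reg.t1, .load Reg.t2 Arr.LC Reg.t1,
    .store Arr.CA Reg.v Reg.t2, .store Arr.UV Reg.nu Reg.v, .add Reg.nu Reg.nu Reg.one,
    .add Reg.i Reg.i Reg.one]

/-- The counts in a slot are positive, so a nonzero cell of `CA` marks the vertices of the first
list; this is how duplicates are avoided in constant time. -/
def loadSecondStep : Program :=
  block [.add Reg.t1 Reg.sb Reg.i, .load Reg.v Arr.LV Reg.t1, .load Reg.t2 Arr.LC Reg.t1,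
    .store Arr.CB Reg.v Reg.t2, .load Reg.t3 Arr.CA Reg.v,
    .ite Reg.zero Reg.t3 .skip
      (block [.store Arr.UV Reg.nu Reg.v, .add Reg.nu Reg.nu Reg.one]),
    .add Reg.i Reg.i Reg.one]

theorem run_loadFirst {s : State} {c : ℕ → ℕ} {l : List ℕ}
    (hl : segment (s.arr Arr.LV) (s.var Reg.sa) (s.var Reg.la) = l)
    (hc : ∀ i < s.var Reg.la, s.arr Arr.LC (s.var Reg.sa + i) =
      c (s.arr Arr.LV (s.var Reg.sa + i)))
    (hi : s.var Reg.i = 0) (hnu : s.var Reg.nu = 0) (hCA : ∀ v, s.arr Arr.CA v = 0)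
    (h1 : s.var Reg.one = 1) :
    Run (.loop Reg.i Reg.la loadFirstStep) s (1 + l.length * 8) fun s' =>
      segment (s'.arr Arr.UV) 0 (s'.var Reg.nu) = l ∧
      ∀ v, s'.arr Arr.CA v = if v ∈ l then c v else 0 := by
  have hlen : l.length = s.var Reg.la := by rw [← hl, length_segment]
  refine (Run.forLoop_const (k := l.length) (c := 7) (fun i s' => s'.var Reg.i = i ∧
    s'.var Reg.nu = i ∧ segment (s'.arr Arr.UV) 0 i = l.take i ∧
      ∀ v, s'.arr Arr.CA v = if v ∈ l.take i then c v else 0)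
      ?_ ?_ ?_ le_rfl).mono le_rfl ?_
  · simp [hi, hnu, hCA]
  · rintro i s' - ⟨hi, -⟩ hF
    rw [hi, hF.var _ rfl, hlen]
  · rintro i s' hi' ⟨h2, h3, h4, h5⟩ hF
    have e1 : s'.var Reg.sa = s.var Reg.sa := hF.var _ rfl
    have e2 : s'.var Reg.one = 1 := (hF.var _ rfl).trans h1
    have e3 : s'.arr Arr.LV = s.arr Arr.LV := hF.arr _ rfl
    have e4 : s'.arr Arr.LC = s.arr Arr.LC := hF.arr _ rfl
    have htake : l.take (i + 1) = l.take i ++ [s.arr Arr.LV (s.var Reg.sa + i)] := by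
      rw [← hl, segment_take _ _ (by omega), segment_take _ _ (by omega), segment_succ]
    have hci := hc i (by omega)
    refine Run.straight rfl (by decide) ?_
    simp only [Reg.sa, Reg.one, Arr.LV, Arr.LC, Reg.i, Reg.nu, Arr.UV, Arr.CA] at *
    refine ⟨?_, ?_, ?_, ?_⟩
    · simp [loadFirstStep, block, Program.ev, e2, h2]
    · simp [loadFirstStep, block, Program.ev, e2, h3]
    · rw [segment_succ, htake, ← h4]
      congr 1
      · refine segment_congr fun j hj => ?_
        simp [loadFirstStep, block, Program.ev, h3, hj.ne]
      · simp [loadFirstStep, block, Program.ev, h3, e1, e3, h2]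
    · intro v
      have : (loadFirstStep.ev s').arr 18 v = if v = s.arr 15 (s.var 12 + i) then
          c (s.arr 15 (s.var 12 + i)) else s'.arr 18 v := by
        simp [loadFirstStep, block, Program.ev, h2, e1, e3, e4, Function.update_apply, hci]
      rw [this, htake, h5]
      by_cases hv : v = s.arr 15 (s.var 12 + i) <;> simp [hv]
  · rintro s' ⟨-, h3, h4, h5⟩
    rw [h3, h4]
    simpa using h5

theorem run_loadSecond {s : State} {c c' : ℕ → ℕ} {l l' : List ℕ}
    (hU : segment (s.arr Arr.UV) 0 (s.var Reg.nu) = l)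
    (hCA : ∀ v, s.arr Arr.CA v = if v ∈ l then c v else 0) (hpos : ∀ v ∈ l, 0 < c v)
    (hl : segment (s.arr Arr.LV) (s.var Reg.sb) (s.var Reg.lb) = l')
    (hc : ∀ i < s.var Reg.lb, s.arr Arr.LC (s.var Reg.sb + i) =
      c' (s.arr Arr.LV (s.var Reg.sb + i)))
    (hi : s.var Reg.i = 0) (hCB : ∀ v, s.arr Arr.CB v = 0)
    (h1 : s.var Reg.one = 1) (h0 : s.var Reg.zero = 0) :
    Run (.loop Reg.i Reg.lb loadSecondStep) s (1 + l'.length * 10) fun s' =>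
      segment (s'.arr Arr.UV) 0 (s'.var Reg.nu) = l ++ l'.filter (· ∉ l) ∧
      ∀ v, s'.arr Arr.CB v = if v ∈ l' then c' v else 0 := by
  have hlen : l'.length = s.var Reg.lb := by rw [← hl, length_segment]
  refine (Run.forLoop_const (k := l'.length) (c := 9) (fun i s' => s'.var Reg.i = i ∧
    segment (s'.arr Arr.UV) 0 (s'.var Reg.nu) = l ++ (l'.take i).filter (· ∉ l) ∧
      ∀ v, s'.arr Arr.CB v = if v ∈ l'.take i then c' v else 0)
      ?_ ?_ ?_ le_rfl).mono le_rfl ?_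
  · simp only [List.take_zero, List.filter_nil, List.append_nil, List.not_mem_nil, if_false]
    exact ⟨hi, hU, hCB⟩
  · rintro i s' - ⟨hi, -⟩ hF
    rw [hi, hF.var _ rfl, hlen]
  · rintro i s' hi' ⟨h2, h4, h5⟩ hF
    have e1 : s'.var Reg.sb = s.var Reg.sb := hF.var _ rfl
    have e2 : s'.var Reg.one = 1 := (hF.var _ rfl).trans h1
    have e0 : s'.var Reg.zero = 0 := (hF.var _ rfl).trans h0
    have e3 : s'.arr Arr.LV = s.arr Arr.LV := hF.arr _ rfl
    have e4 : s'.arr Arr.LC = s.arr Arr.LC := hF.arr _ rfl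
    have e5 : s'.arr Arr.CA = s.arr Arr.CA := hF.arr _ rfl
    have htake : l'.take (i + 1) = l'.take i ++ [s.arr Arr.LV (s.var Reg.sb + i)] := by
      rw [← hl, segment_take _ _ (by omega), segment_take _ _ (by omega), segment_succ]
    have hci := hc i (by omega)
    set u := s.arr Arr.LV (s.var Reg.sb + i) with hu
    -- This is where the positivity of the counts is used: the cell doubles as a membership test.
    have hcond : (0 < s.arr Arr.CA u) ↔ u ∈ l := by
      rw [hCA]
      split_ifs with h
      · simp [h, hpos u h]
      · simp [h]
    refine Run.straight rfl (by decide) ?_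
    simp only [Reg.sb, Reg.one, Reg.zero, Arr.LV, Arr.LC, Reg.i, Reg.nu, Arr.UV, Arr.CA, Arr.CB] at *
    refine ⟨?_, ?_, ?_⟩
    · by_cases hul : u ∈ l <;> rw [← hcond] at hul <;>
      simp [loadSecondStep, block, Program.ev, e2, h2, e0, e1, e3, e5, ← hu, hul]
    · rw [htake, List.filter_append, ← List.append_assoc, ← h4]
      by_cases hul : u ∈ l
      · have hul' := hcond.2 hul
        have : (loadSecondStep.ev s').var 18 = s'.var 18 := by
          simp [loadSecondStep, block, Program.ev, e2, h2, e0, e1, e3, e5, ← hu, hul']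
        rw [this]
        simp [hul]
        refine segment_congr fun j hj => ?_
        simp [loadSecondStep, block, Program.ev, e2, h2, e0, e1, e3, e5, ← hu, hul']
      · have hul' := hul
        rw [← hcond] at hul'
        have : (loadSecondStep.ev s').var 18 = s'.var 18 + 1 := by
          simp [loadSecondStep, block, Program.ev, e2, h2, e0, e1, e3, e5, ← hu, hul']
        rw [this, segment_succ]
        simp only [List.filter_cons, List.filter_nil, hul, not_false_eq_true, decide_true, if_true]
        congr 1
        · refine segment_congr fun j hj => ?_
          simp [loadSecondStep, block, Program.ev, e2, h2, e0, e1, e3, e5, ← hu, hul', hj.ne]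
        · simp [loadSecondStep, block, Program.ev, e2, h2, e0, e1, e3, e5, ← hu, hul']
    · intro v
      have : (loadSecondStep.ev s').arr 19 v = if v = u then c' u else s'.arr 19 v := by
        by_cases hul : u ∈ l <;> rw [← hcond] at hul <;>
        simp [loadSecondStep, block, Program.ev, h2, e0, e1, e3, e4, e5, ← hu, hul,
          Function.update_apply, hci]
      rw [this, htake, h5]
      by_cases hv : v = u <;> simp [hv]
  · rintro s' ⟨-, h4, h5⟩
    rw [h4]
    simpa using h5

end TVD

namespace TVD
open Program

/-! ## Expanding all choices for one vertex -/

def vertexLoad : Program :=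
  block [.load Reg.v Arr.UV Reg.k, .load Reg.ca Arr.CA Reg.v, .load Reg.cb Arr.CB Reg.v,
    .load Reg.dv Arr.dem Reg.v, .load Reg.s Arr.S Reg.v, .add Reg.s2 Reg.s Reg.s,
    .load Reg.t1 Arr.P Reg.v, .add Reg.wt Reg.pn Reg.t1,
    .ite Reg.dv Reg.ca (.copy Reg.k1 Reg.dv) (.copy Reg.k1 Reg.ca), .add Reg.k1 Reg.k1 Reg.one,
    .ite Reg.dv Reg.cb (.copy Reg.k2 Reg.dv) (.copy Reg.k2 Reg.cb), .add Reg.k2 Reg.k2 Reg.one]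

/-- Decide whether the vertex stays in the boundary, and enter it in the new list if it does. -/
def vertexKeep : Program :=
  block [.add Reg.t2 Reg.ca Reg.cb, .load Reg.t3 Arr.deg Reg.v,
    .ite Reg.t2 Reg.t3
      (block [.copy Reg.es Reg.s, .copy Reg.es2 Reg.s2, .const Reg.wt 0, .const Reg.nd 0,
        .add Reg.t4 Reg.lp Reg.nl, .store Arr.LV Reg.t4 Reg.v, .store Arr.LC Reg.t4 Reg.t2,
        .add Reg.nl Reg.nl Reg.one])
      (block [.const Reg.es 0, .const Reg.es2 0, .copy Reg.nd Reg.dv])]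

/-- The scratch cells of a vertex are cleared as soon as they have been read, so that both arrays
are 0 again after a union without a separate pass. -/
def vertexParams : Program :=
  block [.const Reg.t4 0, .store Arr.CA Reg.v Reg.t4, .store Arr.CB Reg.v Reg.t4,
    .const Reg.pK 2, .ite Reg.zero Reg.ca (.copy Reg.df Reg.s) (.const Reg.df 0),
    .ite Reg.zero Reg.cb (.copy Reg.dg Reg.s) (.const Reg.dg 0), .copy Reg.de Reg.es,
    .copy Reg.dw Reg.wt, .const Reg.dc 0, .const Reg.lim 1, .const Reg.need 0, .const Reg.rst 0]

def vertexInit : Program := block [vertexLoad, vertexKeep, vertexParams]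

/-- Parameters that are not set keep their values: `need` and `rst` are still 0 here, and
`sndParams` inherits `de`, `dw`, `dc` and `lim`. -/
def fstParams : Program :=
  block [.copy Reg.pK Reg.k1, .copy Reg.df Reg.s2, .const Reg.dg 0, .copy Reg.de Reg.es2,
    .const Reg.dw 0, .const Reg.dc 1, .copy Reg.lim Reg.dv]

def sndParams : Program :=
  block [.copy Reg.pK Reg.k2, .const Reg.df 0, .copy Reg.dg Reg.s2, .copy Reg.need Reg.nd,
    .copy Reg.rst Reg.dv]

def vertexStep : Program :=
  block [vertexInit, expand, fstParams, expand, sndParams, expand, .add Reg.k Reg.k Reg.one]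

/-- The data of the vertex that is processed next. -/
def currentInfo (s : State) : VertexInfo :=
  let v := s.arr Arr.UV (s.var Reg.k)
  ⟨s.arr Arr.S v, s.arr Arr.dem v, s.arr Arr.CA v, s.arr Arr.CB v, s.var Reg.pn + s.arr Arr.P v,
    s.arr Arr.CA v + s.arr Arr.CB v < s.arr Arr.deg v⟩

theorem ev_vertexInit {s : State} (h1 : s.var Reg.one = 1) (h0 : s.var Reg.zero = 0) :
    let i := currentInfo s
    let s' := vertexInit.ev s
    Expansion.ofState s' = i.selExpansion ∧ s'.var Reg.k1 = i.fstExpansion.K ∧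
      s'.var Reg.k2 = i.sndExpansion.K ∧ s'.var Reg.s2 = 2 * i.s ∧
      s'.var Reg.es2 = i.fstExpansion.de ∧ s'.var Reg.dv = i.d ∧
      s'.var Reg.nd = i.sndExpansion.need := by
  intro i s'
  have hi : i = currentInfo s := rfl
  have m1 : ∀ a b : ℕ, (if a < b then a else b) = min a b := by intro a b; split_ifs <;> omega
  simp only [currentInfo] at hi
  by_cases hk : i.keep
  · have hk' := hk
    rw [hi] at hk'
    dsimp only at hk'
    simp only [VertexInfo.selExpansion, VertexInfo.fstExpansion, VertexInfo.sndExpansion, hk, if_true]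
    simp only [hi, s']
    simp only [Reg.one, Reg.zero, Arr.UV, Arr.CA, Arr.CB, Arr.deg, Reg.k] at h1 h0 hk'
    refine ⟨?_, ?_, ?_, ?_, ?_, ?_, ?_⟩
    · simp [vertexInit, vertexLoad, vertexKeep, vertexParams, block, Program.ev,
        Expansion.ofState, h0, hk']
    all_goals
      simp [vertexInit, vertexLoad, vertexKeep, vertexParams, block, Program.ev, h1, hk',
        m1, two_mul]
  · have hk' := hk
    rw [hi] at hk'
    dsimp only at hk'
    simp only [VertexInfo.selExpansion, VertexInfo.fstExpansion, VertexInfo.sndExpansion, hk, if_false]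
    simp only [hi, s']
    simp only [Reg.one, Reg.zero, Arr.UV, Arr.CA, Arr.CB, Arr.deg, Reg.k] at h1 h0 hk'
    refine ⟨?_, ?_, ?_, ?_, ?_, ?_, ?_⟩
    · simp [vertexInit, vertexLoad, vertexKeep, vertexParams, block, Program.ev,
        Expansion.ofState, h0, hk']
    all_goals
      simp [vertexInit, vertexLoad, vertexKeep, vertexParams, block, Program.ev, h1, hk',
        m1, two_mul]

theorem ev_vertexInit_arr {s : State} (h1 : s.var Reg.one = 1) :
    let i := currentInfo s
    let v := s.arr Arr.UV (s.var Reg.k)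
    let s' := vertexInit.ev s
    s'.arr Arr.CA = Function.update (s.arr Arr.CA) v 0 ∧
      s'.arr Arr.CB = Function.update (s.arr Arr.CB) v 0 ∧
      (i.keep → s'.var Reg.nl = s.var Reg.nl + 1 ∧
        s'.arr Arr.LV = Function.update (s.arr Arr.LV) (s.var Reg.lp + s.var Reg.nl) v ∧
        s'.arr Arr.LC = Function.update (s.arr Arr.LC) (s.var Reg.lp + s.var Reg.nl) (i.ca + i.cb)) ∧
      (¬ i.keep → s'.var Reg.nl = s.var Reg.nl ∧ s'.arr Arr.LV = s.arr Arr.LV ∧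
        s'.arr Arr.LC = s.arr Arr.LC) := by
  intro i v s'
  have hi : i = currentInfo s := rfl
  simp only [currentInfo] at hi
  have hk : i.keep ↔ s.arr 18 (s.arr 20 (s.var 24)) + s.arr 19 (s.arr 20 (s.var 24)) <
    s.arr 7 (s.arr 20 (s.var 24)) := Iff.rfl
  have h1' : s.var 4 = 1 := h1
  simp only [hi, s', v]
  refine ⟨?_, ?_, fun hk => ⟨?_, ?_, ?_⟩, fun hk => ⟨?_, ?_, ?_⟩⟩
  · simp [vertexInit, vertexLoad, vertexKeep, vertexParams, block, Program.ev]
  · simp [vertexInit, vertexLoad, vertexKeep, vertexParams, block, Program.ev]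
  all_goals simp [vertexInit, vertexLoad, vertexKeep, vertexParams, block, Program.ev, hk, h1']

/-- For l entries and p + 1, q + 1 possible counts the three lists have lengths l, at most 2l and at
most 2l(p + 1). The left side is at most 15 + l(141 + 82p + 32q + 32pq), and 80 times the size is
160(p + 1)(q + 1). -/
theorem VertexInfo.steps_le (i : VertexInfo) (l : List Entry) :
    (5 + l.length * (9 + i.selExpansion.K * 16)) +
      (5 + (i.selExpansion.apply l).length * (9 + i.fstExpansion.K * 16)) +
      (5 + (i.fstExpansion.apply (i.selExpansion.apply l)).length *
        (9 + i.sndExpansion.K * 16)) ≤ 15 + 80 * (l.length * i.size) := by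
  have h1 := i.selExpansion.length_apply l
  have h2 := i.fstExpansion.length_apply (i.selExpansion.apply l)
  rw [show i.selExpansion.K = 2 from rfl, show i.fstExpansion.K = min i.d i.ca + 1 from rfl,
    show i.sndExpansion.K = min i.d i.cb + 1 from rfl] at *
  unfold VertexInfo.size
  generalize min i.d i.ca = p at *
  generalize min i.d i.cb = q at *
  generalize (i.selExpansion.apply l).length = l1 at *
  generalize (i.fstExpansion.apply (i.selExpansion.apply l)).length = l2 at *
  generalize l.length = l0 at *
  have e1 : l1 * (9 + (p + 1) * 16) ≤ l0 * 2 * (9 + (p + 1) * 16) := Nat.mul_le_mul_right _ h1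
  have e2 : l2 * (9 + (q + 1) * 16) ≤ l0 * 2 * (p + 1) * (9 + (q + 1) * 16) :=
    Nat.mul_le_mul_right _ (h2.trans (Nat.mul_le_mul_right _ h1))
  have e3 : 0 ≤ l0 * p := Nat.zero_le _
  have e4 : 0 ≤ l0 * q := Nat.zero_le _
  have e5 : 0 ≤ l0 * (p * q) := Nat.zero_le _
  nlinarith

theorem run_vertexStep {s : State} (h1 : s.var Reg.one = 1) (h0 : s.var Reg.zero = 0)
    {i : VertexInfo} (hi : currentInfo s = i) {v : ℕ} (hv : s.arr Arr.UV (s.var Reg.k) = v)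
    {l : List Entry} (hae : s.var Reg.a ≤ s.var Reg.e)
    (hl : entries s (s.var Reg.a) (s.var Reg.e) = l) :
    Run vertexStep s (75 + 80 * (l.length * i.size)) fun s' =>
      s'.var Reg.k = s.var Reg.k + 1 ∧ s'.var Reg.a ≤ s'.var Reg.e ∧
      entries s' (s'.var Reg.a) (s'.var Reg.e) = i.expansion l ∧
      s'.arr Arr.CA = Function.update (s.arr Arr.CA) v 0 ∧
      s'.arr Arr.CB = Function.update (s.arr Arr.CB) v 0 ∧
      (i.keep → s'.var Reg.nl = s.var Reg.nl + 1 ∧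
        s'.arr Arr.LV = Function.update (s.arr Arr.LV) (s.var Reg.lp + s.var Reg.nl) v ∧
        s'.arr Arr.LC = Function.update (s.arr Arr.LC) (s.var Reg.lp + s.var Reg.nl) (i.ca + i.cb)) ∧
      (¬ i.keep → s'.var Reg.nl = s.var Reg.nl ∧ s'.arr Arr.LV = s.arr Arr.LV ∧
        s'.arr Arr.LC = s.arr Arr.LC) := by
  have hT := i.steps_le l
  obtain ⟨a1, a2, a3, a4, a5, a6, a7⟩ := ev_vertexInit h1 h0
  obtain ⟨b1, b2, b3, b4⟩ := ev_vertexInit_arr h1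
  rw [hi] at a1 a2 a3 a4 a5 a6 a7 b3 b4
  rw [hv] at b1 b2 b3
  have f1 : vertexInit.Frame s (vertexInit.ev s) := by
    obtain ⟨_, _, he, _, rfl⟩ := Run.of_loopFree (p := vertexInit) (s := s) rfl
    exact frame_of_exec he
  refine Run.seq (T₁ := 44) (T₂ := 31 + 80 * (l.length * i.size))
    (Run.straight (Q := fun s' => s' = vertexInit.ev s) rfl (by decide) rfl) ?_ (by omega)
  rintro s1 rfl -
  set s1 := vertexInit.ev s
  clear_value s1
  have hl1 : entries s1 (s1.var Reg.a) (s1.var Reg.e) = l := by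
    rw [f1.var _ rfl, f1.var _ rfl, ← hl]
    unfold entries entryAt
    rw [f1.arr _ rfl, f1.arr _ rfl, f1.arr _ rfl, f1.arr _ rfl, f1.arr _ rfl]
  refine Run.seq (T₂ := 16 + (5 + (i.selExpansion.apply l).length * (9 + i.fstExpansion.K * 16)) +
    (5 + (i.fstExpansion.apply (i.selExpansion.apply l)).length * (9 + i.sndExpansion.K * 16)))
    (run_expand a1 (by rw [f1.var _ rfl, h1]) (by rwa [f1.var _ rfl, f1.var _ rfl]) hl1) ?_
    (by omega)
  rintro s2 ⟨c1, c2⟩ f2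
  refine Run.seq (T₁ := 7) (T₂ := 9 + (5 + (i.selExpansion.apply l).length *
    (9 + i.fstExpansion.K * 16)) +
    (5 + (i.fstExpansion.apply (i.selExpansion.apply l)).length * (9 + i.sndExpansion.K * 16)))
    (Run.straight (Q := fun s' => s' = fstParams.ev s2) rfl (by decide) rfl) ?_ (by omega)
  rintro s3 hs3 f3
  have p3 : Expansion.ofState s3 = i.fstExpansion := by
    have : Expansion.ofState s3 = ⟨s2.var Reg.k1, s2.var Reg.s2, 0, s2.var Reg.es2, 0, 1,
        s2.var Reg.dv, s2.var Reg.need, s2.var Reg.rst⟩ := by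
      rw [hs3]; simp [fstParams, block, Program.ev, Expansion.ofState]
    rw [this, f2.var _ rfl, f2.var _ rfl, f2.var _ rfl, f2.var _ rfl, f2.var _ rfl, f2.var _ rfl,
      a2, a4, a5, a6, show s1.var Reg.need = (Expansion.ofState s1).need from rfl,
      show s1.var Reg.rst = (Expansion.ofState s1).rst from rfl, a1]
    rfl
  refine Run.seq (T₂ := 9 +
    (5 + (i.fstExpansion.apply (i.selExpansion.apply l)).length * (9 + i.sndExpansion.K * 16)))
    (run_expand (l := i.selExpansion.apply l) p3 ?_ ?_ ?_) ?_ (by omega)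
  · rw [f3.var _ rfl, f2.var _ rfl, f1.var _ rfl, h1]
  · rwa [f3.var _ rfl, f3.var _ rfl]
  · rw [f3.var _ rfl, f3.var _ rfl, ← c2]
    unfold entries entryAt
    rw [f3.arr _ rfl, f3.arr _ rfl, f3.arr _ rfl, f3.arr _ rfl, f3.arr _ rfl]
  rintro s4 ⟨d1, d2⟩ f4
  refine Run.seq (T₁ := 5) (T₂ := 3 +
    (5 + (i.fstExpansion.apply (i.selExpansion.apply l)).length * (9 + i.sndExpansion.K * 16)))
    (Run.straight (Q := fun s' => s' = sndParams.ev s4) rfl (by decide) rfl) ?_ (by omega)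
  rintro s5 hs5 f5
  have p5 : Expansion.ofState s5 = i.sndExpansion := by
    have : Expansion.ofState s5 = ⟨s4.var Reg.k2, 0, s4.var Reg.s2, s4.var Reg.de, s4.var Reg.dw,
        s4.var Reg.dc, s4.var Reg.lim, s4.var Reg.nd, s4.var Reg.dv⟩ := by
      rw [hs5]; simp [sndParams, block, Program.ev, Expansion.ofState]
    rw [this, f4.var _ rfl, f4.var _ rfl, f4.var _ rfl, f4.var _ rfl, f4.var _ rfl, f4.var _ rfl,
      f4.var _ rfl, f4.var _ rfl, f3.var Reg.k2 rfl, f3.var Reg.s2 rfl, f3.var Reg.nd rfl,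
      f3.var Reg.dv rfl,
      f2.var Reg.k2 rfl, f2.var Reg.s2 rfl, f2.var Reg.nd rfl, f2.var Reg.dv rfl, a3, a4, a6, a7,
      show s3.var Reg.de = (Expansion.ofState s3).de from rfl,
      show s3.var Reg.dw = (Expansion.ofState s3).dw from rfl,
      show s3.var Reg.dc = (Expansion.ofState s3).dc from rfl,
      show s3.var Reg.lim = (Expansion.ofState s3).lim from rfl, p3]
    rfl
  refine Run.seq (T₂ := 1)
    (run_expand (l := i.fstExpansion.apply (i.selExpansion.apply l)) p5 ?_ ?_ ?_) ?_ (by omega)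
  · rw [f5.var _ rfl, f4.var _ rfl, f3.var _ rfl, f2.var _ rfl, f1.var _ rfl, h1]
  · rwa [f5.var _ rfl, f5.var _ rfl]
  · rw [f5.var _ rfl, f5.var _ rfl, ← d2]
    unfold entries entryAt
    rw [f5.arr _ rfl, f5.arr _ rfl, f5.arr _ rfl, f5.arr _ rfl, f5.arr _ rfl]
  rintro s6 ⟨e1, e2⟩ f6
  have hvar : ∀ x, expand.writesVar x = false → fstParams.writesVar x = false →
      sndParams.writesVar x = false → s6.var x = s1.var x := fun x g1 g2 g3 => by
    rw [f6.var x g1, f5.var x g3, f4.var x g1, f3.var x g2, f2.var x g1]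
  have harr : ∀ x, expand.writesArr x = false → fstParams.writesArr x = false →
      sndParams.writesArr x = false → s6.arr x = s1.arr x := fun x g1 g2 g3 => by
    rw [f6.arr x g1, f5.arr x g3, f4.arr x g1, f3.arr x g2, f2.arr x g1]
  refine Run.straight (p := .add Reg.k Reg.k Reg.one) rfl le_rfl ?_
  have hev : ∀ x, x ≠ Reg.k → (Program.ev (.add Reg.k Reg.k Reg.one) s6).var x = s6.var x := by
    intro x hx
    simp only [Program.ev, State.setVar_var, hx, if_false]
  have hek : (Program.ev (.add Reg.k Reg.k Reg.one) s6).var Reg.k = s6.var Reg.k + s6.var Reg.one := by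
    simp only [Program.ev, State.setVar_var, if_true]
  have hea : (Program.ev (.add Reg.k Reg.k Reg.one) s6).arr = s6.arr := rfl
  have hent : ∀ a b, entries (Program.ev (.add Reg.k Reg.k Reg.one) s6) a b = entries s6 a b :=
    fun a b => rfl
  rw [hek, hev Reg.a (by decide), hev Reg.e (by decide), hev Reg.nl (by decide), hea, hent,
    hvar Reg.k rfl rfl rfl, hvar Reg.one rfl rfl rfl, hvar Reg.nl rfl rfl rfl,
    harr Arr.CA rfl rfl rfl, harr Arr.CB rfl rfl rfl, harr Arr.LV rfl rfl rfl,
    harr Arr.LC rfl rfl rfl, f1.var Reg.k rfl, f1.var Reg.one rfl, h1]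
  exact ⟨rfl, e1, e2, b1, b2, b3, b4⟩

end TVD

namespace TVD
open Program

/-! ## The memory -/

/-- The variables and arrays that describe the graph. -/
structure Env (I : Network) (s : State) : Prop where
  n : s.var 0 = I.n
  m : s.var 1 = I.m
  one : s.var Reg.one = 1
  zero : s.var Reg.zero = 0
  pn : s.var Reg.pn = 2 ^ I.n
  big : s.var Reg.big = I.stride I.n
  dem : s.arr Arr.dem = I.d
  fst : s.arr Arr.fst = I.a
  snd : s.arr Arr.snd = I.b
  deg : ∀ v < I.n, s.arr Arr.deg v = I.deg v
  S : ∀ v < I.n, s.arr Arr.S v = I.stride v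
  P : ∀ v < I.n, s.arr Arr.P v = 2 ^ v

/-- The program `p` does not change the variables and arrays that describe the graph. -/
def Program.keepsEnv (p : Program) : Bool :=
  !p.writesVar 0 && !p.writesVar 1 && !p.writesVar Reg.one && !p.writesVar Reg.zero &&
    !p.writesVar Reg.pn && !p.writesVar Reg.big && !p.writesArr Arr.dem && !p.writesArr Arr.fst &&
    !p.writesArr Arr.snd && !p.writesArr Arr.deg && !p.writesArr Arr.S && !p.writesArr Arr.P

theorem Env.of_frame {I : Network} {p : Program} {s s' : State} (h : Env I s) (hF : p.Frame s s')
    (hp : p.keepsEnv = true) : Env I s' := by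
  simp only [keepsEnv, Bool.and_eq_true, Bool.not_eq_true'] at hp
  obtain ⟨⟨⟨⟨⟨⟨⟨⟨⟨⟨⟨h1, h2⟩, h3⟩, h4⟩, h5⟩, h6⟩, h7⟩, h8⟩, h9⟩, h10⟩, h11⟩, h12⟩ := hp
  constructor
  · rw [hF.var _ h1, h.n]
  · rw [hF.var _ h2, h.m]
  · rw [hF.var _ h3, h.one]
  · rw [hF.var _ h4, h.zero]
  · rw [hF.var _ h5, h.pn]
  · rw [hF.var _ h6, h.big]
  · rw [hF.arr _ h7, h.dem]
  · rw [hF.arr _ h8, h.fst]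
  · rw [hF.arr _ h9, h.snd]
  · rw [hF.arr _ h10]; exact h.deg
  · rw [hF.arr _ h11]; exact h.S
  · rw [hF.arr _ h12]; exact h.P

/-- The scratch arrays and the unused part of the tables contain `0`. -/
structure Heap (s : State) : Prop where
  CA : ∀ v, s.arr Arr.CA v = 0
  CB : ∀ v, s.arr Arr.CB v = 0
  TB : ∀ i, s.var Reg.op ≤ i → s.arr Arr.TB i = 0

/-- The slot `z` contains the list `X` and the table of the edge set `A`. -/
structure Slot (I : Network) (s : State) (z : ℕ) (A X : Finset ℕ) : Prop where
  nodup : (segment (s.arr Arr.LV) (s.arr Arr.st z) (s.arr Arr.len z)).Nodup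
  list : (segment (s.arr Arr.LV) (s.arr Arr.st z) (s.arr Arr.len z)).toFinset = X
  counts : ∀ i < s.arr Arr.len z, s.arr Arr.LC (s.arr Arr.st z + i) =
    I.cnt A (s.arr Arr.LV (s.arr Arr.st z + i))
  list_le : s.arr Arr.st z + s.arr Arr.len z ≤ s.var Reg.lp
  table : ∀ k < I.stride I.n, s.arr Arr.TB (s.arr Arr.off z + k) = I.best A X k
  table_le : s.arr Arr.off z + I.stride I.n ≤ s.var Reg.op

/-- What a program may do to the memory without affecting the slot `z`. -/
theorem Slot.preserved {I : Network} {s s' : State} {z : ℕ} {A X : Finset ℕ} (h : Slot I s z A X)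
    (hst : s'.arr Arr.st z = s.arr Arr.st z) (hlen : s'.arr Arr.len z = s.arr Arr.len z)
    (hoff : s'.arr Arr.off z = s.arr Arr.off z)
    (hLV : ∀ i < s.var Reg.lp, s'.arr Arr.LV i = s.arr Arr.LV i)
    (hLC : ∀ i < s.var Reg.lp, s'.arr Arr.LC i = s.arr Arr.LC i)
    (hTB : ∀ i < s.var Reg.op, s'.arr Arr.TB i = s.arr Arr.TB i)
    (hlp : s.var Reg.lp ≤ s'.var Reg.lp) (hop : s.var Reg.op ≤ s'.var Reg.op) :
    Slot I s' z A X := by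
  have hle := h.list_le
  have hle' := h.table_le
  have hseg : segment (s'.arr Arr.LV) (s.arr Arr.st z) (s.arr Arr.len z) =
      segment (s.arr Arr.LV) (s.arr Arr.st z) (s.arr Arr.len z) :=
    segment_congr fun i hi => hLV _ (by omega)
  constructor
  · rw [hst, hlen, hseg]; exact h.nodup
  · rw [hst, hlen, hseg]; exact h.list
  · rw [hst, hlen]
    intro i hi
    rw [hLV _ (by omega), hLC _ (by omega)]
    exact h.counts i hi
  · rw [hst, hlen]; omega
  · rw [hoff]
    intro k hk
    rw [hTB _ (by omega)]
    exact h.table k hk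
  · rw [hoff]; omega

/-- The number of choices at least doubles with every vertex, so all stages together cost at most
twice the last one. -/
theorem sum_geometric_le {P : ℕ → ℕ} {k : ℕ} (h : ∀ i < k, 2 * P i ≤ P (i + 1)) :
    ∑ i ∈ Finset.range k, P (i + 1) ≤ 2 * P k := by
  induction k with
  | zero => simp
  | succ k ih =>
    rw [Finset.sum_range_succ]
    have := ih fun i hi => h i (by omega)
    have := h k (by omega)
    omega

/-- This charges a constant amount per vertex to the number of choices. -/
theorem le_of_geometric {P : ℕ → ℕ} {k : ℕ} (h0 : 1 ≤ P 0) (h : ∀ i < k, 2 * P i ≤ P (i + 1)) :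
    k + 1 ≤ P k := by
  induction k with
  | zero => exact h0
  | succ k ih =>
    have := ih fun i hi => h i (by omega)
    have := h k (by omega)
    omega

/-- The number of choices for a list of vertices. -/
def choices (info : ℕ → VertexInfo) (U : List ℕ) : ℕ := (U.map fun v => (info v).size).prod

theorem choices_take_succ (info : ℕ → VertexInfo) (U : List ℕ) {i : ℕ} (hi : i < U.length) :
    choices info (U.take (i + 1)) = choices info (U.take i) * (info U[i]).size := by
  rw [List.take_succ_eq_append_getElem hi, choices, List.map_append, List.prod_append,
    List.map_singleton, List.prod_singleton, choices]

/-- The factor 2 is the choice whether the vertex is selected; the other factors are positive. -/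
theorem two_mul_choices_le (info : ℕ → VertexInfo) (U : List ℕ) {i : ℕ} (hi : i < U.length) :
    2 * choices info (U.take i) ≤ choices info (U.take (i + 1)) := by
  rw [choices_take_succ info U hi, mul_comm]
  refine Nat.mul_le_mul_left _ ?_
  unfold VertexInfo.size
  exact Nat.le_mul_of_pos_right _ (by positivity)

theorem length_lt_choices (info : ℕ → VertexInfo) (U : List ℕ) :
    U.length + 1 ≤ choices info U := by
  have := le_of_geometric (P := fun i => choices info (U.take i)) (k := U.length)
    (by simp [choices]) (fun i hi => two_mul_choices_le info U hi)
  simpa using this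

/-! ## Expanding all choices -/

theorem run_vertices {I : Network} {A B : Finset ℕ} {s : State} (hE : Env I s) {U : List ℕ}
    (hU : segment (s.arr Arr.UV) 0 (s.var Reg.nu) = U) (hnd : U.Nodup) (hlt : ∀ v ∈ U, v < I.n)
    (hCA : ∀ v, s.arr Arr.CA v = if v ∈ U then I.cnt A v else 0)
    (hCB : ∀ v, s.arr Arr.CB v = if v ∈ U then I.cnt B v else 0)
    (hk : s.var Reg.k = 0) (hnl : s.var Reg.nl = 0) (hae : s.var Reg.a ≤ s.var Reg.e)
    (hl : entries s (s.var Reg.a) (s.var Reg.e) = [⟨0, 0, 0, 0, 0⟩]) :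
    Run (.loop Reg.k Reg.nu vertexStep) s (240 * choices (I.info A B) U) fun s' =>
      entries s' (s'.var Reg.a) (s'.var Reg.e) = choiceList (I.info A B) U ∧
      s'.var Reg.a ≤ s'.var Reg.e ∧
      (∀ v, s'.arr Arr.CA v = 0) ∧ (∀ v, s'.arr Arr.CB v = 0) ∧
      segment (s'.arr Arr.LV) (s.var Reg.lp) (s'.var Reg.nl) =
        U.filter (fun v => I.cnt A v + I.cnt B v < I.deg v) ∧
      (∀ i < s'.var Reg.nl, s'.arr Arr.LC (s.var Reg.lp + i) =
        I.cnt A (s'.arr Arr.LV (s.var Reg.lp + i)) + I.cnt B (s'.arr Arr.LV (s.var Reg.lp + i))) ∧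
      (∀ i < s.var Reg.lp, s'.arr Arr.LV i = s.arr Arr.LV i) ∧
      ∀ i < s.var Reg.lp, s'.arr Arr.LC i = s.arr Arr.LC i := by
  have hlen : U.length = s.var Reg.nu := by rw [← hU, length_segment]
  set P : ℕ → ℕ := fun i => choices (I.info A B) (U.take i) with hP
  have hgeo : ∀ i < U.length, 2 * P i ≤ P (i + 1) := fun i hi => two_mul_choices_le _ U hi
  refine (Run.forLoop (k := U.length) (T := 240 * choices (I.info A B) U) (fun i s' =>
    s'.var Reg.k = i ∧
      entries s' (s'.var Reg.a) (s'.var Reg.e) = choiceList (I.info A B) (U.take i) ∧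
      s'.var Reg.a ≤ s'.var Reg.e ∧
      (∀ v, s'.arr Arr.CA v = if v ∈ U ∧ v ∉ U.take i then I.cnt A v else 0) ∧
      (∀ v, s'.arr Arr.CB v = if v ∈ U ∧ v ∉ U.take i then I.cnt B v else 0) ∧
      segment (s'.arr Arr.LV) (s.var Reg.lp) (s'.var Reg.nl) =
        (U.take i).filter (fun v => I.cnt A v + I.cnt B v < I.deg v) ∧
      (∀ i < s'.var Reg.nl, s'.arr Arr.LC (s.var Reg.lp + i) =
        I.cnt A (s'.arr Arr.LV (s.var Reg.lp + i)) + I.cnt B (s'.arr Arr.LV (s.var Reg.lp + i))) ∧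
      (∀ i < s.var Reg.lp, s'.arr Arr.LV i = s.arr Arr.LV i) ∧
      ∀ i < s.var Reg.lp, s'.arr Arr.LC i = s.arr Arr.LC i)
    (fun i => 75 + 80 * P (i + 1)) ?_ ?_ ?_ ?_).mono le_rfl ?_
  · simp [hk, hnl, hae, hl, hCA, hCB, choiceList]
  · rintro i s' - ⟨hi, -⟩ hF
    rw [hi, hF.var _ rfl, hlen]
  · rintro i s' hi ⟨g1, g2, g3, g4, g5, g6, g7, g8, g9⟩ hF
    have hE' : Env I s' := hE.of_frame hF rfl
    have hv : s'.arr Arr.UV (s'.var Reg.k) = U[i] := by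
      have : U[i] = s.arr Arr.UV (0 + i) := by simp [← hU, segment]
      rw [g1, hF.arr _ rfl, this, zero_add]
    have hvn := hlt U[i] (List.getElem_mem hi)
    -- As the list has no repetitions, the scratch cells of this vertex have not been cleared yet.
    have hnot : U[i] ∉ U.take i := by
      intro h
      obtain ⟨j, hj, e⟩ := List.mem_take_iff_getElem.1 h
      have hj' : j < i := by omega
      have := (hnd.getElem_inj_iff (hi := by omega) (hj := hi)).1 e
      omega
    have hinfo : currentInfo s' = I.info A B U[i] := by
      simp only [currentInfo, hv, Network.info]
      rw [g4, g5, hE'.dem, hE'.S _ hvn, hE'.P _ hvn, hE'.pn, hE'.deg _ hvn,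
        if_pos ⟨List.getElem_mem hi, hnot⟩, if_pos ⟨List.getElem_mem hi, hnot⟩]
      rfl
    have htake : U.take (i + 1) = U.take i ++ [U[i]] := List.take_succ_eq_append_getElem hi
    have hmem : ∀ v, v ∈ U.take (i + 1) ↔ v ∈ U.take i ∨ v = U[i] := by
      intro v
      rw [htake, List.mem_append, List.mem_singleton]
    have hPi : (choiceList (I.info A B) (U.take i)).length * (I.info A B U[i]).size ≤ P (i + 1) := by
      simp only [hP, choices_take_succ _ U hi]
      exact Nat.mul_le_mul_right _ (length_choiceList (I.info A B) (U.take i))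
    refine (run_vertexStep hE'.one hE'.zero hinfo hv g3 g2).mono_frame
      (by omega) ?_
    rintro s2 ⟨k1, k2, k3, k4, k5, k6, k7⟩ hF2
    have hlp : s'.var Reg.lp = s.var Reg.lp := hF.var _ rfl
    refine ⟨by omega, ?_, k2, ?_, ?_, ?_⟩
    · rw [k3, htake, choiceList_concat]
    · intro v
      simp only [k4, Function.update_apply, hmem, g4]
      by_cases hv : v = U[i] <;> simp [hv]
    · intro v
      simp only [k5, Function.update_apply, hmem, g5]
      by_cases hv : v = U[i] <;> simp [hv]
    · rw [htake, List.filter_append]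
      by_cases hkeep : I.cnt A U[i] + I.cnt B U[i] < I.deg U[i]
      · obtain ⟨q1, q2, q3⟩ := k6 hkeep
        rw [hlp] at q2 q3
        refine ⟨?_, ?_, ?_, ?_⟩
        · rw [q1, segment_succ, ← g6]
          congr 1
          · refine segment_congr fun j hj => ?_
            rw [q2, Function.update_of_ne (by omega)]
          · rw [q2, Function.update_self]
            simp [hkeep]
        · intro j hj
          rw [q1] at hj
          rw [q2, q3]
          rcases Nat.lt_succ_iff_lt_or_eq.1 hj with hj | rfl
          · rw [Function.update_of_ne (by omega), Function.update_of_ne (by omega)]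
            exact g7 j hj
          · simp [Network.info]
        · intro j hj
          rw [q2, Function.update_of_ne (by omega), g8 j hj]
        · intro j hj
          rw [q3, Function.update_of_ne (by omega), g9 j hj]
      · obtain ⟨q1, q2, q3⟩ := k7 hkeep
        rw [q1, q2, q3]
        refine ⟨?_, g7, g8, g9⟩
        simp [hkeep, g6]
  -- With k vertices and P choices in the end, the total is at most 1 + 76k + 160P, and k + 1 ≤ P.
  · have h1 := sum_geometric_le hgeo
    have h2 := le_of_geometric (by simp [hP, choices]) hgeo
    have h3 : P U.length = choices (I.info A B) U := by simp [hP]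
    simp only [add_right_comm, Finset.sum_add_distrib, ← Finset.mul_sum, Finset.sum_const,
      Finset.card_range, smul_eq_mul]
    omega
  · rintro s' ⟨-, g2, g3, g4, g5, g6, g⟩
    rw [List.take_length] at g2 g4 g5 g6
    exact ⟨g2, g3, by simpa using g4, by simpa using g5, g6, g⟩

end TVD

namespace TVD
open Program

/-- This keeps the reads within the two old tables and the writes within the new one. -/
theorem Network.Joinable.choice_lt {I : Network} {A X B Y : Finset ℕ} (h : I.Joinable A X B Y)
    {U : List ℕ} (hU : U.Nodup) (hUX : U.toFinset = X ∪ Y) {y : Entry}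
    (hy : y ∈ choiceList (I.info A B) U) :
    y.f < I.stride I.n ∧ y.g < I.stride I.n ∧ y.e < I.stride I.n := by
  have hmem : ∀ v, v ∈ U ↔ v ∈ X ∪ Y := by intro v; rw [← hUX, List.mem_toFinset]
  obtain ⟨σ, p, q, hval, rfl⟩ := (mem_choiceList _ hU _).1 hy
  simp only [hUX, contribution_info]
  have hσ : ∀ v ∈ X ∪ Y, σ v ≤ 1 :=
    fun v hv => Nat.lt_succ_iff.1 (hval v ((hmem v).2 hv)).1
  have hp : ∀ v ∈ X ∪ Y, p v ≤ min (I.d v) (I.cnt A v) := fun v hv => (hval v ((hmem v).2 hv)).2.1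
  have hq : ∀ v ∈ X ∪ Y, q v ≤ min (I.d v) (I.cnt B v) :=
    fun v hv => (hval v ((hmem v).2 hv)).2.2.1
  have hXY := Finset.union_subset h.left.subset_range h.right.subset_range
  refine ⟨?_, ?_, ?_⟩
  · rw [h.sum_left fun v hv => (hp v hv).trans (min_le_right _ _)]
    exact sum_stride_subset_lt h.left.subset_range fun v hv =>
      digit_lt (hσ v (Finset.mem_union_left _ hv))
        ((hp v (Finset.mem_union_left _ hv)).trans (min_le_left _ _))
  · rw [h.sum_right fun v hv => (hq v hv).trans (min_le_right _ _)]
    exact sum_stride_subset_lt h.right.subset_range fun v hv =>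
      digit_lt (hσ v (Finset.mem_union_right _ hv))
        ((hq v (Finset.mem_union_right _ hv)).trans (min_le_left _ _))
  · rw [← Finset.sum_filter]
    have : ∀ v, σ v * I.stride v + min (I.d v) (p v + q v) * (2 * I.stride v) =
      I.stride v * (σ v + 2 * min (I.d v) (p v + q v)) := fun v => by ring
    simp only [this]
    exact sum_stride_subset_lt ((Finset.filter_subset _ _).trans hXY) fun v hv =>
      digit_lt (hσ v (Finset.mem_of_mem_filter _ hv)) (min_le_left _ _)

/-! ## The new table -/

/-- The value 0 plays the role of infinity: an entry counts only if both old cells are nonzero, and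
a new cell that is 0 is overwritten unconditionally. -/
def relaxStep : Program :=
  block [.load Reg.t1 Arr.EF Reg.h, .add Reg.t1 Reg.oa Reg.t1, .load Reg.t1 Arr.TB Reg.t1,
    .load Reg.t2 Arr.EG Reg.h, .add Reg.t2 Reg.ob Reg.t2, .load Reg.t2 Arr.TB Reg.t2,
    .ite Reg.zero Reg.t1
      (.ite Reg.zero Reg.t2
        (block [.add Reg.t3 Reg.t1 Reg.t2, .sub Reg.t3 Reg.t3 Reg.one, .load Reg.t4 Arr.EW Reg.h,
          .add Reg.t3 Reg.t3 Reg.t4, .load Reg.t4 Arr.EE Reg.h, .add Reg.t4 Reg.op Reg.t4,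
          .load Reg.ec Arr.TB Reg.t4,
          .ite Reg.zero Reg.ec (.ite Reg.t3 Reg.ec (.store Arr.TB Reg.t4 Reg.t3) .skip)
            (.store Arr.TB Reg.t4 Reg.t3)])
        .skip)
      .skip,
    .add Reg.h Reg.h Reg.one]

/-- The values that compete for the cell `k` of the new table. -/
def candidates (F G : ℕ → ℕ) (l : List Entry) (k : ℕ) : Set ℕ :=
  {c | ∃ y ∈ l, y.e = k ∧ 0 < F y.f ∧ 0 < G y.g ∧ c = F y.f + G y.g - 1 + y.w}

/-- Among sets of positive numbers only the empty one has infimum 0, so the test for an untouched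
cell computes exactly the infimum after insertion. -/
theorem sInf_insert_pos {C : Set ℕ} (hC : ∀ c ∈ C, 0 < c) (v : ℕ) :
    sInf (insert v C) = if 0 < sInf C then (if v < sInf C then v else sInf C) else v := by
  rcases C.eq_empty_or_nonempty with rfl | hne
  · simp
  · rw [if_pos (hC _ (Nat.sInf_mem hne)), csInf_insert (OrderBot.bddBelow C) hne]
    split_ifs <;> omega

theorem candidates_pos (F G : ℕ → ℕ) (l : List Entry) (k : ℕ) : ∀ c ∈ candidates F G l k, 0 < c := by
  rintro c ⟨y, -, -, h1, h2, rfl⟩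
  omega

theorem candidates_concat_of_ne (F G : ℕ → ℕ) (l : List Entry) (y : Entry) {k : ℕ}
    (h : ¬ (y.e = k ∧ 0 < F y.f ∧ 0 < G y.g)) :
    candidates F G (l ++ [y]) k = candidates F G l k := by
  ext c
  simp only [candidates, List.mem_append, List.mem_singleton, Set.mem_ofPred_eq]
  constructor
  · rintro ⟨z, hz | rfl, h1, h2, h3, h4⟩
    · exact ⟨z, hz, h1, h2, h3, h4⟩
    · exact absurd ⟨h1, h2, h3⟩ h
  · rintro ⟨z, hz, h1⟩
    exact ⟨z, .inl hz, h1⟩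

theorem candidates_concat (F G : ℕ → ℕ) (l : List Entry) (y : Entry) {k : ℕ}
    (h : y.e = k ∧ 0 < F y.f ∧ 0 < G y.g) :
    candidates F G (l ++ [y]) k = insert (F y.f + G y.g - 1 + y.w) (candidates F G l k) := by
  ext c
  simp only [candidates, List.mem_append, List.mem_singleton, Set.mem_ofPred_eq, Set.mem_insert_iff]
  constructor
  · rintro ⟨z, hz | rfl, h1, h2, h3, h4⟩
    · exact .inr ⟨z, hz, h1, h2, h3, h4⟩
    · exact .inl h4
  · rintro (rfl | ⟨z, hz, h1⟩)
    · exact ⟨y, .inr rfl, h.1, h.2.1, h.2.2, rfl⟩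
    · exact ⟨z, .inl hz, h1⟩

theorem ev_relaxStep {s : State} (h1 : s.var Reg.one = 1) (h0 : s.var Reg.zero = 0) {y : Entry}
    (hy : entryAt s (s.var Reg.h) = y) {f g : ℕ} (hf : s.arr Arr.TB (s.var Reg.oa + y.f) = f)
    (hg : s.arr Arr.TB (s.var Reg.ob + y.g) = g) :
    (relaxStep.ev s).var Reg.h = s.var Reg.h + 1 ∧
    ∀ i, (relaxStep.ev s).arr Arr.TB i =
      if i = s.var Reg.op + y.e ∧ 0 < f ∧ 0 < g then
        if 0 < s.arr Arr.TB i then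
          if f + g - 1 + y.w < s.arr Arr.TB i then f + g - 1 + y.w else s.arr Arr.TB i
        else f + g - 1 + y.w
      else s.arr Arr.TB i := by
  subst hy
  simp only [Reg.one, Reg.zero, Arr.TB, Reg.oa, Reg.ob, Reg.h, Reg.op, entryAt, Arr.EF, Arr.EG,
    Arr.EE, Arr.EW, Arr.EC] at *
  constructor
  · simp [relaxStep, block, Program.ev, h1]
  · intro i
    by_cases hf0 : 0 < f
    · by_cases hg0 : 0 < g
      · simp only [hf0, hg0, and_true]
        set w := f + g - 1 + s.arr 24 (s.var 39) with hw
        by_cases hc : 0 < s.arr 17 (s.var 9 + s.arr 23 (s.var 39))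
        · by_cases hlt : w < s.arr 17 (s.var 9 + s.arr 23 (s.var 39))
          · simp [relaxStep, block, Program.ev, h0, h1, hf, hg, hf0, hg0, hc, hlt, ← hw,
              Function.update_apply]
            by_cases hi : i = s.var 9 + s.arr 23 (s.var 39) <;> simp [hi, hc, hlt]
          · simp [relaxStep, block, Program.ev, h0, h1, hf, hg, hf0, hg0, hc, hlt, ← hw]
            rintro rfl
            simp [hc, hlt]
        · simp [relaxStep, block, Program.ev, h0, h1, hf, hg, hf0, hg0, hc, ← hw,
            Function.update_apply]
          by_cases hi : i = s.var 9 + s.arr 23 (s.var 39) <;> simp [hi, hc]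
      · simp [relaxStep, block, Program.ev, h0, hf, hg, hf0, hg0]
    · simp [relaxStep, block, Program.ev, h0, hf, hg, hf0]

theorem run_relax {s : State} (h1 : s.var Reg.one = 1) (h0 : s.var Reg.zero = 0) {l : List Entry}
    (hl : entries s (s.var Reg.a) (s.var Reg.e) = l) (hh : s.var Reg.h = s.var Reg.a)
    (hae : s.var Reg.a ≤ s.var Reg.e)
    {F G : ℕ → ℕ} {M : ℕ} (hF : ∀ k < M, s.arr Arr.TB (s.var Reg.oa + k) = F k)
    (hG : ∀ k < M, s.arr Arr.TB (s.var Reg.ob + k) = G k)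
    (hoa : s.var Reg.oa + M ≤ s.var Reg.op) (hob : s.var Reg.ob + M ≤ s.var Reg.op)
    (hM : ∀ y ∈ l, y.f < M ∧ y.g < M) (hTB : ∀ i, s.var Reg.op ≤ i → s.arr Arr.TB i = 0) :
    Run (.loop Reg.h Reg.e relaxStep) s (1 + l.length * 21) fun s' =>
      (∀ i < s.var Reg.op, s'.arr Arr.TB i = s.arr Arr.TB i) ∧
      ∀ k, s'.arr Arr.TB (s.var Reg.op + k) = sInf (candidates F G l k) := by
  have hlen : l.length = s.var Reg.e - s.var Reg.a := by rw [← hl, length_entries]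
  -- Both old tables lie below `op` and all writes go to addresses from `op` on, so the values read
  -- are the original ones throughout.
  refine (Run.forLoop_const (k := l.length) (c := 20) (fun i s' => s'.var Reg.h = s.var Reg.a + i ∧
      (∀ i < s.var Reg.op, s'.arr Arr.TB i = s.arr Arr.TB i) ∧
      ∀ k, s'.arr Arr.TB (s.var Reg.op + k) =
        sInf (candidates F G (entries s (s.var Reg.a) (s.var Reg.a + i)) k))
      ?_ ?_ ?_ le_rfl).mono le_rfl ?_
  · refine ⟨hh, fun _ _ => rfl, fun k => ?_⟩
    rw [hTB _ (by omega)]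
    simp [candidates]
  · rintro i s' - ⟨hi, -⟩ hF
    rw [hi, hF.var _ rfl]
    omega
  · rintro i s' hi ⟨g1, g2, g3⟩ hFr
    set y := entryAt s (s.var Reg.a + i) with hy
    have hyl : y ∈ l := by
      rw [← hl, entries, List.mem_map]
      exact ⟨_, List.mem_range'_1.2 ⟨by omega, by omega⟩, rfl⟩
    have hent : entryAt s' (s'.var Reg.h) = y := by
      rw [g1, hy]
      unfold entryAt
      rw [hFr.arr _ rfl, hFr.arr _ rfl, hFr.arr _ rfl, hFr.arr _ rfl, hFr.arr _ rfl]
    obtain ⟨hyf, hyg⟩ := hM y hyl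
    have hop : s'.var Reg.op = s.var Reg.op := hFr.var _ rfl
    obtain ⟨k1, k2⟩ := ev_relaxStep (s := s') (by rw [hFr.var _ rfl, h1])
      (by rw [hFr.var _ rfl, h0]) hent (f := F y.f) (g := G y.g)
      (by rw [hFr.var _ rfl, g2 _ (by omega), hF _ hyf])
      (by rw [hFr.var _ rfl, g2 _ (by omega), hG _ hyg])
    refine Run.straight rfl (by decide) ⟨by omega, ?_, ?_⟩
    · intro j hj
      rw [k2, if_neg (by omega), g2 j hj]
    · intro k
      rw [k2, g3, hop, ← add_assoc, entries_succ _ (by omega), ← hy]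
      by_cases hc : y.e = k ∧ 0 < F y.f ∧ 0 < G y.g
      · rw [if_pos ⟨by omega, hc.2⟩, candidates_concat _ _ _ _ hc,
          sInf_insert_pos (candidates_pos _ _ _ _)]
      · rw [if_neg (fun h => hc ⟨by omega, h.2⟩), candidates_concat_of_ne _ _ _ _ hc]
  · rintro s' ⟨-, g2, g3⟩
    rw [show s.var Reg.a + l.length = s.var Reg.e by omega, hl] at g3
    exact ⟨g2, g3⟩

end TVD

namespace TVD
open Program

/-! ## Uniting two edge sets -/

def mergeInit : Program :=
  block [.load Reg.sa Arr.st Reg.y, .load Reg.la Arr.len Reg.y, .load Reg.oa Arr.off Reg.y,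
    .load Reg.sb Arr.st Reg.x, .load Reg.lb Arr.len Reg.x, .load Reg.ob Arr.off Reg.x,
    .const Reg.nu 0, .const Reg.i 0]

def mergeMid : Program :=
  block [.const Reg.a 0, .store Arr.EF Reg.a Reg.a, .store Arr.EG Reg.a Reg.a,
    .store Arr.EE Reg.a Reg.a, .store Arr.EW Reg.a Reg.a, .store Arr.EC Reg.a Reg.a,
    .const Reg.e 1, .const Reg.nl 0, .const Reg.k 0]

/-- The new list and table stay where they were built, and the old ones are abandoned. Reserving a
whole table is a single addition, however long the table is, since its untouched cells are already
0. -/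
def mergeEnd : Program :=
  block [.store Arr.st Reg.y Reg.lp, .store Arr.len Reg.y Reg.nl, .store Arr.off Reg.y Reg.op,
    .add Reg.lp Reg.lp Reg.nl, .add Reg.op Reg.op Reg.big]

/-- Replace the slot `y` by the union of the slots `y` and `x`. -/
def merge : Program :=
  block [mergeInit, .loop Reg.i Reg.la loadFirstStep, .const Reg.i 0,
    .loop Reg.i Reg.lb loadSecondStep, mergeMid, .loop Reg.k Reg.nu vertexStep,
    .copy Reg.h Reg.a, .loop Reg.h Reg.e relaxStep, mergeEnd]

theorem Program.frame_ev {p : Program} (hp : p.loopFree = true) (s : State) :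
    p.Frame s (p.ev s) := by
  obtain ⟨_, _, he, _, rfl⟩ := Run.of_loopFree (s := s) hp
  exact frame_of_exec he

/-- The number of choices when two slots are united. -/
def Network.joinSize (I : Network) (A X B Y : Finset ℕ) : ℕ :=
  ∏ v ∈ X ∪ Y, (I.info A B v).size

theorem run_merge {I : Network} {s : State} {y x : ℕ} {A X B Y : Finset ℕ} (hE : Env I s)
    (hH : Heap s) (hy : s.var Reg.y = y) (hx : s.var Reg.x = x) (hA : Slot I s y A X)
    (hB : Slot I s x B Y) (h : I.Joinable A X B Y) :
    Run merge s (310 * I.joinSize A X B Y) fun s' => Env I s' ∧ Heap s' ∧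
      Slot I s' y (A ∪ B) (I.joined A X B Y) ∧
      ∀ z A' X', z ≠ y → Slot I s z A' X' → Slot I s' z A' X' := by
  set lX := segment (s.arr Arr.LV) (s.arr Arr.st y) (s.arr Arr.len y) with hlX
  set lY := segment (s.arr Arr.LV) (s.arr Arr.st x) (s.arr Arr.len x) with hlY
  set U := lX ++ lY.filter (· ∉ lX) with hUdef
  have memX : ∀ v, v ∈ lX ↔ v ∈ X := by intro v; rw [← hA.list, List.mem_toFinset]
  have memY : ∀ v, v ∈ lY ↔ v ∈ Y := by intro v; rw [← hB.list, List.mem_toFinset]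
  have hUnd : U.Nodup := by
    refine List.nodup_append.2 ⟨hA.nodup, hB.nodup.filter _, ?_⟩
    rintro a ha _ hb rfl
    simp only [List.mem_filter, decide_eq_true_eq] at hb
    exact hb.2 ha
  have memU : ∀ v, v ∈ U ↔ v ∈ X ∪ Y := by
    intro v
    simp only [hUdef, List.mem_append, List.mem_filter, decide_eq_true_eq, memX, memY,
      Finset.mem_union]
    tauto
  have hUX : U.toFinset = X ∪ Y := by ext v; rw [List.mem_toFinset, memU]
  have hsize : choices (I.info A B) U = I.joinSize A X B Y := by
    rw [choices, Network.joinSize, ← hUX, List.prod_toFinset _ hUnd]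
  have hUlt : ∀ v ∈ U, v < I.n := fun v hv => Finset.mem_range.1
    (Finset.union_subset h.left.subset_range h.right.subset_range ((memU v).1 hv))
  -- Both lists are shorter than the number P of choices, so loading them costs at most about 8P +
  -- 10P; with 240P for the enumeration and 21P for the new table, the total stays below 310P.
  have hU1 := length_lt_choices (I.info A B) U
  have hlXU : lX.length ≤ U.length := by simp [hUdef]
  have hlYU : lY.length ≤ U.length := by
    refine List.Subperm.length_le (hB.nodup.subperm fun v hv => ?_)
    rw [memU, Finset.mem_union, ← memY v]
    exact .inr hv
  have hL := length_choiceList (I.info A B) U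
  change _ ≤ choices (I.info A B) U at hL
  rw [← hsize]
  set P := choices (I.info A B) U with hP
  -- load the addresses
  have f1 := Program.frame_ev (p := mergeInit) rfl s
  refine Run.seq (T₁ := 8) (T₂ := 310 * P - 8)
    (Run.straight (Q := fun s' => s' = mergeInit.ev s) rfl (by decide) rfl) ?_ (by omega)
  rintro s1 hs1 -
  have a1 : s1.var Reg.sa = s.arr Arr.st y := by
    rw [hs1, ← hy]; simp [mergeInit, block, Program.ev]
  have a2 : s1.var Reg.la = s.arr Arr.len y := by
    rw [hs1, ← hy]; simp [mergeInit, block, Program.ev]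
  have a3 : s1.var Reg.oa = s.arr Arr.off y := by
    rw [hs1, ← hy]; simp [mergeInit, block, Program.ev]
  have a4 : s1.var Reg.sb = s.arr Arr.st x := by
    rw [hs1, ← hx]; simp [mergeInit, block, Program.ev]
  have a5 : s1.var Reg.lb = s.arr Arr.len x := by
    rw [hs1, ← hx]; simp [mergeInit, block, Program.ev]
  have a6 : s1.var Reg.ob = s.arr Arr.off x := by
    rw [hs1, ← hx]; simp [mergeInit, block, Program.ev]
  have a7 : s1.var Reg.nu = 0 := by rw [hs1]; simp [mergeInit, block, Program.ev]
  have a8 : s1.var Reg.i = 0 := by rw [hs1]; simp [mergeInit, block, Program.ev]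
  rw [← hs1] at f1
  clear hs1
  -- the first list
  refine Run.seq (T₂ := 300 * P)
    (run_loadFirst (c := I.cnt A) (l := lX) (by rw [a1, a2, f1.arr _ rfl])
    (by rw [a1, a2, f1.arr _ rfl, f1.arr _ rfl]; exact hA.counts) a8 a7
    (by rw [f1.arr _ rfl]; exact hH.CA) (by rw [f1.var _ rfl, hE.one])) ?_ (by omega)
  rintro s2 ⟨b1, b2⟩ f2
  have f3 := Program.frame_ev (p := .const Reg.i 0) rfl s2
  refine Run.seq (T₁ := 1) (T₂ := 299 * P)
    (Run.straight (Q := fun s' => s' = (Program.const Reg.i 0).ev s2) rfl le_rfl rfl) ?_ (by omega)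
  rintro s3 hs3 -
  have c8 : s3.var Reg.i = 0 := by rw [hs3]; simp [Program.ev]
  rw [← hs3] at f3
  clear hs3
  -- the second list
  refine Run.seq (T₂ := 288 * P)
    (run_loadSecond (c := I.cnt A) (c' := I.cnt B) (l := lX) (l' := lY)
    (by rw [f3.arr _ rfl, f3.var _ rfl, b1])
    (by rw [f3.arr _ rfl]; exact b2) ?_
    (by rw [f3.arr _ rfl, f3.var _ rfl, f3.var _ rfl, f2.arr _ rfl, f2.var _ rfl, f2.var _ rfl,
      a4, a5, f1.arr _ rfl])
    ?_ c8 (by rw [f3.arr _ rfl, f2.arr _ rfl, f1.arr _ rfl]; exact hH.CB)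
    (by rw [f3.var _ rfl, f2.var _ rfl, f1.var _ rfl, hE.one])
    (by rw [f3.var _ rfl, f2.var _ rfl, f1.var _ rfl, hE.zero])) ?_ (by omega)
  · intro v hv
    exact (Network.mem_verts_iff h.wf h.left.edges).1 (h.left.subset ((memX v).1 hv))
  · rw [f3.var _ rfl, f3.var _ rfl, f2.var _ rfl, f2.var _ rfl, f3.arr _ rfl, f3.arr _ rfl,
      f2.arr _ rfl, f2.arr _ rfl, f1.arr _ rfl, f1.arr _ rfl, a4, a5]
    exact hB.counts
  rintro s4 ⟨d1, d2⟩ f4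
  change segment _ _ _ = U at d1
  have f5 := Program.frame_ev (p := mergeMid) rfl s4
  refine Run.seq (T₁ := 9) (T₂ := 279 * P)
    (Run.straight (Q := fun s' => s' = mergeMid.ev s4) rfl (by decide) rfl) ?_ (by omega)
  rintro s5 hs5 -
  have e1 : s5.var Reg.a = 0 := by rw [hs5]; simp [mergeMid, block, Program.ev]
  have e2 : s5.var Reg.e = 1 := by rw [hs5]; simp [mergeMid, block, Program.ev]
  have e3 : s5.var Reg.nl = 0 := by rw [hs5]; simp [mergeMid, block, Program.ev]
  have e4 : s5.var Reg.k = 0 := by rw [hs5]; simp [mergeMid, block, Program.ev]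
  have e5 : entryAt s5 0 = ⟨0, 0, 0, 0, 0⟩ := by
    rw [hs5]; simp [mergeMid, block, Program.ev, entryAt]
  rw [← hs5] at f5
  clear hs5
  have hvar5 : ∀ z, mergeMid.writesVar z = false → loadSecondStep.writesVar z = false →
      (Program.const Reg.i 0).writesVar z = false → loadFirstStep.writesVar z = false →
      s5.var z = s1.var z := fun z h1 h2 h3 h4 => by
    rw [f5.var z h1, f4.var z h2, f3.var z h3, f2.var z h4]
  have harr5 : ∀ z, mergeMid.writesArr z = false → loadSecondStep.writesArr z = false →
      loadFirstStep.writesArr z = false →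
      s5.arr z = s.arr z := fun z h1 h2 h4 => by
    rw [f5.arr z h1, f4.arr z h2, f3.arr z rfl, f2.arr z h4, f1.arr z]
    rfl
  have hE5 : Env I s5 := ((((hE.of_frame f1 rfl).of_frame f2 rfl).of_frame f3 rfl).of_frame f4
    rfl).of_frame f5 rfl
  -- the vertices
  have hlp5 : s5.var Reg.lp = s.var Reg.lp := by rw [hvar5 _ rfl rfl rfl rfl, f1.var _ rfl]
  have hop5 : s5.var Reg.op = s.var Reg.op := by rw [hvar5 _ rfl rfl rfl rfl, f1.var _ rfl]
  refine Run.seq (T₂ := 39 * P) (run_vertices (A := A) (B := B) hE5 (U := U)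
    (by rw [f5.arr _ rfl, f5.var _ rfl, d1]) hUnd hUlt ?_ ?_ e4 e3 (by omega) ?_) ?_ (by omega)
  · intro v
    rw [f5.arr _ rfl, f4.arr _ rfl, f3.arr _ rfl, b2]
    by_cases hvX : v ∈ X
    · rw [if_pos ((memX v).2 hvX), if_pos ((memU v).2 (Finset.mem_union_left _ hvX))]
    · rw [if_neg (fun h => hvX ((memX v).1 h))]
      split_ifs with hvU
      · have hvY := (Finset.mem_union.1 ((memU v).1 hvU)).resolve_left hvX
        exact (h.cnt_left_eq_zero (Finset.mem_sdiff.2 ⟨hvY, hvX⟩)).symm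
      · rfl
  · intro v
    rw [f5.arr _ rfl, d2]
    by_cases hvY : v ∈ Y
    · rw [if_pos ((memY v).2 hvY), if_pos ((memU v).2 (Finset.mem_union_right _ hvY))]
    · rw [if_neg (fun h => hvY ((memY v).1 h))]
      split_ifs with hvU
      · have hvX := (Finset.mem_union.1 ((memU v).1 hvU)).resolve_right hvY
        exact (h.symm.cnt_left_eq_zero (Finset.mem_sdiff.2 ⟨hvX, hvY⟩)).symm
      · rfl
  · rw [e1, e2, entries_succ _ le_rfl, e5]
    simp
  rintro s6 ⟨g1, g2, g3, g4, g5, g6, g7, g8⟩ f6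
  have f7 := Program.frame_ev (p := .copy Reg.h Reg.a) rfl s6
  refine Run.seq (T₁ := 1) (T₂ := 38 * P)
    (Run.straight (Q := fun s' => s' = (Program.copy Reg.h Reg.a).ev s6) rfl le_rfl rfl) ?_
    (by omega)
  rintro s7 hs7 -
  have i1 : s7.var Reg.h = s7.var Reg.a := by rw [hs7]; simp [Program.ev]
  have i2 : entries s7 (s7.var Reg.a) (s7.var Reg.e) = choiceList (I.info A B) U := by
    rw [hs7, ← g1]; rfl
  rw [← hs7] at f7
  clear hs7
  have hE7 : Env I s7 := (hE5.of_frame f6 rfl).of_frame f7 rfl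
  have hop7 : s7.var Reg.op = s.var Reg.op := by rw [f7.var _ rfl, f6.var _ rfl, hop5]
  have hoa7 : s7.var Reg.oa = s.arr Arr.off y := by
    rw [f7.var _ rfl, f6.var _ rfl, hvar5 _ rfl rfl rfl rfl, a3]
  have hob7 : s7.var Reg.ob = s.arr Arr.off x := by
    rw [f7.var _ rfl, f6.var _ rfl, hvar5 _ rfl rfl rfl rfl, a6]
  have hTB7 : s7.arr Arr.TB = s.arr Arr.TB := by
    rw [f7.arr _ rfl, f6.arr _ rfl, harr5 _ rfl rfl rfl]
  refine Run.seq (T₂ := 5) (run_relax hE7.one hE7.zero i2 i1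
    (by rw [f7.var _ rfl, f7.var _ rfl]; exact g2) (F := I.best A X) (G := I.best B Y)
    (M := I.stride I.n) (by rw [hoa7, hTB7]; exact hA.table) (by rw [hob7, hTB7]; exact hB.table)
    (by rw [hoa7, hop7]; exact hA.table_le) (by rw [hob7, hop7]; exact hB.table_le)
    (fun e he => ⟨(h.choice_lt hUnd hUX he).1, (h.choice_lt hUnd hUX he).2.1⟩)
    (by rw [hop7, hTB7]; exact hH.TB)) ?_ (by omega)
  rintro s8 ⟨j1, j2⟩ f8
  rw [hop7] at j1 j2
  rw [hTB7] at j1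
  have hbest : ∀ k, sInf (candidates (I.best A X) (I.best B Y) (choiceList (I.info A B) U) k) =
      I.best (A ∪ B) (I.joined A X B Y) k := fun k => (h.best_joined hUnd hUX k).symm
  refine Run.straight (p := mergeEnd) rfl (by decide) ?_
  have hE8 : Env I s8 := hE7.of_frame f8 rfl
  have hvar8 : ∀ z, vertexStep.writesVar z = false → (Program.copy Reg.h Reg.a).writesVar z = false →
      relaxStep.writesVar z = false → s8.var z = s5.var z := fun z h1 h2 h3 => by
    rw [f8.var z h3, f7.var z h2, f6.var z h1]
  have hlp8 : s8.var Reg.lp = s.var Reg.lp := by rw [hvar8 _ rfl rfl rfl, hlp5]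
  have hop8 : s8.var Reg.op = s.var Reg.op := by rw [hvar8 _ rfl rfl rfl, hop5]
  have hy8 : s8.var Reg.y = y := by
    rw [hvar8 _ rfl rfl rfl, hvar5 _ rfl rfl rfl rfl, f1.var _ rfl, hy]
  have hnl8 : s8.var Reg.nl = s6.var Reg.nl := by rw [f8.var _ rfl, f7.var _ rfl]
  have hLV8 : s8.arr Arr.LV = s6.arr Arr.LV := by rw [f8.arr _ rfl, f7.arr _ rfl]
  have hLC8 : s8.arr Arr.LC = s6.arr Arr.LC := by rw [f8.arr _ rfl, f7.arr _ rfl]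
  have hLV5 : s5.arr Arr.LV = s.arr Arr.LV := harr5 _ rfl rfl rfl
  have hLC5 : s5.arr Arr.LC = s.arr Arr.LC := harr5 _ rfl rfl rfl
  have hst8 : ∀ z, z = Arr.st ∨ z = Arr.len ∨ z = Arr.off → s8.arr z = s.arr z := by
    rintro z (rfl | rfl | rfl) <;>
    rw [f8.arr _ rfl, f7.arr _ rfl, f6.arr _ rfl, harr5 _ rfl rfl rfl]
  have f9 := Program.frame_ev (p := mergeEnd) rfl s8
  have k1 : (mergeEnd.ev s8).arr Arr.st = Function.update (s.arr Arr.st) y (s.var Reg.lp) := by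
    rw [← hst8 Arr.st (by simp), ← hy8, ← hlp8]; simp [mergeEnd, block, Program.ev]
  have k2 : (mergeEnd.ev s8).arr Arr.len = Function.update (s.arr Arr.len) y (s6.var Reg.nl) := by
    rw [← hst8 Arr.len (by simp), ← hy8, ← hnl8]; simp [mergeEnd, block, Program.ev]
  have k3 : (mergeEnd.ev s8).arr Arr.off = Function.update (s.arr Arr.off) y (s.var Reg.op) := by
    rw [← hst8 Arr.off (by simp), ← hy8, ← hop8]; simp [mergeEnd, block, Program.ev]
  have k4 : (mergeEnd.ev s8).var Reg.lp = s.var Reg.lp + s6.var Reg.nl := by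
    rw [← hlp8, ← hnl8]; simp [mergeEnd, block, Program.ev]
  have k5 : (mergeEnd.ev s8).var Reg.op = s.var Reg.op + I.stride I.n := by
    rw [← hop8, ← hE8.big]; simp [mergeEnd, block, Program.ev]
  have k6 : (mergeEnd.ev s8).arr Arr.LV = s6.arr Arr.LV := by rw [f9.arr _ rfl, hLV8]
  have k7 : (mergeEnd.ev s8).arr Arr.LC = s6.arr Arr.LC := by rw [f9.arr _ rfl, hLC8]
  have k8 : (mergeEnd.ev s8).arr Arr.TB = s8.arr Arr.TB := f9.arr _ rfl
  have k9 : (mergeEnd.ev s8).arr Arr.CA = s6.arr Arr.CA := by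
    rw [f9.arr _ rfl, f8.arr _ rfl, f7.arr _ rfl]
  have k10 : (mergeEnd.ev s8).arr Arr.CB = s6.arr Arr.CB := by
    rw [f9.arr _ rfl, f8.arr _ rfl, f7.arr _ rfl]
  rw [hlp5] at g5 g6 g7 g8
  rw [hLV5] at g7
  rw [hLC5] at g8
  refine ⟨hE8.of_frame f9 rfl, ⟨by rw [k9]; exact g3, by rw [k10]; exact g4, ?_⟩, ?_, ?_⟩
  · rw [k5, k8]
    intro i hi
    obtain ⟨k, rfl⟩ := Nat.exists_eq_add_of_le (show s.var Reg.op ≤ i by omega)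
    rw [j2]
    -- All new codes are less than `stride n`, so nothing has been written behind the new table.
    have : candidates (I.best A X) (I.best B Y) (choiceList (I.info A B) U) k = ∅ := by
      refine Set.eq_empty_of_forall_notMem ?_
      rintro c ⟨e, he, rfl, -⟩
      have := (h.choice_lt hUnd hUX he).2.2
      omega
    rw [this, Nat.sInf_empty]
  · constructor
    · rw [k1, k2, k6, Function.update_self, Function.update_self, g5]
      exact hUnd.filter _
    · rw [k1, k2, k6, Function.update_self, Function.update_self, g5]
      ext v
      simp [Network.joined, memU]
    · rw [k1, k2, k6, k7, Function.update_self, Function.update_self]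
      intro i hi
      rw [g6 i hi, Network.cnt_union h.disj]
    · rw [k1, k2, k4, Function.update_self, Function.update_self]
    · rw [k3, k8, Function.update_self]
      intro k hk
      rw [j2, hbest]
    · rw [k3, k5, Function.update_self]
  · intro z A' X' hz hS
    refine hS.preserved ?_ ?_ ?_ ?_ ?_ ?_ ?_ ?_
    · rw [k1, Function.update_of_ne hz]
    · rw [k2, Function.update_of_ne hz]
    · rw [k3, Function.update_of_ne hz]
    · rw [k6]; exact g7
    · rw [k7]; exact g8
    · rw [k8]; exact j1
    · rw [k4]; omega
    · rw [k5]; omega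

end TVD

namespace TVD
open Finset

namespace Network
variable {I : Network} {A B X Y : Finset ℕ}

/-! ## The number of choices -/

/-- A vertex of `X \ Y` has no edge in `B` and therefore still misses an edge in the union; the same
holds for `Y \ X`. So every vertex of `X ∪ Y` is in at least two of the three boundaries, which is
the origin of the exponent 3b/2. -/
theorem Joinable.two_mul_card_union_le (h : I.Joinable A X B Y)
    (hX : ∀ v ∈ X, I.cnt A v < I.deg v) (hY : ∀ v ∈ Y, I.cnt B v < I.deg v) :
    2 * #(X ∪ Y) ≤ #X + #Y + #(I.joined A X B Y) := by
  have hsub : X \ Y ∪ Y \ X ⊆ I.joined A X B Y := by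
    refine union_subset (fun v hv => ?_) (fun v hv => ?_)
    · have h0 := h.symm.cnt_left_eq_zero hv
      have h1 := (mem_sdiff.1 hv).1
      have h2 := hX v h1
      exact mem_filter.2 ⟨mem_union_left _ h1, by omega⟩
    · have h0 := h.cnt_left_eq_zero hv
      have h1 := (mem_sdiff.1 hv).1
      have h2 := hY v h1
      exact mem_filter.2 ⟨mem_union_right _ h1, by omega⟩
  have h1 := card_le_card hsub
  rw [card_union_of_disjoint disjoint_sdiff_sdiff] at h1
  have h2 := card_sdiff_add_card_inter X Y
  have h3 := card_sdiff_add_card_inter Y X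
  rw [inter_comm] at h3
  have h4 := card_union_add_card_inter X Y
  omega

/-- A vertex outside `X` has count 0 in `A`, so a factor `D` for the first count occurs only on `X`,
and one for the second count only on `Y`. -/
theorem Joinable.joinSize_le (h : I.Joinable A X B Y) {D : ℕ} (hD : ∀ v < I.n, I.d v + 1 ≤ D) :
    I.joinSize A X B Y ≤ 2 ^ #(X ∪ Y) * D ^ (#X + #Y) := by
  have hle : ∀ v ∈ X ∪ Y, (I.info A B v).size ≤
      2 * ((if v ∈ X then D else 1) * (if v ∈ Y then D else 1)) := by
    intro v hv
    have hvn : v < I.n := mem_range.1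
      (union_subset h.left.subset_range h.right.subset_range hv)
    have := hD v hvn
    refine Nat.mul_le_mul_left _ (Nat.mul_le_mul ?_ ?_)
    · change min (I.d v) (I.cnt A v) + 1 ≤ _
      split_ifs with hX
      · omega
      · have h0 := h.cnt_left_eq_zero (mem_sdiff.2 ⟨(mem_union.1 hv).resolve_left hX, hX⟩)
        omega
    · change min (I.d v) (I.cnt B v) + 1 ≤ _
      split_ifs with hY
      · omega
      · have h0 := h.symm.cnt_left_eq_zero (mem_sdiff.2 ⟨(mem_union.1 hv).resolve_right hY, hY⟩)
        omega
  refine (prod_le_prod' hle).trans_eq ?_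
  rw [prod_mul_distrib, prod_mul_distrib, prod_const, prod_ite_mem, prod_ite_mem, prod_const,
    prod_const, union_inter_cancel_left, union_inter_cancel_right, pow_add]

/-- The bound for the number of choices in terms of the width and of the demands. -/
noncomputable def sizeBound (b D : ℕ) : ℕ := ⌊(2 : ℝ) ^ ((3 * (b : ℝ)) / 2) * (D : ℝ) ^ (2 * b)⌋₊

theorem one_le_sizeBound {b D : ℕ} (hD : 1 ≤ D) : 1 ≤ sizeBound b D := by
  refine Nat.le_floor ?_
  have h1 : (1 : ℝ) ≤ (2 : ℝ) ^ ((3 * (b : ℝ)) / 2) := Real.one_le_rpow (by norm_num) (by positivity)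
  have h2 : (1 : ℝ) ≤ (D : ℝ) ^ (2 * b) := one_le_pow₀ (by exact_mod_cast hD)
  push_cast
  nlinarith

theorem sizeBound_le (b D : ℕ) :
    (sizeBound b D : ℝ) ≤ (2 : ℝ) ^ ((3 * (b : ℝ)) / 2) * (D : ℝ) ^ (2 * b) :=
  Nat.floor_le (by positivity)

/-- Three boundaries of size at most b give |X ∪ Y| ≤ 3b/2 and |X| + |Y| ≤ 2b. The real exponent
allows for odd b, and the floor keeps step counts natural. -/
theorem Joinable.joinSize_le_sizeBound (h : I.Joinable A X B Y)
    (hX : ∀ v ∈ X, I.cnt A v < I.deg v) (hY : ∀ v ∈ Y, I.cnt B v < I.deg v) {b D : ℕ}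
    (hD : ∀ v < I.n, I.d v + 1 ≤ D) (hD1 : 1 ≤ D) (hXb : #X ≤ b) (hYb : #Y ≤ b)
    (hj : #(I.joined A X B Y) ≤ b) : I.joinSize A X B Y ≤ sizeBound b D := by
  refine Nat.le_floor ?_
  have h1 := h.two_mul_card_union_le hX hY
  have h2 : (#(X ∪ Y) : ℝ) ≤ (3 * (b : ℝ)) / 2 := by
    have : 2 * #(X ∪ Y) ≤ 3 * b := by omega
    have : (2 * #(X ∪ Y) : ℝ) ≤ 3 * b := by exact_mod_cast this
    linarith
  calc ((I.joinSize A X B Y : ℕ) : ℝ) ≤ ((2 ^ #(X ∪ Y) * D ^ (#X + #Y) : ℕ) : ℝ) := by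
        exact_mod_cast h.joinSize_le hD
    _ = (2 : ℝ) ^ (#(X ∪ Y) : ℝ) * (D : ℝ) ^ (#X + #Y) := by
        rw [Real.rpow_natCast]; push_cast; rfl
    _ ≤ _ := by
        refine mul_le_mul (Real.rpow_le_rpow_of_exponent_le (by norm_num) h2)
          (pow_le_pow_right₀ (by exact_mod_cast hD1) (by omega)) (by positivity) (by positivity)

/-! ## A single edge -/

theorem cnt_empty (v : ℕ) : I.cnt ∅ v = 0 := by simp [cnt]

theorem cnt_singleton (j v : ℕ) : I.cnt {j} v = if I.a j = v ∨ I.b j = v then 1 else 0 := by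
  rw [cnt, filter_singleton]
  split_ifs <;> rfl

theorem nbr_singleton (j v : ℕ) (S : Finset ℕ) : I.nbr {j} S v =
    if (I.a j = v ∧ I.b j ∈ S) ∨ (I.b j = v ∧ I.a j ∈ S) then 1 else 0 := by
  rw [nbr, filter_singleton]
  split_ifs <;> rfl

theorem verts_singleton (hI : I.WellFormed) {j : ℕ} (hj : j < I.m) :
    I.verts {j} = {I.a j, I.b j} := by
  ext v
  rw [mem_verts_iff hI (by simpa using hj), cnt_singleton]
  simp only [mem_insert, mem_singleton, eq_comm (a := v)]
  split_ifs with h <;> simp [h]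

theorem verts_empty : I.verts ∅ = ∅ := by simp [verts, cnt_empty]

theorem closed_empty : I.Closed ∅ ∅ := ⟨by simp, by simp, by simp [verts_empty]⟩

/-- Both ends are kept, even one of degree 1; such an end leaves the list when the edge is united
with the empty set. -/
theorem closed_singleton (hI : I.WellFormed) {j : ℕ} (hj : j < I.m) :
    I.Closed {j} {I.a j, I.b j} := by
  refine ⟨by simpa using hj, (verts_singleton hI hj).ge, ?_⟩
  rw [verts_singleton hI hj, sdiff_self]
  simp

theorem best_empty (k : ℕ) : I.best ∅ ∅ k = if k = 0 then 1 else 0 := by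
  have : {c | ∃ S, I.Sat ∅ ∅ S ∧ I.code ∅ ∅ S = k ∧ c = I.cost ∅ ∅ S + 1} =
      {c | k = 0 ∧ c = 1} := by
    ext c
    simp [Sat, code, cost, verts_empty, eq_comm (a := k)]
  rw [best, this]
  split_ifs with h
  · simp only [h, true_and]
    exact csInf_singleton 1
  · simp [h]

/-- The code of the selection of the first end of an edge only. -/
def fstCode (I : Network) (j : ℕ) : ℕ :=
  I.stride (I.a j) + if 0 < I.d (I.b j) then 2 * I.stride (I.b j) else 0

/-- The code of the selection of the second end of an edge only. -/
def sndCode (I : Network) (j : ℕ) : ℕ :=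
  I.stride (I.b j) + if 0 < I.d (I.a j) then 2 * I.stride (I.a j) else 0

/-- The codes of the four selections of ends of an edge. -/
def edgeCodes (I : Network) (j : ℕ) : Finset ℕ :=
  {0, I.fstCode j, I.sndCode j, I.fstCode j + I.sndCode j}

/-- Selecting an end sets its own selection digit and raises the count of the other end, unless that
end has demand 0. The two effects do not interact, so the code is additive. -/
theorem code_singleton {j : ℕ} (hne : I.a j ≠ I.b j) (S : Finset ℕ) :
    I.code {j} {I.a j, I.b j} S =
      (if I.a j ∈ S then I.fstCode j else 0) + if I.b j ∈ S then I.sndCode j else 0 := by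
  have m1 : ∀ d : ℕ, min d 1 = if 0 < d then 1 else 0 := by intro d; split_ifs <;> omega
  have m0 : ∀ d : ℕ, min d 0 = 0 := by intro d; omega
  rw [code, sum_pair hne, nbr_singleton, nbr_singleton, fstCode, sndCode]
  by_cases ha : I.a j ∈ S <;> by_cases hb : I.b j ∈ S <;>
    simp only [ha, hb, hne, hne.symm, m1, if_true, if_false, and_true, and_false,
      or_false, false_or, or_self, m0] <;> (try split_ifs) <;> ring

theorem exists_code_singleton_iff {j : ℕ} (hne : I.a j ≠ I.b j) (k : ℕ) :
    (∃ S, I.code {j} {I.a j, I.b j} S = k) ↔ k ∈ I.edgeCodes j := by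
  simp only [edgeCodes, mem_insert, mem_singleton]
  constructor
  · rintro ⟨S, rfl⟩
    rw [code_singleton hne]
    split_ifs <;> simp
  · rintro (rfl | rfl | rfl | rfl)
    · exact ⟨∅, by simp [code_singleton hne]⟩
    · exact ⟨{I.a j}, by simp [code_singleton hne, hne.symm]⟩
    · exact ⟨{I.b j}, by simp [code_singleton hne, hne]⟩
    · exact ⟨{I.a j, I.b j}, by simp [code_singleton hne]⟩

theorem edgeCodes_lt (hI : I.WellFormed) {j : ℕ} (hj : j < I.m) {k : ℕ} (hk : k ∈ I.edgeCodes j) :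
    k < I.stride I.n := by
  obtain ⟨S, rfl⟩ := (exists_code_singleton_iff (hI j hj).2.2 k).2 hk
  exact code_lt (closed_singleton hI hj) S

/-- There is no vertex outside the list, hence no demand to test and no weight to charge. -/
theorem best_singleton (hI : I.WellFormed) {j : ℕ} (hj : j < I.m) (k : ℕ) :
    I.best {j} {I.a j, I.b j} k = if k ∈ I.edgeCodes j then 1 else 0 := by
  have : {c | ∃ S, I.Sat {j} {I.a j, I.b j} S ∧ I.code {j} {I.a j, I.b j} S = k ∧
      c = I.cost {j} {I.a j, I.b j} S + 1} = {c | k ∈ I.edgeCodes j ∧ c = 1} := by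
    ext c
    simp [Sat, cost, verts_singleton hI hj, ← exists_code_singleton_iff (hI j hj).2.2]
  rw [best, this]
  split_ifs with h
  · simp only [h, true_and]
    exact csInf_singleton 1
  · simp [h]

/-- There are two ends, each with two selections and at most two counts. -/
theorem joinSize_singleton_le (j : ℕ) : I.joinSize ∅ ∅ {j} {I.a j, I.b j} ≤ 16 := by
  have h : ∀ v ∈ ({I.a j, I.b j} : Finset ℕ), (I.info ∅ {j} v).size ≤ 4 := by
    intro v _
    have h1 : I.cnt {j} v ≤ 1 := by rw [cnt_singleton]; split_ifs <;> omega
    change 2 * ((min (I.d v) (I.cnt ∅ v) + 1) * (min (I.d v) (I.cnt {j} v) + 1)) ≤ 4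
    rw [cnt_empty]
    have : min (I.d v) (I.cnt {j} v) ≤ 1 := (min_le_right _ _).trans h1
    simp
    omega
  rw [joinSize, empty_union]
  refine (prod_le_pow_card _ _ _ h).trans ?_
  calc 4 ^ #({I.a j, I.b j} : Finset ℕ) ≤ 4 ^ 2 := Nat.pow_le_pow_right (by norm_num) card_le_two
    _ = 16 := by norm_num

end Network
end TVD

namespace TVD
open Program

/-! ## The tables of the single edges -/

/-- Enter the edge with the number in `Reg.si` in the slot `N`. -/
def edgeLoad : Program :=
  block [.load Reg.t1 Arr.fst Reg.si, .load Reg.t2 Arr.snd Reg.si,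
    .load Reg.t3 Arr.S Reg.t1, .load Reg.t4 Arr.S Reg.t2,
    .load Reg.k1 Arr.dem Reg.t1, .load Reg.k2 Arr.dem Reg.t2,
    .ite Reg.zero Reg.k1 (.add Reg.es Reg.t3 Reg.t3) (.const Reg.es 0),
    .ite Reg.zero Reg.k2 (.add Reg.es2 Reg.t4 Reg.t4) (.const Reg.es2 0),
    .add Reg.t3 Reg.t3 Reg.es2, .add Reg.t4 Reg.t4 Reg.es]

def edgeList : Program :=
  block [.copy Reg.x 2, .store Arr.st Reg.x Reg.lp, .store Arr.off Reg.x Reg.op,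
    .const Reg.wt 2, .store Arr.len Reg.x Reg.wt,
    .store Arr.LV Reg.lp Reg.t1, .store Arr.LC Reg.lp Reg.one, .add Reg.lp Reg.lp Reg.one,
    .store Arr.LV Reg.lp Reg.t2, .store Arr.LC Reg.lp Reg.one, .add Reg.lp Reg.lp Reg.one]

def edgeTable : Program :=
  block [.store Arr.TB Reg.op Reg.one, .add Reg.wt Reg.op Reg.t3, .store Arr.TB Reg.wt Reg.one,
    .add Reg.wt Reg.wt Reg.t4, .store Arr.TB Reg.wt Reg.one, .add Reg.wt Reg.op Reg.t4,
    .store Arr.TB Reg.wt Reg.one, .add Reg.op Reg.op Reg.big, .load Reg.y Arr.leaf Reg.si]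

def edgeSlot : Program := block [edgeLoad, edgeList, edgeTable]

theorem ev_edgeLoad {I : Network} (hI : I.WellFormed) {s : State} (hE : Env I s) {j : ℕ}
    (hj : s.var Reg.si = j) (hjm : j < I.m) :
    (edgeLoad.ev s).var Reg.t1 = I.a j ∧ (edgeLoad.ev s).var Reg.t2 = I.b j ∧
      (edgeLoad.ev s).var Reg.t3 = I.fstCode j ∧ (edgeLoad.ev s).var Reg.t4 = I.sndCode j := by
  have h1 := hE.S (I.a j) (hI j hjm).1
  have h2 := hE.S (I.b j) (hI j hjm).2.1
  have h3 := hE.fst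
  have h4 := hE.snd
  have h5 := hE.dem
  have h6 := hE.zero
  simp only [Network.fstCode, Network.sndCode]
  simp only [Arr.S, Arr.fst, Arr.snd, Arr.dem, Reg.zero, Reg.si] at *
  refine ⟨?_, ?_, ?_, ?_⟩
  · simp [edgeLoad, block, Program.ev, h3, hj]
  · simp [edgeLoad, block, Program.ev, h4, hj]
  · simp [edgeLoad, block, Program.ev, h1, h2, h3, h4, h5, h6, hj, two_mul]
  · simp [edgeLoad, block, Program.ev, h1, h2, h3, h4, h5, h6, hj, two_mul]

theorem run_edgeSlot {I : Network} (hI : I.WellFormed) {s : State} (hE : Env I s) (hH : Heap s)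
    {j : ℕ} (hj : s.var Reg.si = j) (hjm : j < I.m) :
    Run edgeSlot s 32 fun s' => Env I s' ∧ Heap s' ∧ s'.var Reg.y = s.arr Arr.leaf j ∧
      s'.var Reg.x = s.var 2 ∧ Slot I s' (s.var 2) {j} {I.a j, I.b j} ∧
      ∀ z A X, z ≠ s.var 2 → Slot I s z A X → Slot I s' z A X := by
  obtain ⟨a1, a2, a3, a4⟩ := ev_edgeLoad hI hE hj hjm
  have f1 := frame_ev (p := edgeLoad) rfl s
  have f := frame_ev (p := edgeSlot) rfl s
  have hev : edgeSlot.ev s = edgeTable.ev (edgeList.ev (edgeLoad.ev s)) := rfl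
  have hone : (edgeLoad.ev s).var Reg.one = 1 := by rw [f1.var _ rfl, hE.one]
  have hbig : (edgeLoad.ev s).var Reg.big = I.stride I.n := by rw [f1.var _ rfl, hE.big]
  have hlp : (edgeLoad.ev s).var Reg.lp = s.var Reg.lp := by rw [f1.var _ rfl]
  have hop : (edgeLoad.ev s).var Reg.op = s.var Reg.op := by rw [f1.var _ rfl]
  have hN : (edgeLoad.ev s).var 2 = s.var 2 := by rw [f1.var _ rfl]
  have hsi : (edgeLoad.ev s).var Reg.si = j := by rw [f1.var _ rfl, hj]
  have harr : (edgeLoad.ev s).arr = s.arr := by ext A i; rw [f1.arr _ rfl]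
  refine Run.straight rfl (by decide) ?_
  have hE' : Env I (edgeSlot.ev s) := hE.of_frame f rfl
  rw [hev] at hE' ⊢
  generalize edgeLoad.ev s = s1 at *
  have k1 : (edgeTable.ev (edgeList.ev s1)).arr Arr.st =
      Function.update (s.arr Arr.st) (s.var 2) (s.var Reg.lp) := by
    rw [← harr, ← hN, ← hlp]; simp [edgeTable, edgeList, block, Program.ev]
  have k2 : (edgeTable.ev (edgeList.ev s1)).arr Arr.len =
      Function.update (s.arr Arr.len) (s.var 2) 2 := by
    rw [← harr, ← hN]; simp [edgeTable, edgeList, block, Program.ev]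
  have k3 : (edgeTable.ev (edgeList.ev s1)).arr Arr.off =
      Function.update (s.arr Arr.off) (s.var 2) (s.var Reg.op) := by
    rw [← harr, ← hN, ← hop]; simp [edgeTable, edgeList, block, Program.ev]
  have k4 : (edgeTable.ev (edgeList.ev s1)).var Reg.lp = s.var Reg.lp + 2 := by
    rw [← hlp]; simp only [Reg.one] at hone; simp [edgeTable, edgeList, block, Program.ev, hone]
  have k5 : (edgeTable.ev (edgeList.ev s1)).var Reg.op = s.var Reg.op + I.stride I.n := by
    rw [← hop, ← hbig]; simp [edgeTable, edgeList, block, Program.ev]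
  have k6 : (edgeTable.ev (edgeList.ev s1)).arr Arr.LV =
      Function.update (Function.update (s.arr Arr.LV) (s.var Reg.lp) (I.a j)) (s.var Reg.lp + 1)
        (I.b j) := by
    rw [← harr, ← hlp, ← a1, ← a2]
    simp only [Reg.one] at hone
    simp [edgeTable, edgeList, block, Program.ev, hone]
  have k7 : (edgeTable.ev (edgeList.ev s1)).arr Arr.LC =
      Function.update (Function.update (s.arr Arr.LC) (s.var Reg.lp) 1) (s.var Reg.lp + 1) 1 := by
    rw [← harr, ← hlp]
    simp only [Reg.one] at hone
    simp [edgeTable, edgeList, block, Program.ev, hone]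
  have k8 : ∀ i, (edgeTable.ev (edgeList.ev s1)).arr Arr.TB i =
      if s.var Reg.op ≤ i ∧ i - s.var Reg.op ∈ I.edgeCodes j then 1 else s.arr Arr.TB i := by
    have : (edgeTable.ev (edgeList.ev s1)).arr Arr.TB =
      Function.update (Function.update (Function.update (Function.update (s.arr Arr.TB)
        (s.var Reg.op) 1) (s.var Reg.op + I.fstCode j) 1)
        (s.var Reg.op + I.fstCode j + I.sndCode j) 1) (s.var Reg.op + I.sndCode j) 1 := by
      rw [← harr, ← hop, ← a3, ← a4]
      simp only [Reg.one] at hone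
      simp [edgeTable, edgeList, block, Program.ev, hone]
    intro i
    rw [this]
    simp only [Function.update_apply, Network.edgeCodes, Finset.mem_insert, Finset.mem_singleton]
    split_ifs <;> first | rfl | omega
  have k9 : (edgeTable.ev (edgeList.ev s1)).arr Arr.CA = s.arr Arr.CA := by
    rw [← hev]; exact f.arr _ rfl
  have k10 : (edgeTable.ev (edgeList.ev s1)).arr Arr.CB = s.arr Arr.CB := by
    rw [← hev]; exact f.arr _ rfl
  have k11 : (edgeTable.ev (edgeList.ev s1)).var Reg.y = s.arr Arr.leaf j := by
    rw [← harr, ← hsi]; simp [edgeTable, edgeList, block, Program.ev]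
  have k12 : (edgeTable.ev (edgeList.ev s1)).var Reg.x = s.var 2 := by
    rw [← hN]; simp [edgeTable, edgeList, block, Program.ev]
  clear hev f f1
  generalize edgeTable.ev (edgeList.ev s1) = s' at *
  have hne := (hI j hjm).2.2
  have hseg : segment (s'.arr Arr.LV) (s.var Reg.lp) 2 = [I.a j, I.b j] := by
    rw [k6, segment_succ, segment_succ, segment_zero]
    simp
  refine ⟨hE', ⟨by rw [k9]; exact hH.CA, by rw [k10]; exact hH.CB, ?_⟩, k11, k12, ?_, ?_⟩
  · rw [k5]
    intro i hi
    rw [k8, if_neg, hH.TB i (by omega)]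
    rintro ⟨-, hmem⟩
    have := Network.edgeCodes_lt hI hjm hmem
    omega
  · constructor
    · rw [k1, k2, Function.update_self, Function.update_self, hseg]
      simpa using hne
    · rw [k1, k2, Function.update_self, Function.update_self, hseg]
      simp
    · rw [k1, k2, Function.update_self, Function.update_self, k6, k7]
      intro i hi
      interval_cases i
      · simp [Network.cnt_singleton]
      · simp [Network.cnt_singleton]
    · rw [k1, k2, k4, Function.update_self, Function.update_self]
    · rw [k3, Function.update_self]
      intro k hk
      rw [k8, Network.best_singleton hI hjm, Nat.add_sub_cancel_left, hH.TB _ (by omega)]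
      simp
    · rw [k3, k5, Function.update_self]
  · intro z A X hz hS
    refine hS.preserved ?_ ?_ ?_ ?_ ?_ ?_ ?_ ?_
    · rw [k1, Function.update_of_ne hz]
    · rw [k2, Function.update_of_ne hz]
    · rw [k3, Function.update_of_ne hz]
    · rw [k6]
      intro i hi
      rw [Function.update_of_ne (by omega), Function.update_of_ne (by omega)]
    · rw [k7]
      intro i hi
      rw [Function.update_of_ne (by omega), Function.update_of_ne (by omega)]
    · intro i hi
      rw [k8, if_neg (by omega)]
    · omega
    · omega

end TVD

namespace TVD
open Finset

/-! ## Contracting a tree leaf by leaf -/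

section Contraction
open Classical
variable {W : Type*} {T : SimpleGraph W}

/-- The neighbours of `x` in `live`. -/
noncomputable def liveNbrs (T : SimpleGraph W) (live : Finset W) (x : W) : Finset W :=
  {z ∈ live | T.Adj x z}

/-- The nodes outside of `live` have been contracted into nodes in `live`, as told by `grp`. -/
structure Contraction (T : SimpleGraph W) (live : Finset W) (grp : W → W) : Prop where
  mem : ∀ x, grp x ∈ live
  fixed : ∀ x ∈ live, grp x = x
  adj : ∀ u v, T.Adj u v → grp u = grp v ∨ (u ∈ live ∧ v ∈ live)
  -- By the handshake identity this says that the live nodes span one edge less than their number,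
  -- as in a tree.
  sum : ∑ x ∈ live, #(liveNbrs T live x) + 2 = 2 * #live

theorem contraction_univ [Fintype W] (hT : T.IsTree) : Contraction T univ id := by
  refine ⟨by simp, by simp, by simp, ?_⟩
  have h1 := T.sum_degrees_eq_twice_card_edges
  have h2 := hT.card_edgeFinset
  have h3 : ∀ x, #(liveNbrs T univ x) = T.degree x := by
    intro x
    rw [← SimpleGraph.card_neighborFinset_eq_degree]
    congr 1
    ext z
    simp [liveNbrs]
  simp only [h3]
  rw [h1, card_univ]
  omega

namespace Contraction
variable {live : Finset W} {grp : W → W} (h : Contraction T live grp)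
include h

/-- The only live edge at `x` leads to `y`. Its removal lowers the degree sum by 2, once for `x` and
once for `y`, and leaves the degrees of all other live nodes unchanged. -/
theorem strip [DecidableEq W] {x y : W} (hx : x ∈ live) (hxy : liveNbrs T live x = {y}) :
    Contraction T (live.erase x) (fun u => if grp u = x then y else grp u) := by
  have hy : y ∈ live ∧ T.Adj x y := by
    have : y ∈ liveNbrs T live x := by simp [hxy]
    simpa [liveNbrs] using this
  have hne : y ≠ x := hy.2.ne'
  have huniq : ∀ z ∈ live, T.Adj x z → z = y := fun z hz ha => by
    have : z ∈ liveNbrs T live x := by simp [liveNbrs, hz, ha]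
    simpa [hxy] using this
  refine ⟨fun u => ?_, fun u hu => ?_, fun u v huv => ?_, ?_⟩
  · split_ifs with hu
    · exact mem_erase.2 ⟨hne, hy.1⟩
    · exact mem_erase.2 ⟨hu, h.mem u⟩
  · have := h.fixed u (mem_of_mem_erase hu)
    have := ne_of_mem_erase hu
    simp_all
  · rcases h.adj u v huv with he | ⟨hu, hv⟩
    · simp [he]
    · by_cases hux : u = x
      · subst hux
        have := huniq v hv huv
        subst this
        left
        simp [h.fixed _ hu, h.fixed _ hv]
      · by_cases hvx : v = x
        · subst hvx
          have := huniq u hu huv.symm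
          subst this
          left
          simp [h.fixed _ hu, h.fixed _ hv]
        · exact .inr ⟨mem_erase.2 ⟨hux, hu⟩, mem_erase.2 ⟨hvx, hv⟩⟩
  · have hsum := h.sum
    rw [← add_sum_erase _ _ hx, hxy, card_singleton,
      ← add_sum_erase (live.erase x) _ (mem_erase.2 ⟨hne, hy.1⟩)] at hsum
    rw [← add_sum_erase (live.erase x) _ (mem_erase.2 ⟨hne, hy.1⟩), card_erase_of_mem hx]
    have e1 : liveNbrs T (live.erase x) y = (liveNbrs T live y).erase x := by
      ext z; simp [liveNbrs, and_assoc]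
    have e2 : x ∈ liveNbrs T live y := by simp [liveNbrs, hx, hy.2.symm]
    have e3 : ∀ z ∈ (live.erase x).erase y, #(liveNbrs T (live.erase x) z) = #(liveNbrs T live z) := by
      intro z hz
      have hz' := mem_of_mem_erase (mem_of_mem_erase hz)
      congr 1
      ext w
      simp only [liveNbrs, mem_filter, mem_erase]
      refine ⟨fun hw => ⟨hw.1.2, hw.2⟩, fun hw => ⟨⟨?_, hw.1⟩, hw.2⟩⟩
      rintro rfl
      exact ne_of_mem_erase hz (huniq z hz' hw.2.symm)
    rw [sum_congr rfl e3, e1, card_erase_of_mem e2]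
    have := card_pos.2 ⟨x, hx⟩
    have := card_pos.2 ⟨x, e2⟩
    omega

/-- The average live degree is less than 2, so some live node has degree 0. The class contracted
into it is closed under adjacency, and by connectedness it is the whole tree. -/
theorem card_live_eq_one (hT : T.IsTree) (hne : ∀ x ∈ live, #(liveNbrs T live x) ≠ 1) :
    #live = 1 := by
  by_contra hc
  have hpos : 0 < #live := card_pos.2 ⟨_, h.mem hT.connected.nonempty.some⟩
  obtain ⟨z, hz, hlt⟩ : ∃ z ∈ live, #(liveNbrs T live z) < 2 := by
    by_contra hcon
    push Not at hcon
    have := card_nsmul_le_sum live _ 2 hcon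
    have := h.sum
    rw [smul_eq_mul] at *
    omega
  have h0 : #(liveNbrs T live z) = 0 := by have := hne z hz; omega
  rw [card_eq_zero] at h0
  have hclosed : ∀ u v, T.Adj u v → grp u = z → grp v = z := by
    intro u v huv hu
    rcases h.adj u v huv with he | ⟨hu', hv'⟩
    · rw [← he, hu]
    · have huz : u = z := by rw [← hu, h.fixed u hu']
      subst huz
      have : v ∈ liveNbrs T live u := by simp [liveNbrs, hv', huv]
      simp [h0] at this
  have hall : ∀ w, grp w = z := by
    intro w
    obtain ⟨p⟩ := hT.connected.preconnected z w
    have : ∀ {u v : W} (_ : T.Walk u v), grp u = z → grp v = z := by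
      intro u v p
      induction p with
      | nil => exact id
      | cons hadj _ ih => exact fun hu => ih (hclosed _ _ hadj hu)
    exact this p (h.fixed z hz)
  refine hc (card_eq_one.2 ⟨z, ?_⟩)
  ext w
  rw [mem_singleton]
  refine ⟨fun hw => ?_, fun hw => hw ▸ hz⟩
  rw [← h.fixed w hw, hall w]

/-- The part of the tree that has been contracted into `y` can be separated, up to nodes that are
not leaves, by at most one edge. -/
theorem exists_cut [Fintype W] (h3 : ∀ x, ¬ IsLeaf T x → (T.neighborSet x).ncard = 3)
    {y : W} (hy : y ∈ live) :
    ∃ D : Set W, (∀ x, IsLeaf T x → (x ∈ D ↔ grp x = y)) ∧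
      ∀ u v u' v', u ∈ D → v ∉ D → T.Adj u v → u' ∈ D → v' ∉ D → T.Adj u' v' →
        s(u, v) = s(u', v') := by
  -- With at most one live neighbour, the whole class of `y` can be left only along that edge.
  -- Otherwise `y` has degree three and at most one contracted neighbour; the class without `y`,
  -- which is not a leaf, can be left only from that neighbour to `y`.
  by_cases hle : #(liveNbrs T live y) ≤ 1
  · refine ⟨{u | grp u = y}, fun x _ => Iff.rfl, ?_⟩
    have key : ∀ u v, grp u = y → ¬ grp v = y → T.Adj u v → u = y ∧ v ∈ liveNbrs T live y := by
      intro u v hu hv huv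
      rcases h.adj u v huv with he | ⟨hu', hv'⟩
      · exact absurd (he ▸ hu) hv
      · have huy : u = y := by rw [← hu, h.fixed u hu']
        subst huy
        exact ⟨rfl, by simp [liveNbrs, hv', huv]⟩
    intro u v u' v' hu hv huv hu' hv' huv'
    obtain ⟨rfl, k1⟩ := key u v hu hv huv
    obtain ⟨rfl, k2⟩ := key u' v' hu' hv' huv'
    rw [card_le_one.1 hle _ k1 _ k2]
  · have hdeg : (T.neighborSet y).ncard = #(T.neighborFinset y) := by
      rw [Set.ncard_eq_toFinset_card', SimpleGraph.neighborFinset]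
    have hsub : liveNbrs T live y ⊆ T.neighborFinset y := by
      intro z hz
      simp only [liveNbrs, mem_filter] at hz
      simpa using hz.2
    have hnl : ¬ IsLeaf T y := by
      have := card_le_card hsub
      unfold IsLeaf
      omega
    have hdead : #(T.neighborFinset y \ liveNbrs T live y) ≤ 1 := by
      rw [card_sdiff_of_subset hsub, ← hdeg, h3 y hnl]
      omega
    refine ⟨{u | grp u = y ∧ u ≠ y}, fun x hx => ?_, ?_⟩
    · exact ⟨fun hxD => hxD.1, fun hxy => ⟨hxy, fun e => hnl (e ▸ hx)⟩⟩
    · have key : ∀ u v, (grp u = y ∧ u ≠ y) → ¬ (grp v = y ∧ v ≠ y) → T.Adj u v →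
          v = y ∧ u ∈ T.neighborFinset y \ liveNbrs T live y := by
        intro u v hu hv huv
        have hul : u ∉ live := fun hul => hu.2 (by rw [← hu.1, h.fixed u hul])
        rcases h.adj u v huv with he | ⟨hu', -⟩
        · have hvy : v = y := by
            by_contra hne
            exact hv ⟨he ▸ hu.1, hne⟩
          subst hvy
          refine ⟨rfl, mem_sdiff.2 ⟨by simpa using huv.symm, ?_⟩⟩
          simp [liveNbrs, hul]
        · exact absurd hu' hul
      intro u v u' v' hu hv huv hu' hv' huv'
      obtain ⟨rfl, k1⟩ := key u v hu hv huv
      obtain ⟨rfl, k2⟩ := key u' v' hu' hv' huv'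
      rw [card_le_one.1 hdead _ k1 _ k2]

end Contraction
end Contraction

theorem mem_of_reachable {W : Type*} {T : SimpleGraph W} {D : Set W}
    (hD : ∀ u v, T.Adj u v → u ∈ D → v ∈ D) {u v : W} (h : T.Reachable u v) (hu : u ∈ D) :
    v ∈ D := by
  obtain ⟨p⟩ := h
  induction p with
  | nil => exact hu
  | cons hadj _ ih => exact ih (hD _ _ hadj hu)

end TVD

namespace TVD
open Finset

/-! ## The network of a graph -/

theorem toArray_of_lt {k : ℕ} (f : Fin k → ℕ) {i : ℕ} (h : i < k) : toArray f i = f ⟨i, h⟩ := by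
  simp [toArray, h]

section
variable {n : ℕ} {G : SimpleGraph (Fin n)} (d : Fin n → ℕ) (L : EdgeListing G)

/-- The network of a graph with a given listing of its edges. -/
def network : Network where
  n := n
  m := L.num
  a := toArray fun i => (L.fst i : ℕ)
  b := toArray fun i => (L.snd i : ℕ)
  d := toArray d

theorem EdgeListing.adj (i : Fin L.num) : G.Adj (L.fst i) (L.snd i) := by
  rw [← SimpleGraph.mem_edgeSet, L.mk_eq]
  exact (L.edge i).2

theorem network_a (i : Fin L.num) : (network d L).a i = L.fst i :=
  toArray_of_lt (fun i => (L.fst i : ℕ)) i.2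

theorem network_b (i : Fin L.num) : (network d L).b i = L.snd i :=
  toArray_of_lt (fun i => (L.snd i : ℕ)) i.2

theorem network_d (v : Fin n) : (network d L).d v = d v := toArray_of_lt _ v.2

theorem network_wellFormed : (network d L).WellFormed := by
  intro j hj
  have h1 := network_a d L ⟨j, hj⟩
  have h2 := network_b d L ⟨j, hj⟩
  simp only at h1 h2
  rw [h1, h2]
  exact ⟨(L.fst _).2, (L.snd _).2, fun h => (L.adj ⟨j, hj⟩).ne (Fin.ext h)⟩

theorem mem_edge_iff (i : Fin L.num) (v : Fin n) :
    v ∈ (L.edge i : Sym2 (Fin n)) ↔ (network d L).a i = v ∨ (network d L).b i = v := by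
  rw [← L.mk_eq, Sym2.mem_iff, network_a, network_b, Fin.ext_iff, Fin.ext_iff, eq_comm,
    eq_comm (a := (v : ℕ))]

/-- The numbers of the vertices in a set. -/
noncomputable def vals (S : Set (Fin n)) : Finset ℕ :=
  S.toFinite.toFinset.map Fin.valEmbedding

theorem mem_vals {S : Set (Fin n)} {v : Fin n} : (v : ℕ) ∈ vals S ↔ v ∈ S := by
  simp [vals, ← Fin.ext_iff]

theorem card_vals (S : Set (Fin n)) : #(vals S) = S.ncard := by
  rw [vals, card_map, Set.ncard_eq_toFinset_card S]

/-- A neighbour `u` of `v` corresponds to the number of the edge between them in the listing. -/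
theorem nbr_network (S : Set (Fin n)) (v : Fin n) :
    (network d L).nbr (range L.num) (vals S) v = (G.neighborSet v ∩ S).ncard := by
  classical
  rw [Set.ncard_eq_toFinset_card', Network.nbr]
  symm
  refine card_bij (fun u hu => (L.edge.symm ⟨s(v, u), ?_⟩ : ℕ)) ?_ ?_ ?_
  · simp only [Set.mem_toFinset, Set.mem_inter_iff, SimpleGraph.mem_neighborSet] at hu
    exact hu.1
  · intro u hu
    simp only [Set.mem_toFinset, Set.mem_inter_iff, SimpleGraph.mem_neighborSet] at hu
    refine mem_filter.2 ⟨by simp, ?_⟩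
    rw [network_a, network_b]
    have h := L.mk_eq (L.edge.symm ⟨s(v, u), hu.1⟩)
    rw [Equiv.apply_symm_apply, Sym2.eq_iff] at h
    rcases h with ⟨h1, h2⟩ | ⟨h1, h2⟩
    · left
      rw [h1, h2, mem_vals]
      exact ⟨rfl, hu.2⟩
    · right
      rw [h1, h2, mem_vals]
      exact ⟨rfl, hu.2⟩
  · intro u hu u' hu' he
    exact Sym2.congr_right.1 (congrArg Subtype.val (L.edge.symm.injective (Fin.ext he)))
  · intro j hj
    obtain ⟨hjm, hj⟩ := mem_filter.1 hj
    have hjm := mem_range.1 hjm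
    have ha := network_a d L ⟨j, hjm⟩
    have hb := network_b d L ⟨j, hjm⟩
    have hadj := L.adj ⟨j, hjm⟩
    simp only at ha hb
    rw [ha, hb, mem_vals, mem_vals] at hj
    rcases hj with ⟨h1, h2⟩ | ⟨h1, h2⟩
    · have h1 := Fin.ext h1
      refine ⟨L.snd ⟨j, hjm⟩, ?_, ?_⟩
      · simp only [Set.mem_toFinset, Set.mem_inter_iff, SimpleGraph.mem_neighborSet]
        exact ⟨h1 ▸ hadj, h2⟩
      · have : L.edge.symm ⟨s(v, L.snd ⟨j, hjm⟩), h1 ▸ hadj⟩ = ⟨j, hjm⟩ := by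
          rw [Equiv.symm_apply_eq, Subtype.ext_iff, ← L.mk_eq]
          exact congrArg (fun w => s(w, _)) h1.symm
        rw [this]
    · have h1 := Fin.ext h1
      refine ⟨L.fst ⟨j, hjm⟩, ?_, ?_⟩
      · simp only [Set.mem_toFinset, Set.mem_inter_iff, SimpleGraph.mem_neighborSet]
        exact ⟨h1 ▸ hadj.symm, h2⟩
      · have : L.edge.symm ⟨s(v, L.fst ⟨j, hjm⟩), h1 ▸ hadj.symm⟩ = ⟨j, hjm⟩ := by
          rw [Equiv.symm_apply_eq, Subtype.ext_iff, ← L.mk_eq]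
          exact Sym2.eq_swap.trans (congrArg (fun w => s(_, w)) h1.symm)
        rw [this]

theorem deg_network (v : Fin n) : (network d L).deg v = (G.neighborSet v).ncard := by
  rw [← Set.inter_univ (G.neighborSet v), ← nbr_network d L, Network.deg, Network.cnt, Network.nbr]
  congr 1
  refine filter_congr fun j hj => ?_
  have hw := network_wellFormed d L j (mem_range.1 hj)
  have h1 : (network d L).a j ∈ vals (Set.univ : Set (Fin n)) :=
    (mem_vals (v := ⟨_, hw.1⟩)).2 (Set.mem_univ _)
  have h2 : (network d L).b j ∈ vals (Set.univ : Set (Fin n)) :=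
    (mem_vals (v := ⟨_, hw.2.1⟩)).2 (Set.mem_univ _)
  simp [h1, h2]

theorem isTotalVectorDominating_iff (S : Set (Fin n)) : IsTotalVectorDominating G d S ↔
    ∀ v : Fin n, (network d L).d v ≤ (network d L).nbr (range L.num) (vals S) v :=
  forall_congr' fun v => by rw [network_d, nbr_network]

theorem numEdges_eq : numEdges G = L.num := by
  rw [numEdges, ← Nat.card_coe_set_eq, ← Nat.card_congr L.edge, Nat.card_fin]

/-- Every vertex that is not isolated is an end of some edge. This charges the steps linear in the
number of vertices to the edges and the isolated vertices. -/
theorem card_le_two_mul_edges : n ≤ 2 * L.num + numIsolated G := by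
  classical
  set I := network (fun _ => 0) L
  have h1 : numIsolated G = #(univ.filter fun v : Fin n => I.deg v = 0) := by
    rw [numIsolated, Set.ncard_eq_toFinset_card']
    congr 1
    ext v
    simp only [Set.mem_toFinset, Set.mem_ofPred_eq, mem_filter, mem_univ, true_and, I, deg_network]
    rw [Set.ncard_eq_zero, Set.eq_empty_iff_forall_notMem]
    rfl
  have h2 : #(univ.filter fun v : Fin n => ¬ I.deg v = 0) ≤ 2 * L.num := by
    have hsub : (univ.filter fun v : Fin n => ¬ I.deg v = 0).map Fin.valEmbedding ⊆
        (range L.num).image I.a ∪ (range L.num).image I.b := by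
      intro v hv
      simp only [mem_map, mem_filter, mem_univ, true_and, Fin.valEmbedding_apply] at hv
      obtain ⟨v, hv, rfl⟩ := hv
      obtain ⟨j, hj⟩ := card_pos.1
        (show 0 < #{j ∈ range L.num | I.a j = v ∨ I.b j = v} from Nat.pos_of_ne_zero hv)
      obtain ⟨hj, h⟩ := mem_filter.1 hj
      rcases h with h | h
      · exact mem_union_left _ (mem_image.2 ⟨j, hj, h⟩)
      · exact mem_union_right _ (mem_image.2 ⟨j, hj, h⟩)
    have := card_le_card hsub
    rw [card_map] at this
    have h3 := card_union_le ((range L.num).image I.a) ((range L.num).image I.b)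
    have h4 := card_image_le (s := range L.num) (f := I.a)
    have h5 := card_image_le (s := range L.num) (f := I.b)
    rw [card_range] at h4 h5
    omega
  have h3 := card_filter_add_card_filter_not (s := (univ : Finset (Fin n))) (fun v => I.deg v = 0)
  rw [card_univ, Fintype.card_fin] at h3
  omega

end

/-- Once no demand exceeds its degree, this bounds the sum of the demands, and thus the number of
doublings for the place values. -/
theorem Network.sum_deg_le {I : Network} (hI : I.WellFormed) : ∑ v ∈ range I.n, I.deg v ≤ 2 * I.m := by
  have h : ∀ v, I.deg v ≤ #{j ∈ range I.m | I.a j = v} + #{j ∈ range I.m | I.b j = v} := by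
    intro v
    rw [Network.deg, Network.cnt, filter_or]
    exact card_union_le _ _
  refine (sum_le_sum fun v _ => h v).trans ?_
  rw [sum_add_distrib, ← card_eq_sum_card_fiberwise, ← card_eq_sum_card_fiberwise, card_range]
  · omega
  · intro j hj
    simpa using (hI j (by simpa using hj)).2.1
  · intro j hj
    simpa using (hI j (by simpa using hj)).1

/-! ## The edges in a part of the tree -/

section
open Classical
variable {n N : ℕ} {G : SimpleGraph (Fin n)} (d : Fin n → ℕ) (B : BranchDecomposition G (Fin N))
  (L : EdgeListing G)

/-- The leaf of an edge. -/
def leafAt (i : Fin L.num) : Fin N := B.leafOf (L.edge i)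

/-- The edges whose leaf has been contracted into `y`. -/
noncomputable def owned (grp : Fin N → Fin N) (y : Fin N) : Finset ℕ :=
  {j ∈ range L.num | ∃ h : j < L.num, grp (leafAt B L ⟨j, h⟩) = y}

theorem mem_owned {grp : Fin N → Fin N} {y : Fin N} (i : Fin L.num) :
    (i : ℕ) ∈ owned B L grp y ↔ grp (leafAt B L i) = y := by
  simp [owned]

theorem owned_subset (grp : Fin N → Fin N) (y : Fin N) : owned B L grp y ⊆ range L.num :=
  filter_subset _ _

theorem disjoint_owned (grp : Fin N → Fin N) {x y : Fin N} (h : x ≠ y) :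
    Disjoint (owned B L grp x) (owned B L grp y) := by
  rw [disjoint_left]
  intro j h1 h2
  obtain ⟨hj, h1⟩ := (mem_filter.1 h1).2
  obtain ⟨_, h2⟩ := (mem_filter.1 h2).2
  exact h (h1.symm.trans h2)

/-- A boundary vertex has one edge whose leaf is in the set from `exists_cut` and one whose leaf is
outside. Deleting the only tree edge that leaves this set disconnects the two leaves, so the vertex
is counted in the order of that tree edge. If no tree edge leaves the set, connectedness makes the
boundary empty. -/
theorem card_boundary_owned_le {live : Finset (Fin N)} {grp : Fin N → Fin N}
    (h : Contraction B.tree live grp) {y : Fin N} (hy : y ∈ live) :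
    #((network d L).boundary (owned B L grp y)) ≤ B.width := by
  set I := network d L with hI
  obtain ⟨D, hleaf, hcut⟩ := h.exists_cut B.degree_eq_three hy
  have hmem : ∀ i : Fin L.num, (i : ℕ) ∈ owned B L grp y ↔ leafAt B L i ∈ D := by
    intro i
    exact (mem_owned B L i).trans (hleaf _ (B.leafOf (L.edge i)).2).symm
  have hinc : ∀ v ∈ I.boundary (owned B L grp y), ∃ hv : v < n, ∃ i i' : Fin L.num,
      (⟨v, hv⟩ : Fin n) ∈ (L.edge i : Sym2 (Fin n)) ∧
      (⟨v, hv⟩ : Fin n) ∈ (L.edge i' : Sym2 (Fin n)) ∧ leafAt B L i ∈ D ∧ leafAt B L i' ∉ D := by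
    intro v hv
    simp only [Network.boundary, Network.verts, mem_filter, mem_range] at hv
    obtain ⟨⟨hvn, hpos⟩, hlt⟩ := hv
    obtain ⟨j, hj⟩ := card_pos.1 hpos
    obtain ⟨hjA, hj⟩ := mem_filter.1 hj
    have hsub := owned_subset B L grp y
    obtain ⟨j', hj', hj'A⟩ := exists_mem_notMem_of_card_lt_card
      (show #{j ∈ owned B L grp y | I.a j = v ∨ I.b j = v} <
        #{j ∈ range L.num | I.a j = v ∨ I.b j = v} from hlt)
    obtain ⟨hj'm, hj'⟩ := mem_filter.1 hj'
    have hj'A : j' ∉ owned B L grp y := fun hc => hj'A (mem_filter.2 ⟨hc, hj'⟩)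
    have hjm := mem_range.1 (hsub hjA)
    have hj'm : j' < L.num := mem_range.1 hj'm
    refine ⟨hvn, ⟨j, hjm⟩, ⟨j', hj'm⟩, ?_, ?_, ?_, ?_⟩
    · exact (mem_edge_iff d L ⟨j, hjm⟩ ⟨v, hvn⟩).2 hj
    · exact (mem_edge_iff d L ⟨j', hj'm⟩ ⟨v, hvn⟩).2 hj'
    · exact (hmem ⟨j, hjm⟩).1 hjA
    · exact fun hc => hj'A ((hmem ⟨j', hj'm⟩).2 hc)
  by_cases hex : ∃ u v, u ∈ D ∧ v ∉ D ∧ B.tree.Adj u v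
  · obtain ⟨u, w, hu, hw, huw⟩ := hex
    set f : B.tree.edgeSet := ⟨s(u, w), huw⟩ with hf
    have hsub : I.boundary (owned B L grp y) ⊆ vals (B.order f) := by
      intro v hv
      obtain ⟨hvn, i, i', h1, h2, h3, h4⟩ := hinc v hv
      refine (mem_vals (v := ⟨v, hvn⟩)).2 ⟨L.edge i, L.edge i', h1, h2, fun hr => h4 ?_⟩
      refine mem_of_reachable ?_ hr h3
      intro a b hab ha
      rw [SimpleGraph.deleteEdges_adj] at hab
      by_contra hb
      exact hab.2 (hcut _ _ _ _ ha hb hab.1 hu hw huw)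
    refine (card_le_card hsub).trans ?_
    rw [card_vals]
    exact le_ciSup (f := fun f => (B.order f).ncard) (Set.finite_range _).bddAbove f
  · push Not at hex
    have : I.boundary (owned B L grp y) = ∅ := by
      refine eq_empty_of_forall_notMem fun v hv => ?_
      obtain ⟨hvn, i, i', h1, h2, h3, h4⟩ := hinc v hv
      refine h4 (mem_of_reachable (fun a b hab ha => ?_)
        (B.isTree.connected.preconnected (leafAt B L i) _) h3)
      by_contra hb
      exact hex a b ha hb hab
    simp [this]

theorem owned_strip (grp : Fin N → Fin N) {x y z : Fin N} (hxy : x ≠ y) (hz : z ≠ x) :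
    owned B L (fun u => if grp u = x then y else grp u) z =
      if z = y then owned B L grp y ∪ owned B L grp x else owned B L grp z := by
  ext j
  by_cases hj : j < L.num
  · have e := fun g w => mem_owned B L (grp := g) (y := w) ⟨j, hj⟩
    simp only at e
    split_ifs with hzy
    · subst hzy
      rw [mem_union, e, e, e]
      by_cases h : grp (leafAt B L ⟨j, hj⟩) = x <;> simp [h, hxy]
    · rw [e, e]
      by_cases h : grp (leafAt B L ⟨j, hj⟩) = x <;> simp [h, hz.symm, Ne.symm hzy]
  · have e : ∀ g w, j ∉ owned B L g w := fun g w hc => hj (mem_range.1 (owned_subset B L g w hc))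
    split_ifs <;> simp [e]

include B in
-- The degree sum is 2N − 2 and is at least three times the number N − m of inner nodes. In
-- particular there is at least one edge.
theorem num_nodes_le : N + 2 ≤ 3 * L.num := by
  have h1 := (contraction_univ B.isTree).sum
  have hleaf : L.num = #(univ.filter fun x => IsLeaf B.tree x) := by
    have := Nat.card_congr (L.edge.trans B.leafOf)
    rw [Nat.card_fin, Nat.card_eq_fintype_card, Fintype.card_subtype] at this
    exact this
  have h2 : ∀ x : Fin N, #(liveNbrs B.tree univ x) = (B.tree.neighborSet x).ncard := by
    intro x
    rw [Set.ncard_eq_toFinset_card']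
    congr 1
    ext z
    simp [liveNbrs]
  have h3 : 3 * #(univ.filter fun x => ¬ IsLeaf B.tree x) ≤
      ∑ x ∈ univ, #(liveNbrs B.tree univ x) := by
    rw [mul_comm, ← smul_eq_mul]
    refine (card_nsmul_le_sum _ (fun x => #(liveNbrs B.tree univ x)) 3 fun x hx => ?_).trans
      (sum_le_sum_of_subset (filter_subset _ _))
    rw [h2, B.degree_eq_three x (mem_filter.1 hx).2]
  have h4 := card_filter_add_card_filter_not (s := (univ : Finset (Fin N))) (fun x => IsLeaf B.tree x)
  rw [card_univ, Fintype.card_fin] at h1 h4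
  omega

end
end TVD

namespace TVD
open Program

/-! ## Degrees and place values -/

/-- Count the edge with the number in `Reg.si` at both ends. -/
def degreeStep : Program :=
  block [.load Reg.t1 Arr.fst Reg.si, .load Reg.t2 Arr.deg Reg.t1, .add Reg.t2 Reg.t2 Reg.one,
    .store Arr.deg Reg.t1 Reg.t2, .load Reg.t1 Arr.snd Reg.si, .load Reg.t2 Arr.deg Reg.t1,
    .add Reg.t2 Reg.t2 Reg.one, .store Arr.deg Reg.t1 Reg.t2, .add Reg.si Reg.si Reg.one]

theorem Network.cnt_range_succ (I : Network) (j v : ℕ) : I.cnt (Finset.range (j + 1)) v =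
    I.cnt (Finset.range j) v + if I.a j = v ∨ I.b j = v then 1 else 0 := by
  rw [Finset.range_add_one, Finset.insert_eq, Finset.union_comm, cnt_union (by simp), cnt_singleton]

theorem run_degrees {I : Network} (hI : I.WellFormed) {s : State} (hm : s.var 1 = I.m)
    (hone : s.var Reg.one = 1) (hsi : s.var Reg.si = 0) (hfst : s.arr Arr.fst = I.a)
    (hsnd : s.arr Arr.snd = I.b) (hdeg : ∀ v, s.arr Arr.deg v = 0) :
    Run (.loop Reg.si 1 degreeStep) s (1 + I.m * 10) fun s' => ∀ v, s'.arr Arr.deg v = I.deg v := by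
  refine (Run.forLoop_const (k := I.m) (fun i s' => s'.var Reg.si = i ∧
    ∀ v, s'.arr Arr.deg v = I.cnt (Finset.range i) v) 9 ⟨hsi, ?_⟩ ?_ ?_ le_rfl).mono le_rfl
      fun s' h => h.2
  · intro v
    rw [hdeg, Finset.range_zero, Network.cnt_empty]
  · rintro i s' - ⟨h1, -⟩ hF
    rw [h1, hF.var 1 rfl, hm]
  · rintro i s' hi ⟨h1, h2⟩ hF
    have h3 : s'.var Reg.one = 1 := by rw [hF.var _ rfl, hone]
    have h4 : s'.arr Arr.fst = I.a := by rw [hF.arr _ rfl, hfst]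
    have h5 : s'.arr Arr.snd = I.b := by rw [hF.arr _ rfl, hsnd]
    have h6 := (hI i hi).2.2
    simp only [Reg.si, Reg.one, Arr.deg, Arr.fst, Arr.snd] at h1 h2 h3 h4 h5
    refine Run.straight rfl (by decide) ⟨?_, fun v => ?_⟩
    · simp [degreeStep, block, Program.ev, h1, h3]
    · rw [Network.cnt_range_succ]
      by_cases ha : I.a i = v
      · subst ha
        simp [degreeStep, block, Program.ev, h6, h1, h2, h3, h4, h5, Function.update_apply]
      · by_cases hb : I.b i = v
        · subst hb
          simp [degreeStep, block, Program.ev, h6.symm, h1, h2, h3, h4, h5]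
        · simp [degreeStep, block, Program.ev, ha, hb, Ne.symm ha, Ne.symm hb, h1, h2, h3, h4, h5,
            Function.update_apply]

/-- Check whether the demand of the vertex in `Reg.si` exceeds its degree. -/
def checkStep : Program :=
  block [.load Reg.t1 Arr.dem Reg.si, .load Reg.t2 Arr.deg Reg.si,
    .ite Reg.t2 Reg.t1 (.const Reg.bad 1) .skip, .add Reg.si Reg.si Reg.one]

/-- A demand above the degree rules out every solution. Rejecting this case early bounds the place
values by the degrees, and it settles the isolated vertices, which never occur in a table. -/
theorem run_check {I : Network} {s : State} (hn : s.var 0 = I.n) (hone : s.var Reg.one = 1)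
    (hsi : s.var Reg.si = 0) (hbad : s.var Reg.bad = 0) (hdem : s.arr Arr.dem = I.d)
    (hdeg : ∀ v, s.arr Arr.deg v = I.deg v) :
    Run (.loop Reg.si 0 checkStep) s (1 + I.n * 6) fun s' =>
      0 < s'.var Reg.bad ↔ ∃ v < I.n, I.deg v < I.d v := by
  refine (Run.forLoop_const (k := I.n) (fun i s' => s'.var Reg.si = i ∧
    (0 < s'.var Reg.bad ↔ ∃ v < i, I.deg v < I.d v)) 5 ⟨hsi, ?_⟩ ?_ ?_ le_rfl).mono le_rfl
      fun s' h => h.2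
  · simp [hbad]
  · rintro i s' - ⟨h1, -⟩ hF
    rw [h1, hF.var 0 rfl, hn]
  · rintro i s' hi ⟨h1, h2⟩ hF
    have h3 : s'.var Reg.one = 1 := by rw [hF.var _ rfl, hone]
    have h4 : s'.arr Arr.dem = I.d := by rw [hF.arr _ rfl, hdem]
    have h5 : ∀ v, s'.arr Arr.deg v = I.deg v := by rw [hF.arr _ rfl]; exact hdeg
    simp only [Reg.si, Reg.one, Reg.bad, Arr.deg, Arr.dem] at h1 h2 h3 h4 h5
    refine Run.straight rfl (by decide) ⟨?_, ?_⟩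
    · by_cases hc : I.deg i < I.d i <;> simp [checkStep, block, Program.ev, h1, h3, h4, h5, hc]
    · simp only [Nat.lt_succ_iff_lt_or_eq, or_and_right, exists_or, exists_eq_left, ← h2]
      by_cases hc : I.deg i < I.d i <;> simp [checkStep, block, Program.ev, h1, h4, h5, hc]

def doubleStep : Program := block [.add Reg.t1 Reg.t1 Reg.t1, .add Reg.t3 Reg.t3 Reg.one]

/-- Compute the place value and the power of two of the vertex in `Reg.si`. -/
def placeStep : Program :=
  block [.store Arr.S Reg.si Reg.t1, .store Arr.P Reg.si Reg.pn, .add Reg.pn Reg.pn Reg.pn,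
    .load Reg.t2 Arr.dem Reg.si, .const Reg.t3 0, .loop Reg.t3 Reg.t2 doubleStep,
    .add Reg.t1 Reg.t1 Reg.t1, .add Reg.t1 Reg.t1 Reg.t1, .add Reg.si Reg.si Reg.one]

theorem run_double {s : State} (hone : s.var Reg.one = 1) (h3 : s.var Reg.t3 = 0) :
    Run (.loop Reg.t3 Reg.t2 doubleStep) s (1 + s.var Reg.t2 * 3) fun s' =>
      s'.var Reg.t1 = s.var Reg.t1 * 2 ^ s.var Reg.t2 := by
  refine (Run.forLoop_const (k := s.var Reg.t2) (fun i s' => s'.var Reg.t3 = i ∧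
    s'.var Reg.t1 = s.var Reg.t1 * 2 ^ i) 2 ⟨h3, by simp⟩ ?_ ?_ le_rfl).mono le_rfl fun s' h => h.2
  · rintro i s' - ⟨h1, -⟩ hF
    rw [h1, hF.var Reg.t2 rfl]
  · rintro i s' hi ⟨h1, h2⟩ hF
    have h4 : s'.var Reg.one = 1 := by rw [hF.var _ rfl, hone]
    simp only [Reg.t3, Reg.t1, Reg.one] at h1 h2 h4
    refine Run.straight rfl (by decide) ⟨?_, ?_⟩
    · simp [doubleStep, block, Program.ev, h1, h4]
    · simp [doubleStep, block, Program.ev, h2, pow_succ]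
      ring

theorem run_places {I : Network} {s : State} (hn : s.var 0 = I.n) (hone : s.var Reg.one = 1)
    (hsi : s.var Reg.si = 0) (ht : s.var Reg.t1 = 1) (hpn : s.var Reg.pn = 1)
    (hdem : s.arr Arr.dem = I.d) :
    Run (.loop Reg.si 0 placeStep) s (1 + ∑ v ∈ Finset.range I.n, (10 + I.d v * 3)) fun s' =>
      s'.var Reg.t1 = I.stride I.n ∧ s'.var Reg.pn = 2 ^ I.n ∧
      (∀ v < I.n, s'.arr Arr.S v = I.stride v) ∧ ∀ v < I.n, s'.arr Arr.P v = 2 ^ v := by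
  refine (Run.forLoop (k := I.n) (fun i s' => s'.var Reg.si = i ∧ s'.var Reg.t1 = I.stride i ∧
    s'.var Reg.pn = 2 ^ i ∧ (∀ v < i, s'.arr Arr.S v = I.stride v) ∧
    ∀ v < i, s'.arr Arr.P v = 2 ^ v) (fun v => 9 + I.d v * 3) ⟨hsi, by simp [ht, Network.stride],
    by simp [hpn], by simp, by simp⟩ ?_ ?_ (by simp only [add_right_comm]; exact le_rfl)).mono le_rfl
      fun s' h => h.2
  · rintro i s' - ⟨h1, -⟩ hF
    rw [h1, hF.var 0 rfl, hn]
  · rintro i s' hi ⟨h1, h2, h3, h4, h5⟩ hF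
    have h6 : s'.var Reg.one = 1 := by rw [hF.var _ rfl, hone]
    have h7 : s'.arr Arr.dem = I.d := by rw [hF.arr _ rfl, hdem]
    simp only [Reg.si, Reg.one, Reg.t1, Reg.pn, Arr.S, Arr.P, Arr.dem] at h1 h2 h3 h4 h5 h6 h7
    refine Run.seq (T₁ := 1) (T₂ := 8 + I.d i * 3) (Run.straight
      (Q := fun s1 => s1 = _) rfl le_rfl rfl) ?_ (by omega)
    rintro s1 hs1 -
    refine Run.seq (T₁ := 1) (T₂ := 7 + I.d i * 3) (Run.straight
      (Q := fun s1 => s1 = _) rfl le_rfl rfl) ?_ (by omega)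
    rintro s2 hs2 -
    refine Run.seq (T₁ := 1) (T₂ := 6 + I.d i * 3) (Run.straight
      (Q := fun s1 => s1 = _) rfl le_rfl rfl) ?_ (by omega)
    rintro s3 hs3 -
    refine Run.seq (T₁ := 1) (T₂ := 5 + I.d i * 3) (Run.straight
      (Q := fun s1 => s1 = _) rfl le_rfl rfl) ?_ (by omega)
    rintro s4 hs4 -
    refine Run.seq (T₁ := 1) (T₂ := 4 + I.d i * 3) (Run.straight
      (Q := fun s1 => s1 = _) rfl le_rfl rfl) ?_ (by omega)
    rintro s5 hs5 -
    rw [hs4, hs3, hs2, hs1] at hs5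
    clear hs1 hs2 hs3 hs4 s1 s2 s3 s4
    have g2 : s5.var Reg.t2 = I.d i := by simp [hs5, Program.ev, h1, h7]
    have g3 : s5.var Reg.t1 = I.stride i := by simp [hs5, Program.ev, h2]
    have g4 : s5.var Reg.pn = 2 ^ (i + 1) := by simp [hs5, Program.ev, h3, pow_succ, mul_two]
    have g5 : s5.arr Arr.S = Function.update (s'.arr Arr.S) i (I.stride i) := by
      simp [hs5, Program.ev, h1, h2]
    have g6 : s5.arr Arr.P = Function.update (s'.arr Arr.P) i (2 ^ i) := by
      simp [hs5, Program.ev, h1, h3]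
    have g7 : s5.var Reg.si = i := by simp [hs5, Program.ev, h1]
    have g8 : s5.var Reg.one = 1 := by simp [hs5, Program.ev, h6]
    refine Run.seq (T₂ := 3) (run_double g8 (by simp [hs5, Program.ev])) ?_ (by rw [g2]; omega)
    rintro s6 h8 f6
    rw [g2, g3] at h8
    clear hs5
    -- Two more doublings complete the radix, whose exponent is the demand plus 2.
    refine Run.straight (p := block [.add Reg.t1 Reg.t1 Reg.t1, .add Reg.t1 Reg.t1 Reg.t1,
      .add Reg.si Reg.si Reg.one]) rfl (by decide) ?_
    have g7 : s6.var Reg.si = i := by rw [f6.var _ rfl, g7]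
    have g8 : s6.var Reg.one = 1 := by rw [f6.var _ rfl, g8]
    have g4 : s6.var Reg.pn = 2 ^ (i + 1) := by rw [f6.var _ rfl, g4]
    have g5 := (f6.arr _ rfl).trans g5
    have g6 := (f6.arr _ rfl).trans g6
    simp only [Reg.si, Reg.one, Reg.t1, Reg.pn, Arr.S, Arr.P] at g7 g8 g4 g5 g6 h8
    refine ⟨?_, ?_, ?_, ?_, ?_⟩
    · simp [block, Program.ev, g7, g8]
    · simp [block, Program.ev, h8, Network.stride, pow_add]
      ring
    · simp [block, Program.ev, g4]
    · intro v hv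
      simp only [block, Program.ev, State.setVar_arr, g5, Function.update_apply]
      split_ifs with hvi
      · rw [hvi]
      · exact h4 v (by omega)
    · intro v hv
      simp only [block, Program.ev, State.setVar_arr, g6, Function.update_apply]
      split_ifs with hvi
      · rw [hvi]
      · exact h5 v (by omega)

/-- Record the tree edge with the number in `Reg.si` at both ends. -/
def treeStep : Program :=
  block [.load Reg.t1 Arr.tfst Reg.si, .load Reg.t2 Arr.tsnd Reg.si,
    .load Reg.t3 Arr.r Reg.t1, .add Reg.t3 Reg.t3 Reg.one, .store Arr.r Reg.t1 Reg.t3,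
    .load Reg.t3 Arr.r Reg.t2, .add Reg.t3 Reg.t3 Reg.one, .store Arr.r Reg.t2 Reg.t3,
    .load Reg.t3 Arr.sm Reg.t1, .add Reg.t3 Reg.t3 Reg.t2, .store Arr.sm Reg.t1 Reg.t3,
    .load Reg.t3 Arr.sm Reg.t2, .add Reg.t3 Reg.t3 Reg.t1, .store Arr.sm Reg.t2 Reg.t3,
    .add Reg.si Reg.si Reg.one]

/-- The sum of the other ends of the edges in `A` at `v`. -/
def Network.nbrSum (I : Network) (A : Finset ℕ) (v : ℕ) : ℕ :=
  ∑ j ∈ A, ((if I.a j = v then I.b j else 0) + if I.b j = v then I.a j else 0)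

/-- The sum of the neighbours replaces adjacency lists: it can be updated by subtraction, and it is
the only neighbour as soon as a single one is left. -/
theorem run_tree {J : Network} (hJ : J.WellFormed) {s : State} (hm : s.var 3 = J.m)
    (hone : s.var Reg.one = 1) (hsi : s.var Reg.si = 0) (hfst : s.arr Arr.tfst = J.a)
    (hsnd : s.arr Arr.tsnd = J.b) (hr : ∀ v, s.arr Arr.r v = 0) (hsm : ∀ v, s.arr Arr.sm v = 0) :
    Run (.loop Reg.si 3 treeStep) s (1 + J.m * 16) fun s' => ∀ v, s'.arr Arr.r v = J.deg v ∧
      s'.arr Arr.sm v = J.nbrSum (Finset.range J.m) v := by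
  refine (Run.forLoop_const (k := J.m) (fun i s' => s'.var Reg.si = i ∧
    ∀ v, s'.arr Arr.r v = J.cnt (Finset.range i) v ∧
      s'.arr Arr.sm v = J.nbrSum (Finset.range i) v) 15 ⟨hsi, ?_⟩ ?_ ?_ le_rfl).mono le_rfl
      fun s' h => h.2
  · intro v
    rw [hr, hsm, Finset.range_zero, Network.cnt_empty]
    exact ⟨rfl, rfl⟩
  · rintro i s' - ⟨h1, -⟩ hF
    rw [h1, hF.var 3 rfl, hm]
  · rintro i s' hi ⟨h1, h2⟩ hF
    have h3 : s'.var Reg.one = 1 := by rw [hF.var _ rfl, hone]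
    have h4 : s'.arr Arr.tfst = J.a := by rw [hF.arr _ rfl, hfst]
    have h5 : s'.arr Arr.tsnd = J.b := by rw [hF.arr _ rfl, hsnd]
    have h6 := (hJ i hi).2.2
    simp only [Reg.si, Reg.one, Arr.r, Arr.sm, Arr.tfst, Arr.tsnd] at h1 h2 h3 h4 h5
    refine Run.straight rfl (by decide) ⟨?_, fun v => ?_⟩
    · simp [treeStep, block, Program.ev, h1, h3]
    · rw [Network.cnt_range_succ, Network.nbrSum, Finset.sum_range_succ, ← Network.nbrSum]
      by_cases ha : J.a i = v
      · subst ha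
        simp [treeStep, block, Program.ev, h6, h6.symm, h1, h2, h3, h4, h5]
      · by_cases hb : J.b i = v
        · subst hb
          simp [treeStep, block, Program.ev, h6, h6.symm, h1, h2, h3, h4, h5]
        · simp [treeStep, block, Program.ev, ha, hb, Ne.symm ha, Ne.symm hb, h1, h2, h3, h4, h5,
            Function.update_apply]

end TVD

namespace TVD
open Program Finset

/-! ## Entering all edges -/

def edgeStep : Program := block [edgeSlot, merge, .add Reg.si Reg.si Reg.one]

theorem Network.boundary_empty (I : Network) : I.boundary ∅ = ∅ := by
  simp [boundary, verts_empty]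

/-- Every edge is built in the spare slot `N` and united with the empty slot of its leaf. The union
cuts the list down to the true boundary and tests the demands of ends of degree 1. -/
theorem run_edges {I : Network} (hI : I.WellFormed) {s : State} (hE : Env I s) (hH : Heap s)
    (hsi : s.var Reg.si = 0) {N : ℕ} (hN : s.var 2 = N) {leaf : ℕ → ℕ} (hleaf : s.arr Arr.leaf = leaf)
    (hlt : ∀ j < I.m, leaf j < N) (hinj : ∀ j < I.m, ∀ j' < I.m, leaf j = leaf j' → j = j')
    (hslot : ∀ z < N, Slot I s z ∅ ∅) :
    Run (.loop Reg.si 1 edgeStep) s (1 + I.m * 4994) fun s' => Env I s' ∧ Heap s' ∧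
      ∀ z < N, Slot I s' z {j ∈ range I.m | leaf j = z} (I.boundary {j ∈ range I.m | leaf j = z}) := by
  refine (Run.forLoop_const (k := I.m) (fun i s' => s'.var Reg.si = i ∧ Env I s' ∧ Heap s' ∧
    ∀ z < N, Slot I s' z {j ∈ range i | leaf j = z} (I.boundary {j ∈ range i | leaf j = z}))
    -- This is 32 for the slot of the edge, 310 · 16 for the union, and 1 for the counter.
    4993 ⟨hsi, hE, hH, ?_⟩ ?_ ?_ le_rfl).mono le_rfl fun s' h => h.2
  · simpa [Network.boundary_empty] using hslot
  · rintro i s' - ⟨h1, h2, -⟩ hF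
    rw [h1, h2.m]
  · rintro i s' hi ⟨h1, h2, h3, h4⟩ hF
    have hN' : s'.var 2 = N := by rw [hF.var _ rfl, hN]
    have hleaf' : s'.arr Arr.leaf = leaf := by rw [hF.arr _ rfl, hleaf]
    refine Run.seq (T₂ := 4961) (run_edgeSlot hI h2 h3 h1 hi) ?_ (by omega)
    rintro s1 ⟨g1, g2, g3, g4, g5, g6⟩ f1
    rw [hN'] at g4 g5 g6
    rw [hleaf'] at g3
    have hy := hlt i hi
    have hold : {j ∈ range i | leaf j = leaf i} = ∅ := by
      refine filter_eq_empty_iff.2 fun j hj he => ?_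
      have hj := mem_range.1 hj
      exact hj.ne (hinj j (hj.trans hi) i hi he)
    have hA : Slot I s1 (leaf i) ∅ ∅ := by
      have := g6 _ _ _ hy.ne (h4 _ hy)
      rwa [hold, Network.boundary_empty] at this
    have hJ : I.Joinable ∅ ∅ {i} {I.a i, I.b i} :=
      ⟨hI, Network.closed_empty, Network.closed_singleton hI hi, by simp⟩
    refine Run.seq (T₂ := 1) ((run_merge g1 g2 g3 g4 hA g5 hJ).mono
      (Nat.mul_le_mul_left _ (Network.joinSize_singleton_le i)) fun _ h => h) ?_ (by norm_num)
    rintro s2 ⟨k1, k2, k3, k4⟩ f2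
    refine Run.straight (p := .add Reg.si Reg.si Reg.one) rfl le_rfl ?_
    have f3 := Program.frame_ev (p := .add Reg.si Reg.si Reg.one) rfl s2
    have hs : ∀ z A X, Slot I s2 z A X → Slot I ((Program.add Reg.si Reg.si Reg.one).ev s2) z A X :=
      fun z A X h => ⟨h.nodup, h.list, h.counts, h.list_le, h.table, h.table_le⟩
    refine ⟨?_, k1.of_frame f3 rfl, ⟨k2.CA, k2.CB, k2.TB⟩, fun z hz => hs _ _ _ ?_⟩
    · have e1 : s2.var Reg.si = i := by rw [f2.var _ rfl, f1.var _ rfl, h1]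
      have e2 := k1.one
      simp only [Reg.si, Reg.one] at e1 e2
      simp [Program.ev, e1, e2]
    · rw [range_add_one, filter_insert]
      split_ifs with hzi
      · subst hzi
        rw [hold]
        rw [hJ.joined_eq_boundary, empty_union] at k3
        exact k3
      · exact k4 _ _ _ (Ne.symm hzi) (g6 _ _ _ hz.ne (h4 _ hz))

/-! ## Contracting the tree -/

section
open Classical
variable {W : Type*} {T : SimpleGraph W}

theorem liveNbrs_erase [DecidableEq W] (live : Finset W) (x z : W) :
    liveNbrs T (live.erase x) z = (liveNbrs T live z).erase x := by
  ext w; simp [liveNbrs, and_assoc]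

theorem mem_liveNbrs {live : Finset W} {x z : W} : z ∈ liveNbrs T live x ↔ z ∈ live ∧ T.Adj x z := by
  simp [liveNbrs]

end

/-- Only the neighbour loses a live neighbour and may become a leaf, so it is the next node to be
tested. The last node to absorb another one is recorded as the root. -/
def stripMerge : Program :=
  block [.load Reg.y Arr.sm Reg.x, merge, .store Arr.r Reg.x Reg.zero,
    .load Reg.t1 Arr.r Reg.y, .sub Reg.t1 Reg.t1 Reg.one, .store Arr.r Reg.y Reg.t1,
    .load Reg.t1 Arr.sm Reg.y, .sub Reg.t1 Reg.t1 Reg.x, .store Arr.sm Reg.y Reg.t1,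
    .copy Reg.root Reg.y, .copy Reg.x Reg.y]

def stripNext : Program := block [.add Reg.si Reg.si Reg.one, .copy Reg.x Reg.si]

/-- Contracted nodes have stored degree 0, so `go` is positive exactly for live nodes with one live
neighbour. -/
def stripTest : Program :=
  block [.load Reg.t1 Arr.r Reg.x, .const Reg.two 2,
    .ite Reg.t1 Reg.two (.copy Reg.go Reg.t1) (.const Reg.go 0)]

/-- Contract the node in `Reg.x` into its only neighbour if it is a leaf, and go on to the next node
otherwise. -/
def stripStep : Program := .seq stripTest (.ite Reg.zero Reg.go stripMerge stripNext)

/-! ### Invariant and cost of the contraction loop. -/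

section
variable {n N : ℕ} {G : SimpleGraph (Fin n)} (d : Fin n → ℕ) (B : BranchDecomposition G (Fin N))
  (L : EdgeListing G)

/-- The state of the contraction, where all nodes before `k` have been visited. -/
structure Stripping (live : Finset (Fin N)) (grp : Fin N → Fin N) (k : ℕ) (s : State) : Prop where
  env : Env (network d L) s
  heap : Heap s
  contraction : Contraction B.tree live grp
  slot : ∀ y ∈ live, Slot (network d L) s y (owned B L grp y)
    ((network d L).boundary (owned B L grp y))
  r : ∀ y : Fin N, s.arr Arr.r y = if y ∈ live then #(liveNbrs B.tree live y) else 0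
  sm : ∀ y ∈ live, s.arr Arr.sm y = ∑ z ∈ liveNbrs B.tree live y, (z : ℕ)
  si : s.var Reg.si = k
  le : k ≤ N
  x : s.var Reg.x < N ↔ k < N
  -- Up to `k`, only the node under test may still be a leaf. When `k` reaches `N`, the variable `x`
  -- is no longer a node, and the exception disappears.
  visited : ∀ z ∈ live, (z : ℕ) ≤ k → (z : ℕ) ≠ s.var Reg.x → #(liveNbrs B.tree live z) ≠ 1
  root : ∃ z ∈ live, s.var Reg.root = z

variable {d B L} {live : Finset (Fin N)} {grp : Fin N → Fin N} {k : ℕ} {s : State}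

theorem Network.closed_boundary_joinable {I : Network} (hI : I.WellFormed) {A A' : Finset ℕ}
    (hA : A ⊆ range I.m) (hA' : A' ⊆ range I.m) (h : Disjoint A A') :
    I.Joinable A (I.boundary A) A' (I.boundary A') :=
  ⟨hI, closed_boundary hA, closed_boundary hA', h⟩

/-- The bound for the third boundary is the width bound for the contraction after this step. -/
theorem joinSize_owned_le (h : Contraction B.tree live grp) {x y : Fin N} (hx : x ∈ live)
    (hxy : liveNbrs B.tree live x = {y}) :
    (network d L).joinSize (owned B L grp y) ((network d L).boundary (owned B L grp y))
      (owned B L grp x) ((network d L).boundary (owned B L grp x)) ≤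
      Network.sizeBound B.width (maxDemand d + 1) := by
  have hy := mem_liveNbrs.1 (show y ∈ liveNbrs B.tree live x by simp [hxy])
  have hJ := Network.closed_boundary_joinable (network_wellFormed d L)
    (owned_subset B L grp y) (owned_subset B L grp x) (disjoint_owned B L grp hy.2.ne')
  refine hJ.joinSize_le_sizeBound (fun v hv => (mem_filter.1 hv).2) (fun v hv => (mem_filter.1 hv).2)
    (fun v hv => ?_) (Nat.le_add_left 1 _) (card_boundary_owned_le d B L h hy.1)
    (card_boundary_owned_le d B L h hx) ?_
  · have := network_d d L ⟨v, hv⟩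
    simp only at this
    rw [this]
    exact Nat.succ_le_succ (le_sup (mem_univ _))
  · rw [hJ.joined_eq_boundary]
    have := card_boundary_owned_le d B L (h.strip hx hxy) (mem_erase.2 ⟨hy.2.ne', hy.1⟩)
    rwa [owned_strip B L grp hy.2.ne hy.2.ne', if_pos rfl] at this

theorem Stripping.of_frame (h : Stripping d B L live grp k s) {p : Program} {s' : State}
    (hF : p.Frame s s') (h1 : p.keepsEnv = true)
    (h2 : ∀ x ∈ [Reg.lp, Reg.op, Reg.si, Reg.x, Reg.root], p.writesVar x = false)
    (h3 : ∀ A ∈ [Arr.CA, Arr.CB, Arr.TB, Arr.st, Arr.len, Arr.off, Arr.LV, Arr.LC, Arr.r, Arr.sm],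
      p.writesArr A = false) : Stripping d B L live grp k s' := by
  simp only [List.mem_cons, List.not_mem_nil, or_false, forall_eq_or_imp, forall_eq] at h2 h3
  obtain ⟨v1, v2, v3, v4, v5⟩ := h2
  obtain ⟨a1, a2, a3, a4, a5, a6, a7, a8, a9, a10⟩ := h3
  refine ⟨h.env.of_frame hF h1, ⟨?_, ?_, ?_⟩, h.contraction, fun y hy => ?_, ?_, ?_, ?_, h.le, ?_,
    ?_, ?_⟩
  · rw [hF.arr _ a1]; exact h.heap.CA
  · rw [hF.arr _ a2]; exact h.heap.CB
  · rw [hF.arr _ a3, hF.var _ v2]; exact h.heap.TB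
  · exact (h.slot y hy).preserved (by rw [hF.arr _ a4]) (by rw [hF.arr _ a5]) (by rw [hF.arr _ a6])
      (by simp [hF.arr _ a7]) (by simp [hF.arr _ a8]) (by simp [hF.arr _ a3]) (hF.var _ v1).ge
      (hF.var _ v2).ge
  · rw [hF.arr _ a9]; exact h.r
  · rw [hF.arr _ a10]; exact h.sm
  · rw [hF.var _ v3, h.si]
  · rw [hF.var _ v4]; exact h.x
  · rw [hF.var _ v4]; exact h.visited
  · rw [hF.var _ v5]; exact h.root

theorem Stripping.run_merge (h : Stripping d B L live grp k s) {x y : Fin N} (hsx : s.var Reg.x = x)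
    (hx : x ∈ live) (hxy : liveNbrs B.tree live x = {y}) (hk : k < N) :
    Run stripMerge s (310 * Network.sizeBound B.width (maxDemand d + 1) + 10)
      (Stripping d B L (live.erase x) (fun u => if grp u = x then y else grp u) k) := by
  have hy := mem_liveNbrs.1 (show y ∈ liveNbrs B.tree live x by simp [hxy])
  have hne := hy.2.ne'
  have hy' : y ∈ live.erase x := mem_erase.2 ⟨hne, hy.1⟩
  have hsm := h.sm x hx
  rw [hxy, sum_singleton] at hsm
  have f1 := Program.frame_ev (p := .load Reg.y Arr.sm Reg.x) rfl s
  have hy1 : ((Program.load Reg.y Arr.sm Reg.x).ev s).var Reg.y = y := by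
    simp only [Arr.sm, Reg.x] at hsm hsx
    simp [Program.ev, hsx, hsm]
  refine Run.seq (T₁ := 1) (T₂ := 310 * Network.sizeBound B.width (maxDemand d + 1) + 9)
    (Run.straight (Q := fun s' => s' = (Program.load Reg.y Arr.sm Reg.x).ev s) rfl le_rfl rfl) ?_
    (by omega)
  rintro s1 hs1 -
  rw [← hs1] at f1 hy1
  clear hs1
  have h1 := h.of_frame f1 rfl (by decide) (by decide)
  have hx1 : s1.var Reg.x = x := by rw [f1.var _ rfl, hsx]
  have hJ := Network.closed_boundary_joinable (network_wellFormed d L)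
    (owned_subset B L grp y) (owned_subset B L grp x) (disjoint_owned B L grp hne)
  refine Run.seq (T₂ := 9) ((TVD.run_merge h1.env h1.heap hy1 hx1 (h1.slot y hy.1) (h1.slot x hx)
    hJ).mono (Nat.mul_le_mul_left _ (joinSize_owned_le h.contraction hx hxy)) fun _ h => h) ?_ le_rfl
  rintro s2 ⟨g1, g2, g3, g4⟩ f2
  rw [hJ.joined_eq_boundary] at g3
  set q := block [.store Arr.r Reg.x Reg.zero, .load Reg.t1 Arr.r Reg.y,
    .sub Reg.t1 Reg.t1 Reg.one, .store Arr.r Reg.y Reg.t1, .load Reg.t1 Arr.sm Reg.y,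
    .sub Reg.t1 Reg.t1 Reg.x, .store Arr.sm Reg.y Reg.t1, .copy Reg.root Reg.y,
    .copy Reg.x Reg.y] with hq
  have f3 := Program.frame_ev (p := q) rfl s2
  refine Run.straight (p := q) rfl (by decide) ?_
  have e1 : s2.var Reg.x = x := by rw [f2.var _ rfl, hx1]
  have e2 : s2.var Reg.y = y := by rw [f2.var _ rfl, hy1]
  have e3 := g1.one
  have e4 := g1.zero
  have e5 : s2.arr Arr.r = s1.arr Arr.r := f2.arr _ rfl
  have e6 : s2.arr Arr.sm = s1.arr Arr.sm := f2.arr _ rfl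
  have hxy' : (y : ℕ) ≠ x := fun e => hne (Fin.ext e)
  have k1 : (q.ev s2).var Reg.x = y := by
    simp only [Reg.x, Reg.y] at e1 e2
    simp [hq, block, Program.ev, e2]
  have k2 : (q.ev s2).var Reg.root = y := by
    simp only [Reg.x, Reg.y] at e1 e2
    simp [hq, block, Program.ev, e2]
  have k3 : (q.ev s2).arr Arr.r =
      Function.update (Function.update (s1.arr Arr.r) x 0) y (s1.arr Arr.r y - 1) := by
    rw [← e5]
    simp only [Reg.x, Reg.y, Reg.one, Reg.zero] at e1 e2 e3 e4
    simp [hq, block, Program.ev, e1, e2, e3, e4, hxy']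
  have k4 : (q.ev s2).arr Arr.sm = Function.update (s1.arr Arr.sm) y (s1.arr Arr.sm y - x) := by
    rw [← e6]
    simp only [Reg.x, Reg.y] at e1 e2
    simp [hq, block, Program.ev, e1, e2]
  have hxn : x ∈ liveNbrs B.tree live y := mem_liveNbrs.2 ⟨hx, hy.2.symm⟩
  have hnbr : ∀ z ∈ live.erase x, z ≠ y →
      liveNbrs B.tree (live.erase x) z = liveNbrs B.tree live z := by
    intro z hz hzy
    rw [liveNbrs_erase, erase_eq_of_notMem]
    intro hc
    have : z ∈ liveNbrs B.tree live x :=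
      mem_liveNbrs.2 ⟨mem_of_mem_erase hz, (mem_liveNbrs.1 hc).2.symm⟩
    rw [hxy, mem_singleton] at this
    exact hzy this
  have hslot : ∀ z A X, Slot (network d L) s2 z A X → Slot (network d L) (q.ev s2) z A X :=
    fun z A X h => h.preserved (by rw [f3.arr _ rfl]) (by rw [f3.arr _ rfl]) (by rw [f3.arr _ rfl])
      (by simp [f3.arr Arr.LV rfl]) (by simp [f3.arr Arr.LC rfl]) (by simp [f3.arr Arr.TB rfl])
      (f3.var _ rfl).ge (f3.var _ rfl).ge
  refine ⟨g1.of_frame f3 rfl, ⟨?_, ?_, ?_⟩, h.contraction.strip hx hxy, fun z hz => hslot _ _ _ ?_,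
    fun z => ?_, fun z hz => ?_, ?_, h.le, by rw [k1]; exact iff_of_true y.2 hk,
    fun z hz hzk hzy => ?_,
    y, hy', k2⟩
  · rw [f3.arr _ rfl]; exact g2.CA
  · rw [f3.arr _ rfl]; exact g2.CB
  · rw [f3.arr _ rfl, f3.var _ rfl]; exact g2.TB
  · rw [owned_strip B L grp hy.2.ne (ne_of_mem_erase hz)]
    split_ifs with hzy
    · rw [hzy]; exact g3
    · exact g4 _ _ _ (fun e => hzy (Fin.ext e)) (h1.slot z (mem_of_mem_erase hz))
  · rw [k3]
    by_cases hzy : z = y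
    · subst hzy
      rw [Function.update_self, if_pos hy', h1.r, if_pos hy.1, liveNbrs_erase,
        card_erase_of_mem hxn]
    · rw [Function.update_of_ne (fun e => hzy (Fin.ext e))]
      by_cases hzx : z = x
      · subst hzx
        simp
      · rw [Function.update_of_ne (fun e => hzx (Fin.ext e)), h1.r]
        by_cases hzl : z ∈ live
        · have hz := mem_erase.2 ⟨hzx, hzl⟩
          rw [if_pos hzl, if_pos hz, hnbr z hz hzy]
        · rw [if_neg hzl, if_neg fun hc => hzl (mem_of_mem_erase hc)]
  · rw [k4]
    by_cases hzy : z = y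
    · subst hzy
      rw [Function.update_self, h1.sm z hy.1, liveNbrs_erase, ← add_sum_erase _ _ hxn,
        Nat.add_sub_cancel_left]
    · rw [Function.update_of_ne (fun e => hzy (Fin.ext e)), h1.sm z (mem_of_mem_erase hz),
        hnbr z hz hzy]
  · rw [f3.var _ rfl, f2.var _ rfl, h1.si]
  -- Only `y` has lost a neighbour, and `y` is the node that is now excepted.
  · rw [k1] at hzy
    rw [hnbr z hz fun e => hzy (congrArg _ e)]
    refine h.visited z (mem_of_mem_erase hz) hzk ?_
    rw [hsx]
    exact fun e => ne_of_mem_erase hz (Fin.ext e)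

theorem Stripping.run_next (h : Stripping d B L live grp k s) {x : Fin N} (hsx : s.var Reg.x = x)
    (hx : x ∈ live → #(liveNbrs B.tree live x) ≠ 1) (hk : k < N) :
    Run stripNext s 2 (Stripping d B L live grp (k + 1)) := by
  have f := Program.frame_ev (p := stripNext) rfl s
  refine Run.straight rfl le_rfl ?_
  have h1 := h.si
  have h2 := h.env.one
  simp only [Reg.si, Reg.one] at h1 h2
  have k1 : (stripNext.ev s).var Reg.x = k + 1 := by simp [stripNext, block, Program.ev, h1, h2]
  have k2 : (stripNext.ev s).var Reg.si = k + 1 := by simp [stripNext, block, Program.ev, h1, h2]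
  refine ⟨h.env.of_frame f rfl, ⟨?_, ?_, ?_⟩, h.contraction, fun y hy => ?_, ?_, ?_, k2, hk,
    by rw [k1], fun z hz hzk hzx => ?_, ?_⟩
  · rw [f.arr _ rfl]; exact h.heap.CA
  · rw [f.arr _ rfl]; exact h.heap.CB
  · rw [f.arr _ rfl, f.var _ rfl]; exact h.heap.TB
  · exact (h.slot y hy).preserved (by rw [f.arr _ rfl]) (by rw [f.arr _ rfl]) (by rw [f.arr _ rfl])
      (by simp [f.arr Arr.LV rfl]) (by simp [f.arr Arr.LC rfl]) (by simp [f.arr Arr.TB rfl])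
      (f.var _ rfl).ge (f.var _ rfl).ge
  · rw [f.arr _ rfl]; exact h.r
  · rw [f.arr _ rfl]; exact h.sm
  · rw [k1] at hzx
    by_cases hzx' : z = x
    · rw [hzx']
      exact hx (hzx' ▸ hz)
    · exact h.visited z hz (by omega) (by rw [hsx]; exact fun e => hzx' (Fin.ext e))
  · rw [f.var _ rfl]; exact h.root

theorem Stripping.run_step (h : Stripping d B L live grp k s) (hk : k < N) :
    ∃ live' grp' k' T, Run stripStep s T (Stripping d B L live' grp' k') ∧
      ((k' = k ∧ #live' + 1 = #live ∧ T ≤ 310 * Network.sizeBound B.width (maxDemand d + 1) + 15) ∨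
        k' = k + 1 ∧ #live' = #live ∧ T ≤ 15) := by
  obtain ⟨x, hsx⟩ : ∃ x : Fin N, s.var Reg.x = x := ⟨⟨_, h.x.2 hk⟩, rfl⟩
  have f := Program.frame_ev (p := stripTest) rfl s
  have h1 := h.of_frame f rfl (by decide) (by decide)
  have hgo : 0 < (stripTest.ev s).var Reg.go ↔ s.arr Arr.r x = 1 := by
    simp only [Reg.x, Arr.r] at hsx ⊢
    by_cases hc : s.arr 10 x < 2
    · simp [stripTest, block, Program.ev, hsx, hc]
      omega
    · simp [stripTest, block, Program.ev, hsx, hc]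
      omega
  have hsx1 : (stripTest.ev s).var Reg.x = x := by rw [f.var _ rfl, hsx]
  have hzero := h1.env.zero
  have test : ∀ {T Q}, Run (.ite Reg.zero Reg.go stripMerge stripNext) (stripTest.ev s) T Q →
      Run stripStep s (T + 4) Q := fun hr =>
    Run.seq (T₁ := 4) (Run.straight (Q := fun s' => s' = stripTest.ev s) rfl (by decide) rfl)
      (fun s' hs' _ => hs' ▸ hr) (by omega)
  have hr := h.r x
  by_cases hx : x ∈ live ∧ #(liveNbrs B.tree live x) = 1
  · rw [if_pos hx.1, hx.2] at hr
    obtain ⟨y, hxy⟩ := card_eq_one.1 hx.2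
    refine ⟨_, _, _, _, test (Run.ite (fun _ => h1.run_merge hsx1 hx.1 hxy hk) (fun hc => ?_) le_rfl),
      .inl ⟨rfl, card_erase_add_one hx.1, by omega⟩⟩
    rw [hzero] at hc
    exact absurd (hgo.2 hr) hc
  · refine ⟨_, _, _, _, test (Run.ite (fun hc => ?_)
      (fun _ => h1.run_next hsx1 (fun hxl h1 => hx ⟨hxl, h1⟩) hk) le_rfl), .inr ⟨rfl, rfl, by norm_num⟩⟩
    rw [hzero, hgo, hr] at hc
    split_ifs at hc with hxl
    exact absurd ⟨hxl, hc⟩ hx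

theorem Stripping.run (h : Stripping d B L univ id 0 s) (hN : s.var 2 = N) :
    Run (.loop Reg.si 2 stripStep) s
      (N * (310 * Network.sizeBound B.width (maxDemand d + 1) + 32) + 1) fun s' =>
      Env (network d L) s' ∧ ∃ z, s'.var Reg.root = z ∧ Slot (network d L) s' z (range L.num) ∅ := by
  set M := Network.sizeBound B.width (maxDemand d + 1)
  refine (Run.whileLoop (α := Finset (Fin N) × (Fin N → Fin N) × ℕ)
    (fun a s' => Stripping d B L a.1 a.2.1 a.2.2 s')
    -- A contraction removes a live node and pays for a union; otherwise the counter advances for a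
    -- constant price. A neighbour that is tested again is paid for by the preceding contraction.
    (fun a => #a.1 * (310 * M + 16) + (N - a.2.2) * 16) (a := (univ, id, 0)) h ?_).frame.mono ?_ ?_
  · rintro ⟨live, grp, k⟩ s' h' hF hlt
    rw [h'.si, hF.var 2 rfl, hN] at hlt
    obtain ⟨live', grp', k', T, hr, hcase⟩ := h'.run_step hlt
    refine ⟨T, (live', grp', k'), hr, ?_⟩
    rcases hcase with ⟨rfl, h2, h3⟩ | ⟨rfl, h2, h3⟩
    · simp only [← h2, add_mul]
      omega
    · simp only [h2]
      dsimp only at hlt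
      omega
  · simp only [card_univ, Fintype.card_fin]
    apply le_of_eq
    rw [Nat.sub_zero]
    ring
  · rintro s' ⟨⟨hge, ⟨live, grp, k⟩, h'⟩, hF⟩
    obtain ⟨z, hz, hroot⟩ := h'.root
    dsimp only at h' hz
    have hN' : s'.var 2 = N := by rw [hF.var 2 rfl, hN]
    have hk := h'.si
    have hle := h'.le
    have hx := h'.x
    -- The counter and the node under test are both out of range now, so no live node has exactly
    -- one live neighbour.
    obtain ⟨z', hlive⟩ := card_eq_one.1 (h'.contraction.card_live_eq_one B.isTree fun u hu =>
      h'.visited u hu (by omega) (by omega))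
    have hown : owned B L grp z = range L.num := by
      refine (owned_subset B L grp z).antisymm fun j hj => ?_
      have hg := h'.contraction.mem (leafAt B L ⟨j, mem_range.1 hj⟩)
      refine (mem_owned B L ⟨j, mem_range.1 hj⟩).2 ?_
      rw [hlive, mem_singleton] at hz hg
      rw [hz, hg]
    have hb : (network d L).boundary (range L.num) = ∅ :=
      filter_eq_empty_iff.2 fun v _ => lt_irrefl _
    have hs := h'.slot z hz
    rw [hown, hb] at hs
    exact ⟨h'.env, z, hroot, hs⟩
end
end TVD

namespace TVD
open Program Finset

/-! ## Reading off an optimal set -/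

theorem sum_two_pow_lt {W : Finset ℕ} {n : ℕ} (hW : W ⊆ range n) : ∑ v ∈ W, 2 ^ v < 2 ^ n :=
  Nat.geomSum_lt le_rfl fun _ hv => mem_range.1 (hW hv)

/-- Decide whether the vertex before the one in `Reg.si` belongs to the set. -/
def extractStep : Program :=
  block [.sub Reg.si Reg.si Reg.one, .load Reg.t1 Arr.P Reg.si,
    .ite Reg.t1 Reg.t3 (block [.sub Reg.t3 Reg.t3 Reg.t1, .store Arr.out Reg.si Reg.one]) .skip]

/-- Output the set whose weight is one less than the number in `Reg.t2`. -/
def extract : Program :=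
  block [.copy Reg.t3 Reg.t2, .loop Reg.pn Reg.t3 (.sub Reg.t3 Reg.t3 Reg.pn), .copy Reg.si 0,
    .loop Reg.zero Reg.si extractStep, .copy 0 Reg.one]

/-- Subtracting 2^n repeatedly removes the cardinality part, one subtraction per selected vertex.
The binary digits are then read from the top. The extra 1 in the stored value makes the strict tests
of the program behave like ≤. -/
theorem run_extract {I : Network} {s : State} (hE : Env I s) {W : Finset ℕ} (hW : W ⊆ range I.n)
    (ht : s.var Reg.t2 = ∑ v ∈ W, I.weight v + 1) (hout : ∀ v, s.arr Arr.out v = 0) :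
    Run extract s (8 * I.n + 5) fun s' => s'.var 0 = 1 ∧ ∀ v < I.n, s'.arr Arr.out v ≠ 0 ↔ v ∈ W := by
  have hcard := card_le_card hW
  rw [card_range] at hcard
  have hlt := sum_two_pow_lt hW
  have hsum : ∑ v ∈ W, I.weight v = #W * 2 ^ I.n + ∑ v ∈ W, 2 ^ v := by
    simp [Network.weight, sum_add_distrib]
  rw [hsum] at ht
  refine Run.seq (T₁ := 1) (T₂ := 8 * I.n + 4) (Run.straight (Q := fun s' => s' = _) rfl le_rfl rfl)
    ?_ (by omega)
  rintro s1 hs1 f1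
  have ht1 : s1.var Reg.t3 = #W * 2 ^ I.n + ∑ v ∈ W, 2 ^ v + 1 := by
    rw [hs1, ← ht]; simp [Program.ev]
  have hE1 := hE.of_frame f1 rfl
  have hout1 : ∀ v, s1.arr Arr.out v = 0 := by rw [f1.arr _ rfl]; exact hout
  clear hs1
  refine Run.seq (T₁ := 1 + #W * 2) (T₂ := 6 * I.n + 3) (Run.forLoop_const (k := #W)
    (fun i s' => s'.var Reg.t3 = (#W - i) * 2 ^ I.n + ∑ v ∈ W, 2 ^ v + 1) 1 (by rw [ht1, Nat.sub_zero])
    ?_ ?_ le_rfl) ?_ (by omega)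
  · intro i s' hi h hF
    rw [h, (hE1.of_frame hF rfl).pn]
    rcases Nat.lt_or_ge i #W with hiW | hiW
    · have := Nat.le_mul_of_pos_left (2 ^ I.n) (Nat.sub_pos_of_lt hiW)
      omega
    · rw [Nat.sub_eq_zero_of_le hiW]
      omega
  · intro i s' hi h hF
    have hpn := (hE1.of_frame hF rfl).pn
    refine Run.straight rfl le_rfl ?_
    simp only [Reg.t3, Reg.pn] at h hpn
    simp only [Program.ev, Reg.t3, Reg.pn, State.setVar_var, if_true, h, hpn]
    obtain ⟨c, hc⟩ := Nat.exists_eq_add_of_lt hi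
    rw [show #W - i = c + 1 by omega, show #W - (i + 1) = c by omega, add_mul]
    omega
  intro s2 h2 f2
  rw [Nat.sub_self, zero_mul, zero_add] at h2
  have hE2 := hE1.of_frame f2 rfl
  refine Run.seq (T₁ := 1) (T₂ := 6 * I.n + 2) (Run.straight (Q := fun s' => s' = _) rfl le_rfl rfl)
    ?_ (by omega)
  rintro s3 hs3 f3
  have hE3 := hE2.of_frame f3 rfl
  have h3 : s3.var Reg.t3 = ∑ v ∈ W, 2 ^ v + 1 := by rw [f3.var _ rfl, h2]
  have hsi : s3.var Reg.si = I.n := by rw [hs3, ← hE2.n]; simp [Program.ev]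
  have hout3 : ∀ v, s3.arr Arr.out v = 0 := by rw [f3.arr _ rfl, f2.arr _ rfl]; exact hout1
  clear hs3
  refine Run.seq (T₁ := 1 + I.n * 6) (T₂ := 1) (Run.forLoop_const (k := I.n)
    (fun i s' => s'.var Reg.si = I.n - i ∧ s'.var Reg.t3 = ∑ v ∈ W with v < I.n - i, 2 ^ v + 1 ∧
      ∀ v < I.n, s'.arr Arr.out v ≠ 0 ↔ v ∈ W ∧ I.n - i ≤ v) 5 ⟨hsi, ?_, ?_⟩ ?_ ?_ le_rfl) ?_ (by omega)
  · rw [h3, Nat.sub_zero, filter_true_of_mem fun v hv => mem_range.1 (hW hv)]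
  · intro v hv
    simp [hout3, hv]
  · rintro i s' - ⟨h, -⟩ hF
    rw [h, (hE3.of_frame hF rfl).zero]
    omega
  · rintro i s' hi ⟨g1, g2, g3⟩ hF
    have hE4 := hE3.of_frame hF rfl
    have hone := hE4.one
    obtain ⟨u, hu⟩ : ∃ u, I.n - i = u + 1 := ⟨I.n - i - 1, by omega⟩
    have hu' : I.n - (i + 1) = u := by omega
    have hP := hE4.P u (by omega)
    rw [hu] at g1 g2 g3
    rw [hu']
    have hfil : (∑ v ∈ W with v < u + 1, 2 ^ v) =
        (∑ v ∈ W with v < u, 2 ^ v) + if u ∈ W then 2 ^ u else 0 := by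
      rw [sum_filter, sum_filter, ← sum_ite_eq' W u (fun v => 2 ^ v), ← sum_add_distrib]
      refine sum_congr rfl fun v _ => ?_
      rcases lt_trichotomy v u with h | h | h
      · simp [h, h.ne, h.trans (Nat.lt_succ_self u)]
      · simp [h]
      · simp [h.ne', Nat.not_lt.2 h.le, show ¬ v < u + 1 by omega]
    have hlt : ∑ v ∈ W with v < u, 2 ^ v < 2 ^ u :=
      sum_two_pow_lt fun v hv => mem_range.2 (mem_filter.1 hv).2
    -- The lower digits sum to less than 2^u, so together with the extra 1 they never exceed it.
    have hc : 2 ^ u < s'.var Reg.t3 ↔ u ∈ W := by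
      rw [g2, hfil]
      split_ifs with h <;> simp [h]
      omega
    refine Run.straight rfl (by decide) ⟨?_, ?_, fun v hv => ?_⟩
    · simp only [Reg.si, Reg.one, Reg.t3, Arr.P] at g1 hone hP hc
      by_cases h : u ∈ W <;> simp [extractStep, block, Program.ev, g1, hone, hP, hc, h]
    · rw [hfil] at g2
      simp only [Reg.si, Reg.one, Reg.t3, Arr.P] at g1 g2 hone hP hc
      by_cases h : u ∈ W
      · rw [if_pos h] at g2
        simp [extractStep, block, Program.ev, g1, hone, hP, hc, h]
        omega
      · rw [if_neg h] at g2
        simp [extractStep, block, Program.ev, g1, hone, hP, g2]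
        omega
    · have := g3 v hv
      simp only [Reg.si, Reg.one, Reg.t3, Arr.P, Arr.out] at g1 hone hP hc this
      by_cases h : u ∈ W
      · rcases eq_or_ne v u with rfl | hvu
        · simp [extractStep, block, Program.ev, g1, hone, hP, hc, h]
        · simp [extractStep, block, Program.ev, g1, hone, hP, hc, h, hvu, this]
          omega
      · have hiff : v ∈ W ∧ u + 1 ≤ v ↔ v ∈ W ∧ u ≤ v := by
          refine and_congr_right fun hvW => ?_
          have : v ≠ u := fun e => h (e ▸ hvW)
          omega
        simp [extractStep, block, Program.ev, g1, hone, hP, hc, h, ← hiff]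
        simpa using this
  rintro s4 ⟨-, -, g⟩ f4
  have hone := (hE3.of_frame f4 rfl).one
  refine Run.straight (p := .copy 0 Reg.one) rfl le_rfl ⟨?_, fun v hv => ?_⟩
  · simpa [Program.ev] using hone
  · have := g v hv
    simpa [Program.ev] using this

/-! ## Optimal sets -/

namespace Network
variable {I : Network}

theorem cost_empty_boundary (S : Finset ℕ) : I.cost (range I.m) ∅ S =
    ∑ v ∈ I.verts (range I.m) ∩ S, I.weight v := by
  rw [cost, sdiff_empty, sum_ite_mem]

/-- Vertices without edges are discarded from the set: they are nobody's neighbours, and their own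
demands are 0 because no demand exceeds the degree. -/
theorem exists_of_best_pos (hI : I.WellFormed) (hd : ∀ v < I.n, I.d v ≤ I.deg v)
    (h : 0 < I.best (range I.m) ∅ 0) : ∃ W ⊆ range I.n,
      I.best (range I.m) ∅ 0 = ∑ v ∈ W, I.weight v + 1 ∧
      ∀ v < I.n, I.d v ≤ I.nbr (range I.m) W v := by
  obtain ⟨S, hS, -, hbest⟩ := best_pos_iff.1 h
  refine ⟨I.verts (range I.m) ∩ S, inter_subset_left.trans (filter_subset _ _), ?_, fun v hv => ?_⟩
  · rw [hbest, cost_empty_boundary]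
  · rw [nbr_congr (S' := S) hI Subset.rfl fun u hu => by simp [hu]]
    by_cases hvv : v ∈ I.verts (range I.m)
    · exact hS v (by simpa using hvv)
    · have h0 : I.deg v = 0 := (cnt_eq_zero hI Subset.rfl).1 hvv
      have := hd v hv
      omega

theorem best_le_of_forall {S : Finset ℕ} (hS : ∀ v < I.n, I.d v ≤ I.nbr (range I.m) S v) :
    0 < I.best (range I.m) ∅ 0 ∧ I.best (range I.m) ∅ 0 ≤
      ∑ v ∈ I.verts (range I.m) ∩ S, I.weight v + 1 := by
  have hsat : I.Sat (range I.m) ∅ S := fun v hv =>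
    hS v (mem_range.1 (mem_filter.1 (mem_sdiff.1 hv).1).1)
  have h0 : I.code (range I.m) ∅ S = 0 := sum_empty
  have h1 := best_pos hsat
  have h2 := best_le hsat
  rw [h0] at h1 h2
  rw [cost_empty_boundary] at h2
  exact ⟨h1, h2⟩

/-- The terms 2^v of distinct vertices sum to less than 2^n, so the cardinality dominates the
comparison. -/
theorem card_le_of_sum_weight_le {W S : Finset ℕ} (hS : S ⊆ range I.n)
    (h : ∑ v ∈ W, I.weight v ≤ ∑ v ∈ S, I.weight v) : #W ≤ #S := by
  have hsum : ∀ W : Finset ℕ, ∑ v ∈ W, I.weight v = #W * 2 ^ I.n + ∑ v ∈ W, 2 ^ v := fun W => by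
    simp [weight, sum_add_distrib]
  rw [hsum, hsum] at h
  have := sum_two_pow_lt hS
  by_contra hc
  have := Nat.mul_le_mul_right (2 ^ I.n) (show #S + 1 ≤ #W by omega)
  rw [add_mul] at this
  omega

end Network

/-- Output an optimal set, if there is one, from the table in the slot `Reg.root`. -/
def decode : Program :=
  block [.load Reg.t1 Arr.off Reg.root, .load Reg.t2 Arr.TB Reg.t1,
    .ite Reg.zero Reg.t2 extract (.const 0 0)]

theorem correctOutput_of_table {n : ℕ} {G : SimpleGraph (Fin n)} {d : Fin n → ℕ} {L : EdgeListing G}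
    {W : Finset ℕ} (hW : W ⊆ range n)
    (hbest : (network d L).best (range L.num) ∅ 0 = ∑ v ∈ W, (network d L).weight v + 1)
    (hdom : ∀ v < n, (network d L).d v ≤ (network d L).nbr (range L.num) W v) {s : State}
    (h0 : s.var 0 = 1) (hs : ∀ v < n, s.arr Arr.out v ≠ 0 ↔ v ∈ W) : CorrectOutput G d s := by
  have hvals : vals (outputSet n s) = W := by
    ext v
    by_cases hv : v < n
    · exact (mem_vals (v := ⟨v, hv⟩)).trans (hs v hv)
    · refine iff_of_false (fun h => ?_) fun h => hv (mem_range.1 (hW h))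
      obtain ⟨u, -, rfl⟩ := mem_map.1 h
      exact hv u.2
  refine .inl ⟨h0, (isTotalVectorDominating_iff d L _).2 fun v => ?_, fun S' hS' => ?_⟩
  · rw [hvals]
    exact hdom v v.2
  · have h1 := (isTotalVectorDominating_iff d L _).1 hS'
    have h2 := (Network.best_le_of_forall (I := network d L) fun v hv => h1 ⟨v, hv⟩).2
    change (network d L).best (range L.num) ∅ 0 ≤ _ at h2
    rw [hbest, add_le_add_iff_right] at h2
    rw [← card_vals, ← card_vals, hvals]
    refine (Network.card_le_of_sum_weight_le
      (inter_subset_left.trans (filter_subset _ _)) h2).trans (card_le_card inter_subset_right)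

theorem run_decode {n : ℕ} {G : SimpleGraph (Fin n)} {d : Fin n → ℕ} {L : EdgeListing G} {s : State}
    (hE : Env (network d L) s) (hd : ∀ v < n, (network d L).d v ≤ (network d L).deg v) {z : ℕ}
    (hz : s.var Reg.root = z) (hs : Slot (network d L) s z (range L.num) ∅)
    (hout : ∀ v, s.arr Arr.out v = 0) : Run decode s (8 * n + 8) (CorrectOutput G d) := by
  set I := network d L
  refine Run.seq (T₁ := 1) (T₂ := 8 * n + 7) (Run.straight (Q := fun s' => s' = _) rfl le_rfl rfl) ?_
    (by omega)
  rintro s1 hs1 f1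
  have h1 : s1.var Reg.t1 = s.arr Arr.off z := by rw [hs1, ← hz]; simp [Program.ev]
  refine Run.seq (T₁ := 1) (T₂ := 8 * n + 6) (Run.straight (Q := fun s' => s' = _) rfl le_rfl rfl) ?_
    (by omega)
  rintro s2 hs2 f2
  have hE2 := (hE.of_frame f1 rfl).of_frame f2 rfl
  have h2 : s2.var Reg.t2 = I.best (range L.num) ∅ 0 := by
    have := hs.table 0 (I.stride_pos _)
    rw [add_zero, ← h1, ← f1.arr _ rfl] at this
    rw [hs2, ← this]
    simp [Program.ev]
  have hout2 : ∀ v, s2.arr Arr.out v = 0 := by rw [f2.arr _ rfl, f1.arr _ rfl]; exact hout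
  refine Run.ite (T := 8 * n + 5) (fun hc => ?_) (fun hc => ?_) le_rfl
  · rw [hE2.zero, h2] at hc
    obtain ⟨W, hW, hb, hdom⟩ := Network.exists_of_best_pos (network_wellFormed d L) hd hc
    exact (run_extract hE2 hW (h2.trans hb) hout2).mono le_rfl fun s' h =>
      correctOutput_of_table hW hb hdom h.1 h.2
  · rw [hE2.zero, h2] at hc
    refine Run.straight rfl (by simp [Program.cost]) (.inr ⟨by simp [Program.ev], fun S hS => hc ?_⟩)
    have h1 := (isTotalVectorDominating_iff d L _).1 hS
    exact (Network.best_le_of_forall (I := network d L) fun v hv => h1 ⟨v, hv⟩).1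

end TVD

namespace TVD
open Program Finset

/-! ## The program -/

theorem Run.seq_straight {p q : Program} {s : State} {T₂ T : ℕ} {Q : State → Prop}
    (hp : p.loopFree = true) (h : ∀ s', s' = p.ev s → p.Frame s s' → Run q s' T₂ Q)
    (hT : p.cost + T₂ ≤ T) : Run (.seq p q) s T Q :=
  (Run.of_loopFree hp).seq (fun s' hs' hF => h s' hs' hF) hT

/-- Compute the degrees and compare them with the demands. -/
def prepare : Program :=
  block [block [.const Reg.one 1, .const Reg.si 0], .loop Reg.si 1 degreeStep, .const Reg.si 0,
    .loop Reg.si 0 checkStep]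

/-- Compute the place values. -/
def places : Program :=
  block [block [.const Reg.si 0, .const Reg.t1 1, .const Reg.pn 1], .loop Reg.si 0 placeStep,
    .copy Reg.big Reg.t1]

/-- Record the tree and the table of the empty edge set. -/
def setup : Program :=
  block [.const Reg.si 0, .loop Reg.si 3 treeStep,
    block [.const Reg.t1 0, .store Arr.TB Reg.t1 Reg.one, .copy Reg.op Reg.big]]

/-- Enter all edges in the leaves, contract the tree, and output an optimal set. -/
def solve : Program :=
  block [.const Reg.si 0, .loop Reg.si 1 edgeStep,
    block [.const Reg.si 0, .const Reg.x 0, .const Reg.root 0], .loop Reg.si 2 stripStep, decode]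

/-- Compute a minimum total vector dominating set. -/
def minDominating : Program :=
  .seq prepare (.ite Reg.zero Reg.bad (.const 0 0) (block [places, setup, solve]))

theorem run_prepare {I : Network} (hI : I.WellFormed) {s : State} (hn : s.var 0 = I.n)
    (hm : s.var 1 = I.m) (hbad : s.var Reg.bad = 0) (hdem : s.arr Arr.dem = I.d)
    (hfst : s.arr Arr.fst = I.a) (hsnd : s.arr Arr.snd = I.b) (hdeg : ∀ v, s.arr Arr.deg v = 0) :
    Run prepare s (I.m * 10 + I.n * 6 + 5) fun s' => s'.var Reg.one = 1 ∧
      (∀ v, s'.arr Arr.deg v = I.deg v) ∧ (0 < s'.var Reg.bad ↔ ∃ v < I.n, I.deg v < I.d v) := by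
  refine Run.seq_straight (T₂ := I.m * 10 + I.n * 6 + 3) rfl (fun s1 hs1 f1 => ?_)
    (by change 2 + _ ≤ _; omega)
  have hone : s1.var Reg.one = 1 := by rw [hs1]; simp [block, Program.ev]
  have hsi : s1.var Reg.si = 0 := by rw [hs1]; simp [block, Program.ev]
  clear hs1
  refine Run.seq (T₂ := I.n * 6 + 2) (run_degrees hI (by rw [f1.var _ rfl, hm]) hone hsi
    (by rw [f1.arr _ rfl, hfst]) (by rw [f1.arr _ rfl, hsnd]) (by rw [f1.arr _ rfl]; exact hdeg))
    (fun s2 h2 f2 => ?_) (by omega)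
  refine Run.seq_straight (T₂ := 1 + I.n * 6) rfl (fun s3 hs3 f3 => ?_) (by change 1 + _ ≤ _; omega)
  have hsi : s3.var Reg.si = 0 := by rw [hs3]; simp [Program.ev]
  have hone : s3.var Reg.one = 1 := by rw [f3.var _ rfl, f2.var _ rfl, hone]
  have hdeg : ∀ v, s3.arr Arr.deg v = I.deg v := by rw [f3.arr _ rfl]; exact h2
  refine (run_check (I := I) (by rw [f3.var _ rfl, f2.var _ rfl, f1.var _ rfl, hn]) hone hsi
    (by rw [f3.var _ rfl, f2.var _ rfl, f1.var _ rfl, hbad])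
    (by rw [f3.arr _ rfl, f2.arr _ rfl, f1.arr _ rfl, hdem]) hdeg).mono_frame le_rfl
    fun s4 h4 f4 => ⟨?_, ?_, h4⟩
  · rw [f4.var _ rfl, hone]
  · rw [f4.arr _ rfl]; exact hdeg

theorem run_placeValues {I : Network} {s : State} (hn : s.var 0 = I.n) (hone : s.var Reg.one = 1)
    (hdem : s.arr Arr.dem = I.d) :
    Run places s (∑ v ∈ range I.n, (10 + I.d v * 3) + 5) fun s' =>
      s'.var Reg.big = I.stride I.n ∧ s'.var Reg.pn = 2 ^ I.n ∧
      (∀ v < I.n, s'.arr Arr.S v = I.stride v) ∧ ∀ v < I.n, s'.arr Arr.P v = 2 ^ v := by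
  refine Run.seq_straight (T₂ := ∑ v ∈ range I.n, (10 + I.d v * 3) + 2) rfl (fun s1 hs1 f1 => ?_)
    (by change 3 + _ ≤ _; omega)
  refine Run.seq (T₂ := 1) (run_places (I := I) (by rw [f1.var _ rfl, hn])
    (by rw [f1.var _ rfl, hone]) (by rw [hs1]; simp [block, Program.ev])
    (by rw [hs1]; simp [block, Program.ev]) (by rw [hs1]; simp [block, Program.ev])
    (by rw [f1.arr _ rfl, hdem])) (fun s2 h2 f2 => ?_) (by omega)
  refine Run.straight (p := .copy Reg.big Reg.t1) rfl le_rfl ?_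
  simpa [Program.ev] using h2

theorem run_setup {J : Network} (hJ : J.WellFormed) {s : State} (hm : s.var 3 = J.m)
    (hone : s.var Reg.one = 1) (hfst : s.arr Arr.tfst = J.a) (hsnd : s.arr Arr.tsnd = J.b)
    (hr : ∀ v, s.arr Arr.r v = 0) (hsm : ∀ v, s.arr Arr.sm v = 0) (hTB : ∀ i, s.arr Arr.TB i = 0) :
    Run setup s (J.m * 16 + 5) fun s' => (∀ v, s'.arr Arr.r v = J.deg v ∧
      s'.arr Arr.sm v = J.nbrSum (range J.m) v) ∧ s'.var Reg.op = s.var Reg.big ∧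
      ∀ i, s'.arr Arr.TB i = if i = 0 then 1 else 0 := by
  refine Run.seq_straight (T₂ := J.m * 16 + 4) rfl (fun s1 hs1 f1 => ?_) (by change 1 + _ ≤ _; omega)
  refine Run.seq (T₂ := 3) (run_tree hJ (by rw [f1.var _ rfl, hm]) (by rw [f1.var _ rfl, hone])
    (by rw [hs1]; simp [Program.ev]) (by rw [f1.arr _ rfl, hfst]) (by rw [f1.arr _ rfl, hsnd])
    (by rw [f1.arr _ rfl]; exact hr) (by rw [f1.arr _ rfl]; exact hsm)) (fun s2 h2 f2 => ?_) (by omega)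
  have hone2 : s2.var Reg.one = 1 := by rw [f2.var _ rfl, f1.var _ rfl, hone]
  have hbig : s2.var Reg.big = s.var Reg.big := by rw [f2.var _ rfl, f1.var _ rfl]
  have hTB2 : s2.arr Arr.TB = fun _ => 0 := by
    rw [f2.arr _ rfl, f1.arr _ rfl]; exact funext hTB
  refine Run.straight (p := block [.const Reg.t1 0, .store Arr.TB Reg.t1 Reg.one,
    .copy Reg.op Reg.big]) rfl (by decide) ⟨?_, ?_, fun i => ?_⟩
  · simpa [block, Program.ev] using h2
  · simpa [block, Program.ev] using hbig
  · simp only [Reg.one, Arr.TB] at hone2 hTB2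
    simp [block, Program.ev, hone2, hTB2, Function.update_apply]

section
variable {n N : ℕ} {G : SimpleGraph (Fin n)} {d : Fin n → ℕ}

theorem card_liveNbrs_univ (v : Fin n) : #(liveNbrs G univ v) = (G.neighborSet v).ncard := by
  classical
  rw [Set.ncard_eq_toFinset_card']
  congr 1
  ext z
  simp [liveNbrs]

theorem nbrSum_network (L : EdgeListing G) (v : Fin n) :
    (network d L).nbrSum (range L.num) v = ∑ u ∈ liveNbrs G univ v, (u : ℕ) := by
  classical
  have h1 : ∀ u : Fin n, (network d L).nbr (range L.num) {(u : ℕ)} v =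
      if u ∈ liveNbrs G univ v then 1 else 0 := by
    intro u
    have hu : vals {u} = {(u : ℕ)} := by simp [vals]
    rw [← hu, nbr_network]
    split_ifs with h <;> rw [mem_liveNbrs] at h
    · rw [Set.inter_eq_right.2 (by simpa using h.2), Set.ncard_singleton]
    · rw [Set.ncard_eq_zero, Set.inter_singleton_eq_empty]
      simpa using h
  have h2 : ∀ j ∈ range L.num, ((if (network d L).a j = v then (network d L).b j else 0) +
      if (network d L).b j = v then (network d L).a j else 0) =
      ∑ u : Fin n, if ((network d L).a j = v ∧ (network d L).b j ∈ ({(u : ℕ)} : Finset ℕ)) ∨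
        ((network d L).b j = v ∧ (network d L).a j ∈ ({(u : ℕ)} : Finset ℕ)) then (u : ℕ) else 0 := by
    intro j hj
    have hw := network_wellFormed d L j (mem_range.1 hj)
    obtain ⟨a, ha⟩ : ∃ a : Fin n, (network d L).a j = a := ⟨⟨_, hw.1⟩, rfl⟩
    obtain ⟨b, hb⟩ : ∃ b : Fin n, (network d L).b j = b := ⟨⟨_, hw.2.1⟩, rfl⟩
    rw [ha, hb] at hw ⊢
    have hne : a ≠ b := fun e => hw.2.2 (congrArg _ e)
    simp only [mem_singleton, Fin.val_inj]
    by_cases hav : a = v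
    · subst hav
      simp [hne.symm]
    · by_cases hbv : b = v
      · subst hbv
        simp [hne]
      · simp [hav, hbv]
  rw [Network.nbrSum, sum_congr rfl h2, sum_comm, ← filter_univ_mem (liveNbrs G univ v), sum_filter]
  refine sum_congr rfl fun u _ => ?_
  rw [← sum_filter, sum_const, smul_eq_mul]
  change (network d L).nbr (range L.num) {(u : ℕ)} v * _ = _
  rw [h1]
  split_ifs <;> simp

variable {B : BranchDecomposition G (Fin N)} {L : EdgeListing G} {K : EdgeListing B.tree}

/-- At the beginning all slots share one table at address 0, with the value 1 at the code 0. Sharing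
is harmless, since a union builds a new table instead of changing an old one. -/
theorem slot_empty {I : Network} {s : State} {z : ℕ} (hst : s.arr Arr.st z = 0)
    (hlen : s.arr Arr.len z = 0) (hoff : s.arr Arr.off z = 0) (hop : s.var Reg.op = I.stride I.n)
    (hTB : ∀ i, s.arr Arr.TB i = if i = 0 then 1 else 0) : Slot I s z ∅ ∅ := by
  refine ⟨?_, ?_, ?_, ?_, fun k _ => ?_, ?_⟩
  · simp [hlen, segment]
  · simp [hlen, segment]
  · simp [hlen]
  · simp [hst, hlen]
  · rw [hoff, zero_add, hTB, Network.best_empty]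
  · rw [hoff, hop, zero_add]

theorem run_solve {s : State} (hE : Env (network d L) s) (hH : Heap s) (hN : s.var 2 = N)
    (hd : ∀ v < n, (network d L).d v ≤ (network d L).deg v)
    (hleaf : s.arr Arr.leaf = toArray fun i => ((B.leafOf (L.edge i) : Fin N) : ℕ))
    (hslot : ∀ z < N, Slot (network d L) s z ∅ ∅)
    (hr : ∀ y : Fin N, s.arr Arr.r y = #(liveNbrs B.tree univ y))
    (hsm : ∀ y : Fin N, s.arr Arr.sm y = ∑ z ∈ liveNbrs B.tree univ y, (z : ℕ))
    (hout : ∀ v, s.arr Arr.out v = 0) :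
    Run solve s (L.num * 4994 + N * (310 * Network.sizeBound B.width (maxDemand d + 1) + 32) +
      8 * n + 14) (CorrectOutput G d) := by
  set M := Network.sizeBound B.width (maxDemand d + 1)
  set f : Fin L.num → ℕ := fun i => ((B.leafOf (L.edge i) : Fin N) : ℕ) with hf
  have hfl : ∀ i : Fin L.num, toArray f i = leafAt B L i := fun i => toArray_of_lt f i.2
  have hpos : 0 < N := Fin.pos B.isTree.connected.nonempty.some
  refine Run.seq_straight (T₂ := L.num * 4994 + N * (310 * M + 32) + 8 * n + 13) rfl
    (fun s1 hs1 f1 => ?_) (by change 1 + _ ≤ _; omega)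
  have hsl1 : ∀ z A X, Slot (network d L) s z A X → Slot (network d L) s1 z A X := by
    rw [hs1]
    exact fun z A X h => ⟨h.nodup, h.list, h.counts, h.list_le, h.table, h.table_le⟩
  have hH1 : Heap s1 := by rw [hs1]; exact ⟨hH.CA, hH.CB, hH.TB⟩
  refine Run.seq (T₂ := N * (310 * M + 32) + 8 * n + 12) (run_edges (network_wellFormed d L)
    (hE.of_frame f1 rfl) hH1 (by rw [hs1]; simp [Program.ev]) (N := N) (by rw [f1.var _ rfl, hN])
    (leaf := toArray f) (by rw [f1.arr _ rfl, hleaf]) ?_ ?_ fun z hz => hsl1 _ _ _ (hslot z hz))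
    ?_ (by change 1 + L.num * 4994 + _ ≤ _; omega)
  · intro j hj
    rw [hfl ⟨j, hj⟩]
    exact (leafAt B L _).2
  · intro j hj j' hj' he
    rw [hfl ⟨j, hj⟩, hfl ⟨j', hj'⟩] at he
    have := L.edge.injective (B.leafOf.injective (Subtype.ext (Fin.ext he)))
    exact Fin.mk.inj this
  rintro s2 ⟨hE2, hH2, hs2⟩ f2
  refine Run.seq_straight (T₂ := N * (310 * M + 32) + 8 * n + 9) rfl (fun s3 hs3 f3 => ?_)
    (by change 3 + _ ≤ _; omega)
  have hE3 := hE2.of_frame f3 rfl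
  have hN3 : s3.var 2 = N := by rw [f3.var _ rfl, f2.var _ rfl, f1.var _ rfl, hN]
  have hx3 : s3.var Reg.x = 0 := by rw [hs3]; simp [block, Program.ev]
  have hS : Stripping d B L univ id 0 s3 := by
    refine ⟨hE3, ?_, contraction_univ B.isTree, fun y _ => ?_, fun y => ?_, fun y _ => ?_,
      by rw [hs3]; simp [block, Program.ev], Nat.zero_le _, by rw [hx3], fun z _ hz hzx => ?_,
      ⟨0, hpos⟩, mem_univ _, by rw [hs3]; simp [block, Program.ev]⟩
    · rw [hs3]; exact ⟨hH2.CA, hH2.CB, hH2.TB⟩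
    · have hown : owned B L id y = {j ∈ range L.num | toArray f j = y} := by
        refine filter_congr fun j hj => ?_
        rw [hfl ⟨j, mem_range.1 hj⟩, Fin.val_inj]
        simp [mem_range.1 hj]
      rw [hown, hs3]
      have h := hs2 y y.2
      exact ⟨h.nodup, h.list, h.counts, h.list_le, h.table, h.table_le⟩
    · rw [f3.arr _ rfl, f2.arr _ rfl, f1.arr _ rfl, if_pos (mem_univ _), hr]
    · rw [f3.arr _ rfl, f2.arr _ rfl, f1.arr _ rfl, hsm]
    · rw [hx3] at hzx
      omega
  refine Run.seq (T₂ := 8 * n + 8) (hS.run hN3) ?_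
    (by change N * (310 * M + 32) + 1 + _ ≤ _; omega)
  rintro s4 ⟨hE4, z, hz, hs4⟩ f4
  refine run_decode hE4 hd hz hs4 ?_
  rw [f4.arr _ rfl, f3.arr _ rfl, f2.arr _ rfl, f1.arr _ rfl]
  exact hout

/-- At most N unions during the contraction cost 310M each, and N ≤ 3m turns this into 930Mm. All
other terms are linear in n, N, m and the number of tree edges, and are charged to m and the
isolated vertices through n ≤ 2m + n₀ and N + 2 ≤ 3m; then M ≥ 1 allows writing Mm for m. -/
theorem run_minDominating (d : Fin n → ℕ) (B : BranchDecomposition G (Fin N)) (L : EdgeListing G)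
    (K : EdgeListing B.tree) : Run minDominating (inputState d B L K)
      (6162 * (Network.sizeBound B.width (maxDemand d + 1) * L.num) + 24 * numIsolated G)
      (CorrectOutput G d) := by
  set M := Network.sizeBound B.width (maxDemand d + 1) with hM
  set I := network d L with hI
  set J := network (fun _ => 0) K with hJ
  set s := inputState d B L K with hs
  have hwf := network_wellFormed d L
  have hM1 : 1 ≤ M := Network.one_le_sizeBound (Nat.le_add_left _ _)
  have hN := num_nodes_le B L
  have hn := card_le_two_mul_edges L
  have hK : K.num + 1 = N := by
    classical
    have h1 := B.isTree.card_edgeFinset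
    rwa [SimpleGraph.edgeFinset, ← Set.ncard_eq_toFinset_card', ← numEdges, numEdges_eq K,
      Fintype.card_fin] at h1
  have hmM : L.num ≤ M * L.num := Nat.le_mul_of_pos_left _ hM1
  have hMN : N * (310 * M) ≤ 930 * (M * L.num) := by
    have := Nat.mul_le_mul_right (310 * M) (show N ≤ 3 * L.num by omega)
    exact this.trans_eq (by ring)
  refine Run.seq (T₁ := L.num * 10 + n * 6 + 5) (T₂ := 18 * n + 6 * L.num + 16 * K.num + 24 +
    L.num * 4994 + N * (310 * M + 32) + 1) (run_prepare (I := I) hwf rfl rfl rfl rfl rfl rfl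
      fun _ => rfl) ?_ (by rw [mul_add]; omega)
  rintro s1 ⟨hone, hdeg, hbad⟩ f1
  have hzero : s1.var Reg.zero = 0 := f1.var _ rfl
  refine Run.ite (T := 18 * n + 6 * L.num + 16 * K.num + 24 + L.num * 4994 + N * (310 * M + 32))
    (fun hc => ?_) (fun hc => ?_) le_rfl
  · rw [hzero, hbad] at hc
    obtain ⟨v, hv, hlt⟩ := hc
    refine Run.straight rfl (by change 1 ≤ _; omega) (.inr ⟨by simp [Program.ev], fun S hS => ?_⟩)
    have h1 := (isTotalVectorDominating_iff d L S).1 hS ⟨v, hv⟩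
    exact absurd (h1.trans (Network.nbr_le_cnt _ _ _)) (Nat.not_le.2 hlt)
  · rw [hzero, hbad] at hc
    push Not at hc
    -- The program has reached this branch only because no demand exceeds its degree.
    have hsum : ∑ v ∈ range I.n, (10 + I.d v * 3) ≤ 10 * n + 6 * L.num := by
      have h1 := sum_le_sum fun v hv => hc v (mem_range.1 hv)
      have h2 : ∑ v ∈ range I.n, I.deg v ≤ 2 * L.num := Network.sum_deg_le hwf
      rw [sum_add_distrib, ← sum_mul, sum_const, card_range, smul_eq_mul]
      change n * 10 + _ ≤ _
      omega
    have hn1 : s1.var 0 = I.n := f1.var _ rfl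
    refine Run.seq (T₁ := 10 * n + 6 * L.num + 5) (T₂ := 8 * n + 16 * K.num + 19 +
      L.num * 4994 + N * (310 * M + 32)) ((run_placeValues (I := I) hn1 hone (f1.arr _ rfl)).mono
        (by omega) fun _ h => h) ?_ (by omega)
    rintro s2 ⟨hbig, hpn, hS, hP⟩ f2
    refine Run.seq (T₁ := K.num * 16 + 5) (T₂ := L.num * 4994 + N * (310 * M + 32) + 8 * n + 14)
      (run_setup (J := J) (network_wellFormed _ K) ((f2.var _ rfl).trans (f1.var _ rfl))
        (by rw [f2.var _ rfl, hone]) ((f2.arr _ rfl).trans (f1.arr _ rfl))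
        ((f2.arr _ rfl).trans (f1.arr _ rfl)) (by rw [f2.arr _ rfl, f1.arr _ rfl]; exact fun _ => rfl)
        (by rw [f2.arr _ rfl, f1.arr _ rfl]; exact fun _ => rfl)
        (by rw [f2.arr _ rfl, f1.arr _ rfl]; exact fun _ => rfl)) ?_ (by omega)
    rintro s3 ⟨htree, hop, hTB⟩ f3
    rw [hbig] at hop
    have harr : ∀ A, prepare.writesArr A = false → places.writesArr A = false →
        setup.writesArr A = false → s3.arr A = s.arr A := fun A h1 h2 h3 => by
      rw [f3.arr A h3, f2.arr A h2, f1.arr A h1]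
    have hvar : ∀ x, prepare.writesVar x = false → places.writesVar x = false →
        setup.writesVar x = false → s3.var x = s.var x := fun x h1 h2 h3 => by
      rw [f3.var x h3, f2.var x h2, f1.var x h1]
    have hE : Env I s3 := by
      refine ⟨hvar _ rfl rfl rfl, hvar _ rfl rfl rfl, ?_, hvar _ rfl rfl rfl, ?_, ?_,
        harr _ rfl rfl rfl, harr _ rfl rfl rfl, harr _ rfl rfl rfl, ?_, ?_, ?_⟩
      · rw [f3.var _ rfl, f2.var _ rfl, hone]
      · rw [f3.var _ rfl, hpn]
      · rw [f3.var _ rfl, hbig]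
      · rw [f3.arr _ rfl, f2.arr _ rfl]; exact fun v _ => hdeg v
      · rw [f3.arr _ rfl]; exact hS
      · rw [f3.arr _ rfl]; exact hP
    have hH : Heap s3 := by
      refine ⟨by rw [harr _ rfl rfl rfl]; exact fun _ => rfl,
        by rw [harr _ rfl rfl rfl]; exact fun _ => rfl, fun i hi => ?_⟩
      -- The only nonzero cell of the initial table has the address 0, which lies below the first
      -- free address.
      have := I.stride_pos I.n
      rw [hTB, if_neg (by omega)]
    refine run_solve hE hH (hvar _ rfl rfl rfl) hc (harr _ rfl rfl rfl)
      (fun z _ => slot_empty ?_ ?_ ?_ hop hTB) (fun y => ?_) (fun y => ?_) ?_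
    · rw [harr _ rfl rfl rfl]; rfl
    · rw [harr _ rfl rfl rfl]; rfl
    · rw [harr _ rfl rfl rfl]; rfl
    · rw [(htree y).1, deg_network, card_liveNbrs_univ]
    · rw [(htree y).2]; exact nbrSum_network K y
    · rw [harr _ rfl rfl rfl]; exact fun _ => rfl

end
end TVD

/-- One fixed program and one absolute constant serve all graphs, demands and branch decompositions
(of any width `b`). -/
theorem theorem2 :
    ∃ (P : TVD.Program) (C : ℝ), 0 < C ∧
      ∀ (n : ℕ) (G : SimpleGraph (Fin n)) (d : Fin n → ℕ)
        (N : ℕ) (B : TVD.BranchDecomposition G (Fin N)) (b : ℕ), B.width = b →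
      ∀ (L : TVD.EdgeListing G) (K : TVD.EdgeListing B.tree),
        ∃ (t : ℕ) (s : TVD.State),
          TVD.Exec P (TVD.inputState d B L K) t s ∧
          TVD.CorrectOutput G d s ∧
          (t : ℝ) ≤ C * ((2 : ℝ) ^ ((3 * (b : ℝ)) / 2) * ((TVD.maxDemand d : ℝ) + 1) ^ (2 * b)
            * (TVD.numEdges G : ℝ) + (TVD.numIsolated G : ℝ)) := by
  refine ⟨TVD.minDominating, 6162, by norm_num, fun n G d N B b hb L K => ?_⟩
  obtain ⟨t, s, he, ht, hs⟩ := TVD.run_minDominating d B L K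
  refine ⟨t, s, he, hs, ?_⟩
  have h1 := TVD.Network.sizeBound_le b (TVD.maxDemand d + 1)
  have h2 : (t : ℝ) ≤ 6162 * (TVD.Network.sizeBound b (TVD.maxDemand d + 1) * L.num) +
      24 * TVD.numIsolated G := by
    rw [hb] at ht
    exact_mod_cast ht
  push_cast at h1
  have h3 := mul_le_mul_of_nonneg_right h1 (Nat.cast_nonneg (α := ℝ) L.num)
  have h4 := Nat.cast_nonneg (α := ℝ) (TVD.numIsolated G)
  rw [TVD.numEdges_eq L]
  linarith
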